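/- Let $\nu$ be a Borel probability measure on $\mathbb{R}^q$ (the law of the covariates $X$), let $J\ge 0$, and for $j=1,\dots,J$ let $h_j(\cdot\mid x)$ be a probability distribution on $\mathbb{R}$ depending measurably on $x\in\mathbb{R}^q$ (the estimate distribution of the $j$-th candidate propensity score model), with $\int\!\int f^2\,h_j(df\mid x)\,\nu(dx)<\infty$; this holds, for instance, whenever the estimates take values in $[0,1]$, and $h_j(\cdot\mid x)$ may be a point mass at a value $\pi_j(x)$. For weight functions $\delta=(\delta_0,\dots,\delta_J)$ the logistic synthesis model says that a unit with covariate $x$ has treatment $Z=z\in\{0,1\}$ with probability $$q_\delta(z\mid x)=\int\frac{\exp\{z(\delta_0(x)+\sum_{j=1}^J\delta_j(x)f_j)\}}{1+\exp(\delta_0(x)+\sum_{j=1}^J\delta_j(x)f_j)}\prod_{j=1}^J h_j(df_j\mid x),$$ independently over units. For point masses at $\pi_j(x)$ this is the logistic link of $\delta_0(x)+\sum_j\delta_j(x)\pi_j(x)$. Let the prior $\Pi$ on $\delta$ make $\delta_0,\dots,\delta_J$ independent jointly measurable Gaussian processes, $\delta_j\sim\mathrm{GP}(m_j,C_j)$,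 whose sample paths lie almost surely in the separable complete space $L^2(\nu)$. Given $D_n=\{(X_i,Z_i)\}_{i=1}^n$, let $$\hat\pi_n(x)=\frac{\int q_\delta(1\mid x)\prod_{i=1}^n q_\delta(Z_i\mid X_i)\,\Pi(d\delta)}{\sum_{z\in\{0,1\}}\int q_\delta(z\mid x)\prod_{i=1}^n q_\delta(Z_i\mid X_i)\,\Pi(d\delta)}$$ be the posterior predictive mean of the treatment of a new unit with covariate $x$. Suppose that the true treatment law $p^*(z\mid x)$ lies inside the model: there are $\delta_0^*,\dots,\delta_J^*\in L^2(\nu)$ with $p^*(z\mid x)=q_{\delta^*}(z\mid x)$ for $z\in\{0,1\}$ and $\nu$-almost every $x$, and the prior puts positive mass around $\delta^*$, that is, $\Pi\big(\|\delta_j-\delta_j^*\|_{L^2(\nu)}<\varepsilon,\ j=0,\dots,J\big)>0$ for every $\varepsilon>0$. Let $(X_i,Z_i)$, $i\ge1$, be i.i.d. with $X_i\sim\nu$ and $Z_i\mid X_i\sim p^*(\cdot\mid X_i)$, and let $X\sim\nu$ be independent of the data. Then, with $\pi_*(x)=p^*(1\mid x)$, $$\hat\pi_n(X)\xrightarrow{\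 p\ }\pi_*(X)\qquad(n\to\infty),$$ that is, $\Pr\big(|\hat\pi_n(X)-\pi_*(X)|\ge\varepsilon\big)\to0$ for every $\varepsilon>0$. -/

import Mathlib

open MeasureTheory ProbabilityTheory Filter Topology

open scoped ENNReal

noncomputable section

namespace BRS

variable {𝒳 Θ : Type*} [MeasurableSpace 𝒳] [MeasurableSpace Θ] {J : ℕ}

/-- The linear predictor `η = d₀ + ∑ j, d_j f_j` with weights `d` and candidate estimates `f`. -/
def linearPredictor (d : Fin (J + 1) → ℝ) (f : Fin J → ℝ) : ℝ :=
  d 0 + ∑ j : Fin J, d j.succ * f j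

/-- The logistic synthesis function `exp (z η) / (1 + exp η)`; here `true` is treatment `Z = 1`
and `false` is `Z = 0`. -/
def synthesis (d : Fin (J + 1) → ℝ) (f : Fin J → ℝ) (z : Bool) : ℝ :=
  Real.exp ((z.toNat : ℝ) * linearPredictor d f) / (1 + Real.exp (linearPredictor d f))

/-- The treatment probability of one unit with covariate `x` under the synthesis model with
weights `d = (δ₀(x), …, δ_J(x))`: the synthesis function is integrated over independent estimates
`f_j ∼ h_j(· | x)`. If every `h_j(· | x)` is a point mass at `π_j(x)`, this is the plain logistic
link of `δ₀(x) + ∑ j, δ_j(x) π_j(x)`. -/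
def unitProb (h : Fin J → Kernel 𝒳 ℝ) (d : Fin (J + 1) → ℝ) (x : 𝒳) (z : Bool) : ℝ :=
  ∫ f : Fin J → ℝ, synthesis d f z ∂(Measure.pi fun j => h j x)

/-- The likelihood of treatments `z₁, …, z_n` at covariates `x₁, …, x_n` for given weight
functions `δ₀, …, δ_J`, the candidate estimates being integrated out. -/
def likelihood (h : Fin J → Kernel 𝒳 ℝ) (δ : Fin (J + 1) → 𝒳 → ℝ) {n : ℕ}
    (x : Fin n → 𝒳) (z : Fin n → Bool) : ℝ :=
  ∏ i : Fin n, unitProb h (fun j => δ j (x i)) (x i) (z i)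

/-- The probability of `z₁, …, z_n` given `x₁, …, x_n` under the Bayesian model: the likelihood
integrated with respect to the prior on the weight functions. The prior is the law of the random
functions `x ↦ δ j x θ`, where `θ` is drawn from `Q`. -/
def marginal (h : Fin J → Kernel 𝒳 ℝ) (Q : Measure Θ) (δ : Fin (J + 1) → 𝒳 → Θ → ℝ) {n : ℕ}
    (x : Fin n → 𝒳) (z : Fin n → Bool) : ℝ :=
  ∫ θ, likelihood h (fun j y => δ j y θ) x z ∂Q

/-- The posterior predictive probability of treatment `b` for a new unit with covariate `x`, given
the data `(x₁, z₁), …, (x_n, z_n)`. -/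
def predictive (h : Fin J → Kernel 𝒳 ℝ) (Q : Measure Θ) (δ : Fin (J + 1) → 𝒳 → Θ → ℝ) {n : ℕ}
    (xs : Fin n → 𝒳) (zs : Fin n → Bool) (x : 𝒳) (b : Bool) : ℝ :=
  marginal h Q δ (Fin.snoc (α := fun _ => 𝒳) xs x) (Fin.snoc (α := fun _ => Bool) zs b) /
    ∑ c : Bool,
      marginal h Q δ (Fin.snoc (α := fun _ => 𝒳) xs x) (Fin.snoc (α := fun _ => Bool) zs c)

/-- The synthesized propensity score: the posterior predictive mean of the treatment indicator of a
new unit with covariate `x`. -/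
def propensityEstimate (h : Fin J → Kernel 𝒳 ℝ) (Q : Measure Θ) (δ : Fin (J + 1) → 𝒳 → Θ → ℝ)
    {n : ℕ} (xs : Fin n → 𝒳) (zs : Fin n → Bool) (x : 𝒳) : ℝ :=
  ∑ b : Bool, (b.toNat : ℝ) * predictive h Q δ xs zs x b

/-- `δ₀, …, δ_J` are independent Gaussian processes, `δ_j ∼ GP(m_j, C_j)`, realized as jointly
measurable processes over `(Θ, Q)`, with almost all sample paths in the parameter space
`L²(ν)`. -/
structure IsGPPrior (ν : Measure 𝒳) (Q : Measure Θ) (δ : Fin (J + 1) → 𝒳 → Θ → ℝ)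
    (m : Fin (J + 1) → 𝒳 → ℝ) (C : Fin (J + 1) → 𝒳 → 𝒳 → ℝ) : Prop where
  measurable : ∀ j, Measurable (Function.uncurry (δ j))
  gaussian : ∀ j, IsGaussianProcess (δ j) Q
  mean : ∀ j x, ∫ θ, δ j x θ ∂Q = m j x
  cov : ∀ j x y, covariance (δ j x) (δ j y) Q = C j x y
  indep : iIndepFun (fun j θ x => δ j x θ) Q
  memLp : ∀ j, ∀ᵐ θ ∂Q, MemLp (fun x => δ j x θ) 2 ν

end BRS

end

/-!
The estimate `π̂ₙ(x)` is the posterior mean of `q_δ(1 ∣ x)`, so its mean error over a set `E` of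
covariates is at most the posterior mean of `d(δ) = ∫_E |q_δ(1 ∣ x) - π⋆(x)| ν(dx)`
(`setLIntegral_error_mul_le`). As `d ≤ 1`, it is enough that the posterior mass of `{d ≥ ε}` tends
to zero in probability. The set `E` carries all but a small part of `ν` and is chosen such that the
prior variances and the first moments of the candidate estimates are bounded on it
(`exists_truncation`).

Two facts on the likelihood relative to the truth give the decay of the posterior mass.

*Denominator.* The logarithm of the logistic link is 1-Lipschitz, hence the log-likelihood ratio of
one observation is bounded below by minus a nonnegative function whose mean under the truth is at
most a linear combination, with finite coefficients, of the distances `‖δ_j - δ⋆_j‖` in `L²(ν)`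
(`lintegral_processLogRatioBound_le`). The mass condition on the prior and Markov's inequality show
that the marginal likelihood, relative to the likelihood of the truth, is at least of the order of
`exp (-κ n)`, for every `κ > 0`, with probability close to one
(`measure_lintegral_relLikelihood_lt_le`).

*Numerator.* On a set `A` of parameters that are separated from the truth by one bounded test, the
square root of the integrated likelihood has mean at most `Q(A)^(1/2) exp (-b n)`
(`lintegral_sqrt_setLIntegral_relLikelihood_le`). For a cell of parameters that are close to each
other in `L¹` on `E`, the sign of the deviation of one of its members from the truth is such a test
(`exists_cell_test`). Summation over the cells needs a partition of the prior into small cells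
with `∑ Q(A)^(1/2) ≤ exp (a n)` for arbitrarily small `a`, up to exponentially small prior mass
(`tendsto_measure_posterior_mass`).

Such cells exist for every square integrable Gaussian process, without any smoothness of the paths
(`exists_gaussianProcess_covering`). A jointly measurable process is approximated in mean square by
its values at finitely many points (`exists_sampling_approx`), so it lies near a subspace whose
dimension does not depend on `n`. In the principal axes of a Gaussian vector, at most of the order
of `c n` axes have variance above a constant multiple of `1 / (c n)`, where `c` may be chosen as
small as `a` requires; these axes are cut into intervals (`tsum_sqrt_cells_le`). The sum of squares
over the other axes is small, and a Chernoff bound makes the exceptional event exponentially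
unlikely (`exists_gaussian_covering`).
-/

namespace BRS

open scoped NNReal RealInnerProductSpace

/-! ### Sampling a square integrable process at finitely many index points -/

/-- A function on `T × Θ` that depends on its first argument only through a finite measurable
partition of `T`. -/
def IsPartitionwise {T Θ : Type*} [MeasurableSpace T] [MeasurableSpace Θ] (g : T × Θ → ℝ) : Prop :=
  ∃ (ι : Type) (_ : Fintype ι) (p : T → ι) (k : ι → Θ → ℝ),
    (∀ i, MeasurableSet (p ⁻¹' {i})) ∧ (∀ i, Measurable (k i)) ∧ g = fun z => k (p z.1) z.2

/-- The algebra of subsets of `T × Θ` whose sections over `T` take finitely many values. -/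
def partitionwiseSets (T Θ : Type*) [MeasurableSpace T] [MeasurableSpace Θ] : Set (Set (T × Θ)) :=
  {S | ∃ (ι : Type) (_ : Fintype ι) (p : T → ι) (B : ι → Set Θ),
    (∀ i, MeasurableSet (p ⁻¹' {i})) ∧ (∀ i, MeasurableSet (B i)) ∧ S = {z | z.2 ∈ B (p z.1)}}

section

variable {T Θ : Type*} [MeasurableSpace T] [MeasurableSpace Θ]

lemma measurableSet_preimage_pair {ι κ : Type} {p : T → ι} {r : T → κ}
    (hp : ∀ i, MeasurableSet (p ⁻¹' {i})) (hr : ∀ i, MeasurableSet (r ⁻¹' {i})) (i : ι × κ) :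
    MeasurableSet ((fun t => (p t, r t)) ⁻¹' {i}) := by
  have : ((fun t => (p t, r t)) ⁻¹' {i}) = p ⁻¹' {i.1} ∩ r ⁻¹' {i.2} := by
    ext t; simp [Prod.ext_iff]
  rw [this]
  exact (hp _).inter (hr _)

lemma measurable_partitionwise {β : Type*} [MeasurableSpace β] {ι : Type} [Fintype ι] {p : T → ι}
    (hp : ∀ i, MeasurableSet (p ⁻¹' {i})) {k : ι → Θ → β} (hk : ∀ i, Measurable (k i)) :
    Measurable fun z : T × Θ => k (p z.1) z.2 := by
  let _ : MeasurableSpace ι := ⊤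
  have hp' : Measurable p := measurable_to_countable' hp
  have : Measurable fun z : ι × Θ => k z.1 z.2 := measurable_from_prod_countable_right hk
  exact this.comp ((hp'.comp measurable_fst).prodMk measurable_snd)

lemma isSetAlgebra_partitionwiseSets : IsSetAlgebra (partitionwiseSets T Θ) where
  empty_mem := ⟨Unit, inferInstance, fun _ => (), fun _ => ∅, by simp, by simp, by simp⟩
  compl_mem := by
    rintro S ⟨ι, _, p, B, hp, hB, rfl⟩
    exact ⟨ι, inferInstance, p, fun i => (B i)ᶜ, hp, fun i => (hB i).compl, rfl⟩
  union_mem := by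
    rintro S S' ⟨ι, _, p, B, hp, hB, rfl⟩ ⟨κ, _, r, D, hr, hD, rfl⟩
    exact ⟨ι × κ, inferInstance, fun t => (p t, r t), fun i => B i.1 ∪ D i.2,
      measurableSet_preimage_pair hp hr, fun i => (hB _).union (hD _), rfl⟩

lemma generateFrom_partitionwiseSets :
    (Prod.instMeasurableSpace : MeasurableSpace (T × Θ)) =
      MeasurableSpace.generateFrom (partitionwiseSets T Θ) := by
  classical
  apply le_antisymm
  · rw [← generateFrom_prod]
    apply MeasurableSpace.generateFrom_mono
    rintro _ ⟨s, hs, t, ht, rfl⟩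
    refine ⟨Bool, inferInstance, fun x => decide (x ∈ s), fun b => if b then t else ∅, ?_, ?_, ?_⟩
    · intro b
      cases b
      · have : ((fun x => decide (x ∈ s)) ⁻¹' {false}) = sᶜ := by ext; simp
        rw [this]; exact hs.compl
      · have : ((fun x => decide (x ∈ s)) ⁻¹' {true}) = s := by ext; simp
        rw [this]; exact hs
    · intro b; cases b
      · simp
      · simpa using ht
    · ext z
      by_cases h : z.1 ∈ s <;> simp [h]
  · apply MeasurableSpace.generateFrom_le
    rintro S ⟨ι, _, p, B, hp, hB, rfl⟩
    have := measurable_partitionwise (β := Prop) hp (k := fun i θ => θ ∈ B i)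
      (fun i => measurable_mem.2 (hB i))
    exact measurableSet_setOfPred.2 this

/-- Functions that depend on `T` only through a finite partition are dense in `L²(ρ ⊗ Q)`. -/
lemma exists_isPartitionwise_approx (ρ : Measure T) [IsFiniteMeasure ρ] (Q : Measure Θ)
    [IsFiniteMeasure Q] {Y : T × Θ → ℝ} (hY : MemLp Y 2 (ρ.prod Q)) {ε : ℝ≥0∞} (hε : ε ≠ 0) :
    ∃ g : T × Θ → ℝ, eLpNorm (Y - g) 2 (ρ.prod Q) ≤ ε ∧ IsPartitionwise g := by
  classical
  refine hY.induction_dense (by simp) IsPartitionwise ?_ ?_ ?_ hε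
  · intro c s hs _ ε hε
    obtain ⟨η, hη, h⟩ := exists_eLpNorm_indicator_le (p := 2) (μ := ρ.prod Q) (by simp) c hε
    obtain ⟨S, hS, hlt⟩ := (Measure.MeasureDense.of_generateFrom_isSetAlgebra_finite (μ := ρ.prod Q)
      isSetAlgebra_partitionwiseSets generateFrom_partitionwiseSets).approx s hs (by simp) η
      (by exact_mod_cast hη)
    refine ⟨S.indicator fun _ => c, ?_, ?_⟩
    · have hle := h (symmDiff s S) (by simpa using hlt.le)
      refine (eLpNorm_mono fun z => ?_).trans hle
      by_cases h1 : z ∈ s <;> by_cases h2 : z ∈ S <;>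
        simp [h1, h2, Set.mem_symmDiff]
    · obtain ⟨ι, _, p, B, hp, hB, rfl⟩ := hS
      refine ⟨ι, inferInstance, p, fun i => (B i).indicator fun _ => c, hp,
        fun i => measurable_const.indicator (hB i), ?_⟩
      ext z
      by_cases h1 : z.2 ∈ B (p z.1) <;> simp [h1]
  · rintro f g ⟨ι, _, p, k, hp, hk, rfl⟩ ⟨κ, _, r, l, hr, hl, rfl⟩
    exact ⟨ι × κ, inferInstance, fun t => (p t, r t), fun i => k i.1 + l i.2,
      measurableSet_preimage_pair hp hr, fun i => (hk _).add (hl _), rfl⟩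
  · rintro f ⟨ι, _, p, k, hp, hk, rfl⟩
    exact (measurable_partitionwise hp hk).aestronglyMeasurable

/-- A square integrable process is approximated in mean square by its values at finitely many
index points, each point standing for one cell of a measurable partition of the index set. -/
lemma exists_sampling_approx [Nonempty T] (ρ : Measure T) [IsFiniteMeasure ρ] (Q : Measure Θ)
    [IsFiniteMeasure Q] {Y : T → Θ → ℝ} (hYm : Measurable (Function.uncurry Y))
    (hY : MemLp (Function.uncurry Y) 2 (ρ.prod Q)) {ε : ℝ≥0∞} (hε : ε ≠ 0) :
    ∃ (ι : Type) (_ : Fintype ι) (p : T → ι) (t : ι → T), (∀ i, MeasurableSet (p ⁻¹' {i})) ∧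
      ∫⁻ x, ∫⁻ θ, ‖Y x θ - Y (t (p x)) θ‖ₑ ^ 2 ∂Q ∂ρ ≤ ε := by
  classical
  obtain ⟨ε', hε', hε4⟩ : ∃ ε' : ℝ≥0∞, ε' ≠ 0 ∧ 4 * ε' ^ 2 ≤ ε := by
    by_cases htop : ε = ⊤
    · exact ⟨1, by simp, by simp [htop]⟩
    · refine ⟨ENNReal.ofReal (Real.sqrt ε.toReal / 2), ?_, ?_⟩
      · have := ENNReal.toReal_pos hε htop
        simp only [ne_eq, ENNReal.ofReal_eq_zero, not_le]
        positivity
      · rw [← ENNReal.ofReal_pow (by positivity), div_pow, Real.sq_sqrt (by positivity)]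
        rw [show (4 : ℝ≥0∞) = ENNReal.ofReal 4 by simp, ← ENNReal.ofReal_mul (by norm_num)]
        rw [show 4 * (ε.toReal / 2 ^ 2) = ε.toReal by ring, ENNReal.ofReal_toReal htop]
  obtain ⟨g, hg, ι, _, p, k, hp, hk, rfl⟩ := exists_isPartitionwise_approx ρ Q hY hε'
  let _ : MeasurableSpace ι := ⊤
  have hpm : Measurable p := measurable_to_countable' hp
  set e : T → ι → ℝ≥0∞ := fun x i => ∫⁻ θ, ‖Y x θ - k i θ‖ₑ ^ 2 ∂Q with he
  have hem : ∀ i, Measurable fun x => e x i := fun i => by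
    have : Measurable (fun z : T × Θ => ‖Y z.1 z.2 - k i z.2‖ₑ ^ 2) :=
      (((hYm.sub ((hk i).comp measurable_snd)).enorm).pow_const 2)
    exact this.lintegral_prod_right'
  have htot : ∫⁻ x, e x (p x) ∂ρ ≤ ε' ^ 2 := by
    have h1 : eLpNorm (Function.uncurry Y - fun z => k (p z.1) z.2) 2 (ρ.prod Q) ^ 2
        = ∫⁻ x, e x (p x) ∂ρ := by
      rw [eLpNorm_eq_lintegral_rpow_enorm_toReal (by simp) (by simp), ← ENNReal.rpow_natCast,
        ← ENNReal.rpow_mul]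
      simp only [ENNReal.toReal_ofNat, Nat.cast_ofNat, one_div, isUnit_iff_ne_zero, ne_eq,
        OfNat.ofNat_ne_zero, not_false_eq_true, IsUnit.inv_mul_cancel, ENNReal.rpow_one,
        ENNReal.rpow_ofNat, Pi.sub_apply]
      have hm : Measurable fun z : T × Θ => ‖Function.uncurry Y z - k (p z.1) z.2‖ₑ ^ 2 :=
        ((hYm.sub (measurable_partitionwise hp hk)).enorm).pow_const 2
      rw [lintegral_prod _ hm.aemeasurable]
      rfl
    rw [← h1]
    exact pow_le_pow_left' hg 2
  have hchoose : ∀ i, ∃ t : T, e t i * ρ (p ⁻¹' {i}) ≤ ∫⁻ x in p ⁻¹' {i}, e x i ∂ρ := by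
    intro i
    by_cases h0 : ρ (p ⁻¹' {i}) = 0
    · obtain ⟨t⟩ := ‹Nonempty T›
      exact ⟨t, by simp [h0]⟩
    · obtain ⟨t, -, ht⟩ := exists_le_setLAverage (μ := ρ) (s := p ⁻¹' {i}) h0 (by simp)
        (hem i).aemeasurable
      refine ⟨t, ?_⟩
      rw [setLAverage_eq] at ht
      exact ENNReal.mul_le_of_le_div ht
  choose t ht using hchoose
  have hsum : ∀ F : ι → T → ℝ≥0∞, (∫⁻ x, F (p x) x ∂ρ) = ∑ i, ∫⁻ x in p ⁻¹' {i}, F i x ∂ρ := by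
    intro F
    have h1 : (∫⁻ x, F (p x) x ∂ρ) =
        ∫⁻ x in ⋃ i ∈ (Finset.univ : Finset ι), p ⁻¹' {i}, F (p x) x ∂ρ := by
      have : (⋃ i ∈ (Finset.univ : Finset ι), p ⁻¹' {i}) = Set.univ := by ext; simp
      rw [this, setLIntegral_univ]
    rw [h1, lintegral_biUnion_finset ?_ fun i _ => hp i]
    · refine Finset.sum_congr rfl fun i _ => setLIntegral_congr_fun (hp i) ?_
      intro x hx
      simp only [Set.mem_preimage, Set.mem_singleton_iff] at hx
      simp [hx]
    · intro i _ j _ hij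
      exact Disjoint.preimage _ (by simpa using hij)
  refine ⟨ι, inferInstance, p, t, hp, ?_⟩
  have htp : ∫⁻ x, e (t (p x)) (p x) ∂ρ ≤ ε' ^ 2 := by
    refine le_trans ?_ htot
    rw [hsum fun i x => e x i, hsum fun i _ => e (t i) i]
    refine Finset.sum_le_sum fun i _ => ?_
    rw [setLIntegral_const]
    exact ht i
  have hpt : ∀ x, ∫⁻ θ, ‖Y x θ - Y (t (p x)) θ‖ₑ ^ 2 ∂Q ≤ 2 * (e x (p x) + e (t (p x)) (p x)) := by
    intro x
    have hm : ∀ x i, Measurable fun θ => ‖Y x θ - k i θ‖ₑ ^ 2 := fun x i =>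
      (((hYm.comp measurable_prodMk_left).sub (hk i)).enorm).pow_const 2
    have hm2 : Measurable fun θ =>
        ‖Y x θ - k (p x) θ‖ₑ ^ 2 + ‖Y (t (p x)) θ - k (p x) θ‖ₑ ^ 2 := (hm _ _).add (hm _ _)
    rw [he, ← lintegral_add_left (hm _ _), ← lintegral_const_mul _ hm2]
    refine lintegral_mono fun θ => ?_
    have h1 : ‖Y x θ - Y (t (p x)) θ‖ₑ ≤ ‖Y x θ - k (p x) θ‖ₑ + ‖Y (t (p x)) θ - k (p x) θ‖ₑ := by
      rw [show Y x θ - Y (t (p x)) θ = (Y x θ - k (p x) θ) - (Y (t (p x)) θ - k (p x) θ) by ring]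
      exact enorm_sub_le
    refine (pow_le_pow_left' h1 2).trans ?_
    have := ENNReal.rpow_add_le_mul_rpow_add_rpow ‖Y x θ - k (p x) θ‖ₑ ‖Y (t (p x)) θ - k (p x) θ‖ₑ
      (p := 2) (by norm_num)
    norm_num at this
    exact this
  calc ∫⁻ x, ∫⁻ θ, ‖Y x θ - Y (t (p x)) θ‖ₑ ^ 2 ∂Q ∂ρ
      ≤ ∫⁻ x, 2 * (e x (p x) + e (t (p x)) (p x)) ∂ρ := lintegral_mono hpt
    _ = 2 * (∫⁻ x, e x (p x) ∂ρ + ∫⁻ x, e (t (p x)) (p x) ∂ρ) := by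
        have hm1 : Measurable fun x => e x (p x) := by
          have : Measurable fun z : T × ι => e z.1 z.2 := measurable_from_prod_countable_left hem
          exact this.comp (measurable_id.prodMk hpm)
        have hm2 : Measurable fun x => e (t (p x)) (p x) :=
          (measurable_from_top (f := fun i => e (t i) i)).comp hpm
        have hm3 : Measurable fun x => e x (p x) + e (t (p x)) (p x) := hm1.add hm2
        rw [lintegral_const_mul _ hm3, lintegral_add_left hm1]
    _ ≤ 2 * (ε' ^ 2 + ε' ^ 2) := by gcongr
    _ = 4 * ε' ^ 2 := by ring
    _ ≤ ε := hε4

end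

/-! ### Gaussian vectors: exponential moments, cells and principal axes -/

/-- Exponential moment of the square of a centred Gaussian variable. -/
lemma lintegral_exp_sq_gaussianReal_le (v : ℝ≥0) {a : ℝ} (ha : 0 ≤ a) (hav : 2 * a * v ≤ 1 / 2) :
    ∫⁻ x, ENNReal.ofReal (Real.exp (a * x ^ 2)) ∂(gaussianReal 0 v) ≤
      ENNReal.ofReal (Real.exp (2 * a * v)) := by
  by_cases hv : v = 0
  · subst hv
    simp only [gaussianReal_zero_var]
    rw [lintegral_dirac' _ (by fun_prop)]
    simp
  have hv0 : (0 : ℝ) < v := by positivity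
  rw [gaussianReal_of_var_ne_zero _ hv, lintegral_withDensity_eq_lintegral_mul _
    (measurable_gaussianPDF 0 v) (by fun_prop)]
  set b : ℝ := 1 / (2 * v) - a with hb
  have hbpos : 0 < b := by
    rw [hb, sub_pos, lt_div_iff₀ (by positivity)]
    nlinarith
  have h1 : ∀ x : ℝ, (gaussianPDF 0 v * fun x => ENNReal.ofReal (Real.exp (a * x ^ 2))) x =
      ENNReal.ofReal ((√(2 * Real.pi * v))⁻¹ * Real.exp (-b * x ^ 2)) := by
    intro x
    simp only [Pi.mul_apply, gaussianPDF, gaussianPDFReal]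
    rw [← ENNReal.ofReal_mul (by positivity), mul_assoc, ← Real.exp_add]
    congr 3
    rw [hb]; field_simp; ring
  simp_rw [h1]
  rw [← ofReal_integral_eq_lintegral_ofReal ((integrable_exp_neg_mul_sq hbpos).const_mul _)
    (Eventually.of_forall fun x => by positivity), integral_const_mul, integral_gaussian]
  apply ENNReal.ofReal_le_ofReal
  rw [← Real.sqrt_inv, ← Real.sqrt_mul (by positivity)]
  have hu : (2 * Real.pi * v)⁻¹ * (Real.pi / b) = (1 - 2 * a * v)⁻¹ := by
    have : b = (1 - 2 * a * v) / (2 * v) := by rw [hb]; field_simp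
    rw [this]
    have : (1 - 2 * a * v) ≠ 0 := by linarith
    field_simp
  rw [hu]
  apply Real.sqrt_le_iff.2 ⟨by positivity, ?_⟩
  rw [← Real.exp_nat_mul]
  set u : ℝ := 2 * a * v
  have hu0 : 0 ≤ u := by positivity
  rw [inv_le_iff_one_le_mul₀ (by linarith)]
  have := Real.add_one_le_exp (((2 : ℕ) : ℝ) * u)
  push_cast at this ⊢
  nlinarith [Real.exp_pos (2 * u)]

section

variable {Θ : Type*} [MeasurableSpace Θ] {Q : Measure Θ}

/-- The constant in `tsum_sqrt_cell_le`: the part of the bound that does not depend on the random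
variable. The sum comes from the weights `1 + i²` of the cells. -/
noncomputable def cellConst : ℝ := 3 + ∑' i : ℤ, (1 / (1 + (i : ℝ) ^ 2))

lemma cellConst_pos : 0 < cellConst := by
  have : 0 ≤ ∑' i : ℤ, (1 / (1 + (i : ℝ) ^ 2)) := tsum_nonneg fun i => by positivity
  unfold cellConst; linarith

lemma summable_one_div_one_add_int_sq : Summable fun i : ℤ => (1 / (1 + (i : ℝ) ^ 2)) := by
  refine Summable.of_nonneg_of_le (fun i => by positivity) (fun i => ?_)
    ((Real.summable_one_div_int_pow (p := 2)).2 (by norm_num) |>.add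
      (summable_of_hasFiniteSupport (f := fun i : ℤ => if i = 0 then (1 : ℝ) else 0)
        ((Set.finite_singleton 0).subset fun i hi => by simpa using hi)))
  by_cases hi : i = 0
  · simp [hi]
  · simp only [hi, if_false, add_zero]
    have : (0 : ℝ) < (i : ℝ) ^ 2 := by positivity
    exact one_div_le_one_div_of_le this (by linarith)

/-- The sum of the square roots of the cell probabilities of a real random variable, for cells of
width `w`, is bounded through its second moment: the cell with index `i` gets the weight
`1 + i²`. -/
lemma tsum_sqrt_cell_le [IsProbabilityMeasure Q] {g : Θ → ℝ} (hg : Measurable g)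
    (hgL : MemLp g 2 Q) {w : ℝ} (hw : 0 < w) :
    ∑' i : ℤ, (Q {θ | ⌊g θ / w⌋ = i}) ^ (1 / 2 : ℝ) ≤
      ENNReal.ofReal (cellConst + (∫ θ, g θ ^ 2 ∂Q) / w ^ 2) := by
  have hsum := summable_one_div_one_add_int_sq
  unfold cellConst
  set C : ℝ := ∑' i : ℤ, (1 / (1 + (i : ℝ) ^ 2)) with hC
  have hC0 : 0 ≤ C := tsum_nonneg fun i => by positivity
  set f : Θ → ℤ := fun θ => ⌊g θ / w⌋ with hf
  have hfm : Measurable f := Int.measurable_floor.comp (hg.div_const w)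
  have hint : Integrable (fun θ => g θ ^ 2) Q := hgL.integrable_sq
  have hw1 : ∑' i : ℤ, ENNReal.ofReal (1 + (i : ℝ) ^ 2) * Q {θ | f θ = i} ≤
      ENNReal.ofReal (3 + 2 * ((∫ θ, g θ ^ 2 ∂Q) / w ^ 2)) := by
    have h1 : ∑' i : ℤ, ENNReal.ofReal (1 + (i : ℝ) ^ 2) * Q {θ | f θ = i} =
        ∫⁻ θ, ENNReal.ofReal (1 + (f θ : ℝ) ^ 2) ∂Q := by
      rw [← lintegral_map (f := fun i : ℤ => ENNReal.ofReal (1 + (i : ℝ) ^ 2)) (by fun_prop) hfm,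
        lintegral_countable']
      refine tsum_congr fun i => ?_
      rw [Measure.map_apply hfm (measurableSet_singleton i)]
      rfl
    rw [h1]
    have h2 : ∫ θ, (3 + 2 * (g θ ^ 2 / w ^ 2)) ∂Q = 3 + 2 * ((∫ θ, g θ ^ 2 ∂Q) / w ^ 2) := by
      rw [integral_add (integrable_const _) ((hint.div_const _).const_mul _), integral_const_mul,
        integral_div]
      simp
    have h2i : Integrable (fun θ => 3 + 2 * (g θ ^ 2 / w ^ 2)) Q :=
      (integrable_const _).add ((hint.div_const _).const_mul _)
    rw [← h2, ofReal_integral_eq_lintegral_ofReal h2i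
      (Eventually.of_forall fun θ => by
        have : 0 ≤ g θ ^ 2 / w ^ 2 := by positivity
        simp only [Pi.zero_apply]; linarith)]
    refine lintegral_mono fun θ => ENNReal.ofReal_le_ofReal ?_
    have h3 := Int.floor_le (g θ / w)
    have h4 := Int.lt_floor_add_one (g θ / w)
    rw [← div_pow]
    set y := g θ / w
    have h5 : |((f θ : ℤ) : ℝ) - y| ≤ 1 := by
      rw [abs_le]; constructor <;> simp only [hf] <;> linarith
    have h6 := abs_le.1 h5
    nlinarith [sq_nonneg (((f θ : ℤ) : ℝ) - 2 * y), sq_abs (((f θ : ℤ) : ℝ) - y),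
      abs_nonneg (((f θ : ℤ) : ℝ) - y)]
  -- `√p ≤ A p / 2 + 1 / A` for the weight `A = 1 + i²`, by the arithmetic-geometric mean inequality
  have hpt : ∀ i : ℤ, (Q {θ | f θ = i}) ^ (1 / 2 : ℝ) ≤
      ENNReal.ofReal (1 / 2) * (ENNReal.ofReal (1 + (i : ℝ) ^ 2) * Q {θ | f θ = i}) +
        ENNReal.ofReal (1 / (1 + (i : ℝ) ^ 2)) := by
    intro i
    set p := (Q {θ | f θ = i}).toReal with hp
    have hp0 : 0 ≤ p := ENNReal.toReal_nonneg
    have hpQ : Q {θ | f θ = i} = ENNReal.ofReal p :=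
      (ENNReal.ofReal_toReal (measure_ne_top _ _)).symm
    rw [hpQ, ENNReal.ofReal_rpow_of_nonneg hp0 (by norm_num), ← ENNReal.ofReal_mul (by positivity),
      ← ENNReal.ofReal_mul (by positivity),
      ← ENNReal.ofReal_add (by positivity) (by positivity), ← Real.sqrt_eq_rpow]
    apply ENNReal.ofReal_le_ofReal
    set A : ℝ := 1 + (i : ℝ) ^ 2
    have hA : 0 < A := by positivity
    apply Real.sqrt_le_iff.2 ⟨by positivity, ?_⟩
    have h2 : A * p * (1 / A) = p := by field_simp
    nlinarith [mul_nonneg hA.le hp0, one_div_pos.2 hA, sq_nonneg (1 / 2 * (A * p) - 1 / A)]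
  calc ∑' i : ℤ, (Q {θ | f θ = i}) ^ (1 / 2 : ℝ)
      ≤ ∑' i : ℤ, (ENNReal.ofReal (1 / 2) * (ENNReal.ofReal (1 + (i : ℝ) ^ 2) * Q {θ | f θ = i}) +
        ENNReal.ofReal (1 / (1 + (i : ℝ) ^ 2))) := ENNReal.tsum_le_tsum hpt
    _ = ENNReal.ofReal (1 / 2) * ∑' i : ℤ, ENNReal.ofReal (1 + (i : ℝ) ^ 2) * Q {θ | f θ = i} +
        ENNReal.ofReal C := by
        rw [ENNReal.tsum_add, ENNReal.tsum_mul_left, hC,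
          ENNReal.ofReal_tsum_of_nonneg (fun i => by positivity) hsum]
    _ ≤ ENNReal.ofReal (1 / 2) * ENNReal.ofReal (3 + 2 * ((∫ θ, g θ ^ 2 ∂Q) / w ^ 2)) +
        ENNReal.ofReal C := by gcongr
    _ ≤ ENNReal.ofReal (3 + C + (∫ θ, g θ ^ 2 ∂Q) / w ^ 2) := by
        have hI : 0 ≤ (∫ θ, g θ ^ 2 ∂Q) / w ^ 2 :=
          div_nonneg (integral_nonneg fun θ => by positivity) (by positivity)
        rw [← ENNReal.ofReal_mul (by positivity), ← ENNReal.ofReal_add (by positivity) hC0]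
        apply ENNReal.ofReal_le_ofReal
        linarith

/-- A sum over a box of indices of products factorizes; for an infinite box the product of the
sums is an upper bound. -/
lemma tsum_prod_le_prod_tsum {S ι : Type*} [Fintype S] [DecidableEq S] (f : S → ι → ℝ≥0∞) :
    ∑' i : S → ι, ∏ k, f k (i k) ≤ ∏ k, ∑' i, f k i := by
  classical
  rw [ENNReal.tsum_eq_iSup_sum]
  refine iSup_le fun s => ?_
  calc ∑ i ∈ s, ∏ k, f k (i k)
      ≤ ∑ i ∈ Fintype.piFinset fun k => s.image fun i => i k, ∏ k, f k (i k) := by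
        refine Finset.sum_le_sum_of_subset fun i hi => ?_
        rw [Fintype.mem_piFinset]
        exact fun k => Finset.mem_image_of_mem _ hi
    _ = ∏ k, ∑ i ∈ s.image fun i => i k, f k i := (Finset.prod_univ_sum _ _).symm
    _ ≤ ∏ k, ∑' i, f k i := Finset.prod_le_prod' fun k _ => ENNReal.sum_le_tsum _

variable {E : Type*} [NormedAddCommGroup E] [InnerProductSpace ℝ E]

/-- The mean square norm of a linear image of a vector with uncorrelated coordinates. -/
lemma integral_norm_sq_map_eq_sum {ι : Type*} [Fintype ι] [DecidableEq ι]
    (b : OrthonormalBasis ι ℝ E) {G : Θ → E} (hG : MemLp G 2 Q) {v : ι → ℝ}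
    (hv : ∀ k l, ∫ θ, ⟪b k, G θ⟫ * ⟪b l, G θ⟫ ∂Q = if k = l then v k else 0) (L : E →ₗ[ℝ] E) :
    ∫ θ, ‖L (G θ)‖ ^ 2 ∂Q = ∑ k, v k * ‖L (b k)‖ ^ 2 := by
  have h1 : ∀ θ, ‖L (G θ)‖ ^ 2 =
      ∑ k, ∑ l, (⟪b k, G θ⟫ * ⟪b l, G θ⟫) * ⟪L (b k), L (b l)⟫ := by
    intro θ
    rw [← real_inner_self_eq_norm_sq]
    conv_lhs => rw [← b.sum_repr' (G θ)]
    simp only [map_sum, map_smul, sum_inner, inner_sum, real_inner_smul_left,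
      real_inner_smul_right]
    refine Finset.sum_congr rfl fun k _ => Finset.sum_congr rfl fun l _ => ?_
    rw [real_inner_comm (L (b k)) (L (b l))]
    ring
  have hint : ∀ k l, Integrable (fun θ => ⟪b k, G θ⟫ * ⟪b l, G θ⟫ * ⟪L (b k), L (b l)⟫) Q :=
    fun k l => ((hG.const_inner (b k)).integrable_mul (hG.const_inner (b l))).mul_const _
  simp_rw [h1]
  rw [integral_finsetSum _ fun k _ => integrable_finsetSum _ fun l _ => hint k l]
  refine Finset.sum_congr rfl fun k _ => ?_
  rw [integral_finsetSum _ fun l _ => hint k l]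
  simp_rw [integral_mul_const, hv]
  simp [ite_mul]

variable [FiniteDimensional ℝ E] [MeasurableSpace E] [BorelSpace E]

/-- A centred Gaussian vector has independent coordinates in an orthonormal basis of eigenvectors
of its covariance operator. -/
lemma exists_orthonormalBasis_independent [IsProbabilityMeasure Q] {G : Θ → E}
    (hG : HasGaussianLaw G Q) (h0 : ∫ θ, G θ ∂Q = 0) :
    ∃ (b : OrthonormalBasis (Fin (Module.finrank ℝ E)) ℝ E)
      (v : Fin (Module.finrank ℝ E) → ℝ≥0),
      iIndepFun (fun k θ => ⟪b k, G θ⟫) Q ∧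
      (∀ k, Q.map (fun θ => ⟪b k, G θ⟫) = gaussianReal 0 (v k)) ∧
      ∀ k l, ∫ θ, ⟪b k, G θ⟫ * ⟪b l, G θ⟫ ∂Q = if k = l then (v k : ℝ) else 0 := by
  have hμ : MemLp id 2 (Q.map G) :=
    (memLp_map_measure_iff (by fun_prop) hG.aemeasurable).2 hG.memLp_two
  set C := covarianceOperator (Q.map G) with hC
  have hsymm : C.toLinearMap.IsSymmetric := isPositive_covarianceOperator.isSymmetric
  set b := hsymm.eigenvectorBasis rfl with hb
  have hmean : ∀ x : E, ∫ θ, ⟪x, G θ⟫ ∂Q = 0 := fun x => by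
    rw [integral_inner hG.integrable, h0, inner_zero_right]
  have hcov : ∀ k l, ∫ θ, ⟪b k, G θ⟫ * ⟪b l, G θ⟫ ∂Q =
      if k = l then hsymm.eigenvalues rfl k else 0 := by
    intro k l
    have h1 : ∫ θ, ⟪b k, G θ⟫ * ⟪b l, G θ⟫ ∂Q = ⟪C (b k), b l⟫ := by
      rw [hC, covarianceOperator_inner hμ, integral_map hG.aemeasurable
        (by exact Continuous.aestronglyMeasurable (by fun_prop))]
    have h2 : C (b k) = (hsymm.eigenvalues rfl k : ℝ) • b k := hsymm.apply_eigenvectorBasis rfl k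
    rw [h1, h2, real_inner_smul_left, orthonormal_iff_ite.1 b.orthonormal k l]
    simp
  have hgk : ∀ k, HasGaussianLaw (fun θ => ⟪b k, G θ⟫) Q := fun k =>
    hG.map_fun (innerSL ℝ (b k))
  have hcov' : ∀ k l, cov[fun θ => ⟪b k, G θ⟫, fun θ => ⟪b l, G θ⟫; Q] =
      if k = l then hsymm.eigenvalues rfl k else 0 := by
    intro k l
    rw [covariance_eq_sub (hgk k).memLp_two (hgk l).memLp_two, hmean, hmean, ← hcov]
    simp
  have hvar : ∀ k, Var[fun θ => ⟪b k, G θ⟫; Q] = hsymm.eigenvalues rfl k := by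
    intro k
    rw [← covariance_self (hgk k).aemeasurable, hcov', if_pos rfl]
  refine ⟨b, fun k => (Var[fun θ => ⟪b k, G θ⟫; Q]).toNNReal, ?_, fun k => ?_, fun k l => ?_⟩
  · refine HasGaussianLaw.iIndepFun_of_covariance_eq_zero ?_ fun k l hkl => ?_
    · exact hG.map_fun (ContinuousLinearMap.pi fun k => innerSL ℝ (b k))
    · rw [hcov', if_neg hkl]
  · rw [(hgk k).map_eq_gaussianReal, hmean]
  · rw [hcov, Real.coe_toNNReal _ (variance_nonneg _ _), hvar]

end

/-! ### Cells for Gaussian vectors of arbitrary dimension -/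

section

variable {Θ : Type*} [MeasurableSpace Θ] {Q : Measure Θ}

variable {E : Type*} [NormedAddCommGroup E] [InnerProductSpace ℝ E] [FiniteDimensional ℝ E]

lemma sum_norm_sq_starProjection {ι : Type*} [Fintype ι] (b : OrthonormalBasis ι ℝ E)
    (F : Submodule ℝ E) : ∑ k, ‖F.starProjection (b k)‖ ^ 2 = Module.finrank ℝ F := by
  have h1 : ∀ k, ‖F.starProjection (b k)‖ ^ 2 = ⟪b k, F.starProjection (b k)⟫ := fun k => by
    rw [← real_inner_self_eq_norm_sq, Submodule.inner_starProjection_left_eq_right,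
      Submodule.starProjection_eq_self_iff.2 (F.starProjection_apply_mem _)]
  simp_rw [h1]
  have h2 := LinearMap.trace_eq_sum_inner (F.starProjection : E →ₗ[ℝ] E) b
  have h3 : LinearMap.IsProj F (F.starProjection : E →ₗ[ℝ] E) :=
    ⟨fun x => F.starProjection_apply_mem x, fun x hx => Submodule.starProjection_eq_self_iff.2 hx⟩
  rw [h3.trace] at h2
  exact h2.symm

variable [MeasurableSpace E] [BorelSpace E]

/-- Chernoff bound for the sum of the squares of independent centred Gaussian variables whose
variances are at most `1 / (4 a)`. -/
lemma measure_sum_sq_gt_le {ι : Type*} (s : Finset ι) {g : ι → Θ → ℝ}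
    (hg : ∀ k, Measurable (g k)) (hind : iIndepFun g Q) {v : ι → ℝ≥0}
    (hlaw : ∀ k, Q.map (g k) = gaussianReal 0 (v k)) {a : ℝ} (ha : 0 < a)
    (hav : ∀ k ∈ s, 2 * a * v k ≤ 1 / 2) (r : ℝ) :
    Q {θ | r < ∑ k ∈ s, g k θ ^ 2} ≤
      ENNReal.ofReal (Real.exp (2 * a * ∑ k ∈ s, (v k : ℝ) - a * r)) := by
  have h1 : ∫⁻ θ, ENNReal.ofReal (Real.exp (a * ∑ k ∈ s, g k θ ^ 2)) ∂Q ≤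
      ENNReal.ofReal (Real.exp (2 * a * ∑ k ∈ s, (v k : ℝ))) := by
    have h2 : ∀ θ, ENNReal.ofReal (Real.exp (a * ∑ k ∈ s, g k θ ^ 2)) =
        ∏ k ∈ s, ENNReal.ofReal (Real.exp (a * g k θ ^ 2)) := by
      intro θ
      rw [Finset.mul_sum, Real.exp_sum,
        ENNReal.ofReal_prod_of_nonneg fun _ _ => (Real.exp_pos _).le]
    simp_rw [h2]
    have hm : Measurable fun x : ℝ => ENNReal.ofReal (Real.exp (a * x ^ 2)) := by fun_prop
    rw [lintegral_prod_eq_prod_lintegral_of_indepFun s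
      (fun k θ => ENNReal.ofReal (Real.exp (a * g k θ ^ 2)))
      (hind.comp (fun _ x => ENNReal.ofReal (Real.exp (a * x ^ 2))) fun _ => hm)
      fun k => hm.comp (hg k), Finset.mul_sum, Real.exp_sum,
      ENNReal.ofReal_prod_of_nonneg fun _ _ => (Real.exp_pos _).le]
    refine Finset.prod_le_prod' fun k hk => ?_
    rw [← lintegral_map (f := fun x : ℝ => ENNReal.ofReal (Real.exp (a * x ^ 2))) hm (hg k),
      hlaw k]
    exact lintegral_exp_sq_gaussianReal_le (v k) ha.le (hav k hk)
  have h3 := mul_meas_ge_le_lintegral (μ := Q)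
    (f := fun θ => ENNReal.ofReal (Real.exp (a * ∑ k ∈ s, g k θ ^ 2)))
    (by fun_prop) (ENNReal.ofReal (Real.exp (a * r)))
  have hsub : {θ | r < ∑ k ∈ s, g k θ ^ 2} ⊆ {θ | ENNReal.ofReal (Real.exp (a * r)) ≤
      ENNReal.ofReal (Real.exp (a * ∑ k ∈ s, g k θ ^ 2))} := by
    intro θ hθ
    refine ENNReal.ofReal_le_ofReal (Real.exp_le_exp.2 ?_)
    exact mul_le_mul_of_nonneg_left (le_of_lt hθ) ha.le
  rw [Real.exp_sub, ENNReal.ofReal_div_of_pos (Real.exp_pos _)]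
  rw [ENNReal.le_div_iff_mul_le (Or.inl (by simp [Real.exp_pos])) (Or.inl (by simp)), mul_comm]
  calc _ ≤ ENNReal.ofReal (Real.exp (a * r)) * Q {θ | ENNReal.ofReal (Real.exp (a * r)) ≤
      ENNReal.ofReal (Real.exp (a * ∑ k ∈ s, g k θ ^ 2))} := by gcongr
    _ ≤ _ := h3.trans h1

/-- The cells of independent coordinates: the square roots of their probabilities sum up to at most
the product of the one-dimensional sums. -/
lemma tsum_sqrt_cells_le {ι : Type*} [Fintype ι] [IsProbabilityMeasure Q]
    {g : ι → Θ → ℝ} (hg : ∀ k, Measurable (g k)) (hgL : ∀ k, MemLp (g k) 2 Q)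
    (hind : iIndepFun g Q) {w : ℝ} (hw : 0 < w) :
    ∑' i : ι → ℤ, (Q {θ | ∀ k, ⌊g k θ / w⌋ = i k}) ^ (1 / 2 : ℝ) ≤
      ENNReal.ofReal (Real.exp
        (Fintype.card ι * cellConst + (∑ k, ∫ θ, g k θ ^ 2 ∂Q) / w ^ 2)) := by
  classical
  have h1 : ∀ i : ι → ℤ, (Q {θ | ∀ k, ⌊g k θ / w⌋ = i k}) ^ (1 / 2 : ℝ) =
      ∏ k, (Q {θ | ⌊g k θ / w⌋ = i k}) ^ (1 / 2 : ℝ) := by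
    intro i
    have hm : Measurable fun x : ℝ => ⌊x / w⌋ :=
      Int.measurable_floor.comp (measurable_id.div_const w)
    have h2 := (hind.comp (fun _ x => ⌊x / w⌋) fun _ => hm).measure_inter_preimage_eq_mul
      Finset.univ (sets := fun k => {i k}) fun k _ => measurableSet_singleton _
    rw [ENNReal.prod_rpow_of_nonneg (by norm_num)]
    congr 1
    have h4 : {θ | ∀ k, ⌊g k θ / w⌋ = i k} =
        ⋂ k ∈ Finset.univ, ((fun x => ⌊x / w⌋) ∘ g k) ⁻¹' {i k} := by
      ext θ; simp
    rw [h4, h2]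
    rfl
  simp_rw [h1]
  refine (tsum_prod_le_prod_tsum fun k i => (Q {θ | ⌊g k θ / w⌋ = i}) ^ (1 / 2 : ℝ)).trans ?_
  have h3 : (Fintype.card ι * cellConst + (∑ k, ∫ θ, g k θ ^ 2 ∂Q) / w ^ 2) =
      ∑ k, (cellConst + (∫ θ, g k θ ^ 2 ∂Q) / w ^ 2) := by
    rw [Finset.sum_add_distrib, Finset.sum_div]
    simp
  rw [h3, Real.exp_sum, ENNReal.ofReal_prod_of_nonneg fun _ _ => (Real.exp_pos _).le]
  refine Finset.prod_le_prod' fun k _ => (tsum_sqrt_cell_le (hg k) (hgL k) hw).trans ?_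
  refine ENNReal.ofReal_le_ofReal ?_
  linarith [Real.add_one_le_exp (cellConst + (∫ θ, g k θ ^ 2 ∂Q) / w ^ 2)]

/-- Cells for a Gaussian vector with mean square norm `τ` that is approximated, with mean square
error `τ₀`, in a subspace `F` of dimension at most `K`. Outside of an event of probability
`exp (-K)` the space is covered by cells of diameter of the order `√τ₀`, and the square roots of
their probabilities sum up to at most `exp (c K)`. The bounds do not depend on the dimension of the
ambient space. Only the eigendirections of the covariance with variance above `τ₀ / K` are cut into
cells, and there are at most `K τ / τ₀` of them. -/
lemma exists_gaussian_covering [IsProbabilityMeasure Q] {G : Θ → E} (hGm : Measurable G)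
    (hG : HasGaussianLaw G Q) (h0 : ∫ θ, G θ ∂Q = 0) (F : Submodule ℝ E) {τ τ₀ K ε : ℝ}
    (hτpos : 0 < τ) (hτ₀pos : 0 < τ₀) (hK : 0 < K) (hFK : (Module.finrank ℝ F : ℝ) ≤ K)
    (hτ : ∫ θ, ‖G θ‖ ^ 2 ∂Q ≤ τ) (hτ₀ : ∫ θ, ‖G θ - F.starProjection (G θ)‖ ^ 2 ∂Q ≤ τ₀)
    (hε0 : 0 < ε) (hε : 8 * τ₀ ≤ ε ^ 2) :
    ∃ (S : Finset (Fin (Module.finrank ℝ E))) (A : (S → ℤ) → Set Θ),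
      (∀ i, MeasurableSet (A i)) ∧
      (∀ i, ∀ θ ∈ A i, ∀ θ' ∈ A i, ‖G θ - G θ'‖ ^ 2 ≤ 5 * ε ^ 2) ∧
      ∑' i, (Q (A i)) ^ (1 / 2 : ℝ) ≤
        ENNReal.ofReal (Real.exp (K * (τ / τ₀ * (cellConst + τ / ε ^ 2)))) ∧
      Q (⋃ i, A i)ᶜ ≤ ENNReal.ofReal (Real.exp (-K)) := by
  classical
  obtain ⟨b, v, hind, hlaw, hv⟩ := exists_orthonormalBasis_independent hG h0
  set g : Fin (Module.finrank ℝ E) → Θ → ℝ := fun k θ => ⟪b k, G θ⟫ with hg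
  have hgm : ∀ k, Measurable (g k) := fun k =>
    (innerSL ℝ (b k)).continuous.measurable.comp hGm
  have hgL : ∀ k, MemLp (g k) 2 Q := fun k => hG.memLp_two.const_inner (b k)
  have hgv : ∀ k, ∫ θ, g k θ ^ 2 ∂Q = v k := fun k => by
    have := hv k k
    simpa [sq] using this
  have htr : ∑ k, (v k : ℝ) ≤ τ := by
    have := integral_norm_sq_map_eq_sum b hG.memLp_two (v := fun k => (v k : ℝ)) hv LinearMap.id
    simp only [LinearMap.id_coe, id_eq, OrthonormalBasis.norm_eq_one, one_pow, mul_one] at this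
    linarith
  have hres : ∑ k, (v k : ℝ) * ‖b k - F.starProjection (b k)‖ ^ 2 ≤ τ₀ := by
    have := integral_norm_sq_map_eq_sum b hG.memLp_two (v := fun k => (v k : ℝ)) hv
      (LinearMap.id - (F.starProjection : E →ₗ[ℝ] E))
    simp only [LinearMap.sub_apply, LinearMap.id_coe, id_eq, ContinuousLinearMap.coe_coe] at this
    linarith
  -- few axes have large variance by the trace bound; the variances of the other axes are summable
  -- up to `2 τ₀`, as their mass in `F` is at most `dim F · τ₀ / K`
  set S : Finset (Fin (Module.finrank ℝ E)) := Finset.univ.filter fun k => τ₀ / K < v k with hS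
  have hcard : (S.card : ℝ) ≤ K * τ / τ₀ := by
    have h1 : S.card • (τ₀ / K) ≤ ∑ k ∈ S, (v k : ℝ) :=
      Finset.card_nsmul_le_sum _ _ _ fun k hk => (Finset.mem_filter.1 hk).2.le
    have h2 : ∑ k ∈ S, (v k : ℝ) ≤ ∑ k, (v k : ℝ) :=
      Finset.sum_le_sum_of_subset_of_nonneg (Finset.subset_univ _) fun _ _ _ => NNReal.coe_nonneg _
    rw [nsmul_eq_mul] at h1
    rw [le_div_iff₀ hτ₀pos]
    have h3 : (S.card : ℝ) * τ₀ = K * (S.card * (τ₀ / K)) := by field_simp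
    rw [h3]
    exact mul_le_mul_of_nonneg_left (by linarith) hK.le
  have htail : ∑ k ∈ Sᶜ, (v k : ℝ) ≤ 2 * τ₀ := by
    have h1 : ∀ k, (v k : ℝ) =
        v k * ‖F.starProjection (b k)‖ ^ 2 + v k * ‖b k - F.starProjection (b k)‖ ^ 2 := by
      intro k
      have h2 := F.norm_sq_eq_add_norm_sq_starProjection (b k)
      rw [b.norm_eq_one, Submodule.starProjection_orthogonal' F, sub_apply, one_pow,
        one_apply_eq_self] at h2
      rw [← mul_add]
      linear_combination (v k : ℝ) * h2
    have h2 : ∑ k ∈ Sᶜ, (v k : ℝ) * ‖F.starProjection (b k)‖ ^ 2 ≤ τ₀ := by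
      calc ∑ k ∈ Sᶜ, (v k : ℝ) * ‖F.starProjection (b k)‖ ^ 2
          ≤ ∑ k ∈ Sᶜ, τ₀ / K * ‖F.starProjection (b k)‖ ^ 2 := by
            refine Finset.sum_le_sum fun k hk => mul_le_mul_of_nonneg_right ?_ (by positivity)
            simpa [hS] using hk
        _ ≤ ∑ k, τ₀ / K * ‖F.starProjection (b k)‖ ^ 2 :=
            Finset.sum_le_sum_of_subset_of_nonneg (Finset.subset_univ _) fun _ _ _ => by positivity
        _ = τ₀ / K * Module.finrank ℝ F := by
            rw [← Finset.mul_sum, sum_norm_sq_starProjection]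
        _ ≤ τ₀ / K * K := by gcongr
        _ = τ₀ := by field_simp
    have h3 : ∑ k ∈ Sᶜ, (v k : ℝ) * ‖b k - F.starProjection (b k)‖ ^ 2 ≤ τ₀ :=
      (Finset.sum_le_sum_of_subset_of_nonneg (Finset.subset_univ _)
        fun _ _ _ => by positivity).trans hres
    calc ∑ k ∈ Sᶜ, (v k : ℝ) = ∑ k ∈ Sᶜ, (v k : ℝ) * ‖F.starProjection (b k)‖ ^ 2 +
        ∑ k ∈ Sᶜ, (v k : ℝ) * ‖b k - F.starProjection (b k)‖ ^ 2 := by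
          rw [← Finset.sum_add_distrib]
          exact Finset.sum_congr rfl fun k _ => h1 k
      _ ≤ 2 * τ₀ := by linarith
  set M : ℝ := K * τ / τ₀ with hM
  have hMpos : 0 < M := by positivity
  set w : ℝ := ε / √M with hw
  have hwpos : 0 < w := by positivity
  have hw2 : w ^ 2 = ε ^ 2 / M := by rw [hw, div_pow, Real.sq_sqrt hMpos.le]
  refine ⟨S, fun i => {θ | ∀ k : S, ⌊g k θ / w⌋ = i k} ∩ {θ | ∑ k ∈ Sᶜ, g k θ ^ 2 ≤ ε ^ 2},
    fun i => ?_, fun i θ hθ θ' hθ' => ?_, ?_, ?_⟩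
  · refine MeasurableSet.inter ?_ (measurableSet_le (by fun_prop) measurable_const)
    have : {θ | ∀ k : S, ⌊g k θ / w⌋ = i k} = ⋂ k : S, {θ | ⌊g k θ / w⌋ = i k} := by ext; simp
    rw [this]
    exact MeasurableSet.iInter fun k => measurableSet_eq_fun
      (Int.measurable_floor.comp ((hgm k).div_const w)) measurable_const
  · have h1 : ‖G θ - G θ'‖ ^ 2 =
        ∑ k ∈ S, (g k θ - g k θ') ^ 2 + ∑ k ∈ Sᶜ, (g k θ - g k θ') ^ 2 := by
      rw [Finset.sum_add_sum_compl, ← b.sum_sq_norm_inner_right]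
      refine Finset.sum_congr rfl fun k _ => ?_
      rw [inner_sub_right, Real.norm_eq_abs, sq_abs]
    have h2 : ∑ k ∈ S, (g k θ - g k θ') ^ 2 ≤ ε ^ 2 := by
      calc ∑ k ∈ S, (g k θ - g k θ') ^ 2 ≤ ∑ k ∈ S, w ^ 2 := by
            refine Finset.sum_le_sum fun k hk => ?_
            have h3 := (hθ.1 ⟨k, hk⟩).trans (hθ'.1 ⟨k, hk⟩).symm
            have h4 := Int.abs_sub_lt_one_of_floor_eq_floor h3
            rw [← sub_div, abs_div, abs_of_pos hwpos, div_lt_one hwpos] at h4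
            exact sq_le_sq' (by linarith [abs_lt.1 h4]) (by linarith [abs_lt.1 h4])
        _ = S.card * (ε ^ 2 / M) := by rw [Finset.sum_const, nsmul_eq_mul, hw2]
        _ ≤ M * (ε ^ 2 / M) := by gcongr
        _ = ε ^ 2 := by field_simp
    have h3 : ∑ k ∈ Sᶜ, (g k θ - g k θ') ^ 2 ≤ 4 * ε ^ 2 := by
      calc ∑ k ∈ Sᶜ, (g k θ - g k θ') ^ 2 ≤ ∑ k ∈ Sᶜ, (2 * g k θ ^ 2 + 2 * g k θ' ^ 2) :=
            Finset.sum_le_sum fun k _ => by nlinarith [sq_nonneg (g k θ + g k θ')]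
        _ = 2 * ∑ k ∈ Sᶜ, g k θ ^ 2 + 2 * ∑ k ∈ Sᶜ, g k θ' ^ 2 := by
            rw [Finset.sum_add_distrib, Finset.mul_sum, Finset.mul_sum]
        _ ≤ 4 * ε ^ 2 := by
            have h5 : ∑ k ∈ Sᶜ, g k θ ^ 2 ≤ ε ^ 2 := hθ.2
            have h6 : ∑ k ∈ Sᶜ, g k θ' ^ 2 ≤ ε ^ 2 := hθ'.2
            linarith
    linarith
  · calc _ ≤ ∑' i : S → ℤ, (Q {θ | ∀ k : S, ⌊g k θ / w⌋ = i k}) ^ (1 / 2 : ℝ) := by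
          refine ENNReal.tsum_le_tsum fun i => ENNReal.rpow_le_rpow ?_ (by norm_num)
          exact measure_mono Set.inter_subset_left
      _ ≤ _ := tsum_sqrt_cells_le (fun k : S => hgm k) (fun k : S => hgL k)
          (hind.precomp Subtype.val_injective) hwpos
      _ ≤ _ := by
          refine ENNReal.ofReal_le_ofReal (Real.exp_le_exp.2 ?_)
          simp_rw [hgv]
          rw [Fintype.card_coe, Finset.sum_coe_sort S fun k => (v k : ℝ), hw2]
          have h1 : ∑ k ∈ S, (v k : ℝ) ≤ τ :=
            (Finset.sum_le_sum_of_subset_of_nonneg (Finset.subset_univ _)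
              fun _ _ _ => NNReal.coe_nonneg _).trans htr
          calc S.card * cellConst + (∑ k ∈ S, (v k : ℝ)) / (ε ^ 2 / M)
              ≤ M * cellConst + τ / (ε ^ 2 / M) := by
                have := cellConst_pos
                gcongr
            _ = K * (τ / τ₀ * (cellConst + τ / ε ^ 2)) := by
                rw [hM]; field_simp
  · have hsub : (⋃ i : S → ℤ, {θ | ∀ k : S, ⌊g k θ / w⌋ = i k} ∩
        {θ | ∑ k ∈ Sᶜ, g k θ ^ 2 ≤ ε ^ 2})ᶜ ⊆ {θ | ε ^ 2 < ∑ k ∈ Sᶜ, g k θ ^ 2} := by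
      intro θ hθ
      by_contra hcon
      have hcon' : ∑ k ∈ Sᶜ, g k θ ^ 2 ≤ ε ^ 2 := not_lt.1 hcon
      exact hθ (Set.mem_iUnion.2 ⟨fun k => ⌊g k θ / w⌋, fun k => rfl, hcon'⟩)
    refine (measure_mono hsub).trans ?_
    refine (measure_sum_sq_gt_le Sᶜ hgm hind hlaw (a := K / (4 * τ₀)) (by positivity)
      (fun k hk => ?_) (ε ^ 2)).trans ?_
    · have h1 : (v k : ℝ) ≤ τ₀ / K := by simpa [hS] using hk
      calc 2 * (K / (4 * τ₀)) * (v k : ℝ) ≤ 2 * (K / (4 * τ₀)) * (τ₀ / K) := by gcongr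
        _ = 1 / 2 := by field_simp; norm_num
    · refine ENNReal.ofReal_le_ofReal (Real.exp_le_exp.2 ?_)
      have h1 : 2 * (K / (4 * τ₀)) * ∑ k ∈ Sᶜ, (v k : ℝ) ≤ 2 * (K / (4 * τ₀)) * (2 * τ₀) := by
        gcongr
      have h2 : K / (4 * τ₀) * (8 * τ₀) ≤ K / (4 * τ₀) * ε ^ 2 := by gcongr
      have h3 : 2 * (K / (4 * τ₀)) * (2 * τ₀) = K := by field_simp; norm_num
      have h4 : K / (4 * τ₀) * (8 * τ₀) = 2 * K := by field_simp; norm_num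
      linarith

end

/-! ### Cells for Gaussian processes -/

lemma lintegral_enorm_add_sq_le {α : Type*} [MeasurableSpace α] (μ : Measure α) {f g : α → ℝ}
    (hf : Measurable f) :
    ∫⁻ x, ‖f x + g x‖ₑ ^ 2 ∂μ ≤ 2 * (∫⁻ x, ‖f x‖ₑ ^ 2 ∂μ + ∫⁻ x, ‖g x‖ₑ ^ 2 ∂μ) := by
  rw [← lintegral_add_left (by fun_prop), ← lintegral_const_mul' _ _ (by simp)]
  refine lintegral_mono fun x => ?_
  refine (pow_le_pow_left' (enorm_add_le (f x) (g x)) 2).trans ?_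
  have := ENNReal.rpow_add_le_mul_rpow_add_rpow ‖f x‖ₑ ‖g x‖ₑ (p := 2) (by norm_num)
  norm_num at this
  exact this

lemma ofReal_sq_eq_enorm_sq (a : ℝ) : ENNReal.ofReal (a ^ 2) = ‖a‖ₑ ^ 2 := by
  rw [← sq_abs, ENNReal.ofReal_pow (abs_nonneg a), Real.enorm_eq_ofReal_abs]

lemma hasGaussianLaw_toLp_of_isGaussianProcess {T Θ : Type*} [MeasurableSpace Θ]
    {Q : Measure Θ} {Y : T → Θ → ℝ}
    (hY : IsGaussianProcess Y Q) {ι : Type*} [Fintype ι] (t : ι → T) (c : ι → ℝ) :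
    HasGaussianLaw (fun θ => WithLp.toLp 2 (fun i => c i * Y (t i) θ)) Q := by
  refine HasGaussianLaw.toLp_pi (X := fun i θ => c i * Y (t i) θ) 2 ?_
  have h1 : IsGaussianProcess (fun i θ => c i * Y (t i) θ) Q := (hY.comp_right t).smul c
  have h2 := h1.hasGaussianLaw Finset.univ
  let L : (↥(Finset.univ : Finset ι) → ℝ) →L[ℝ] (ι → ℝ) :=
    ContinuousLinearMap.pi fun i =>
      ContinuousLinearMap.proj (R := ℝ) (⟨i, Finset.mem_univ i⟩ : ↥(Finset.univ : Finset ι))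
  exact h2.map_fun L

section

variable {T Θ : Type*} [MeasurableSpace T] [MeasurableSpace Θ]

/-- The Euclidean norm of a vector weighted by the masses of the cells of a partition is the
`L²` norm of the corresponding step function. -/
lemma ofReal_norm_sq_weighted (ρ : Measure T) [IsFiniteMeasure ρ] {ι : Type} [Fintype ι]
    {p : T → ι} (hp : ∀ i, MeasurableSet (p ⁻¹' {i})) (f : ι → ℝ) :
    ENNReal.ofReal (‖WithLp.toLp 2 (fun i => √(ρ.real (p ⁻¹' {i})) * f i)‖ ^ 2) =
      ∫⁻ x, ‖f (p x)‖ₑ ^ 2 ∂ρ := by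
  let _ : MeasurableSpace ι := ⊤
  have hpm : Measurable p := measurable_to_countable' hp
  rw [EuclideanSpace.norm_sq_eq, ENNReal.ofReal_sum_of_nonneg fun _ _ => by positivity,
    ← lintegral_map (f := fun i => ‖f i‖ₑ ^ 2) measurable_from_top hpm, lintegral_fintype]
  refine Finset.sum_congr rfl fun i _ => ?_
  rw [Measure.map_apply hpm (measurableSet_singleton i), norm_mul, mul_pow, Real.norm_eq_abs,
    sq_abs, Real.sq_sqrt measureReal_nonneg, Real.norm_eq_abs, sq_abs, mul_comm,
    ENNReal.ofReal_mul (sq_nonneg _), ofReal_measureReal, ofReal_sq_eq_enorm_sq]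

/-- Prior cells for posterior consistency: for a square integrable centred Gaussian process and
cells of a given `L²(ρ)` diameter, the square roots of the cell probabilities sum up to `exp (a n)`
with an arbitrarily small `a`, outside of an exponentially unlikely event. The process is replaced
by finitely many of its values, so finely (depending on `n`) that Markov's inequality controls the
error; the finite-dimensional bound does not see how many values are used. -/
theorem exists_gaussianProcess_covering [Nonempty T] (ρ : Measure T) [IsFiniteMeasure ρ]
    {Q : Measure Θ} [IsProbabilityMeasure Q] {Y : T → Θ → ℝ}
    (hYm : Measurable (Function.uncurry Y)) (hY : MemLp (Function.uncurry Y) 2 (ρ.prod Q))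
    (hG : IsGaussianProcess Y Q) (h0 : ∀ t, ∫ θ, Y t θ ∂Q = 0) {ε a : ℝ} (hε : 0 < ε)
    (ha : 0 < a) :
    ∃ c : ℝ, 0 < c ∧ ∀ᶠ n : ℕ in atTop, ∃ (κ : Type) (_ : Countable κ) (A : κ → Set Θ),
      (∀ i, MeasurableSet (A i)) ∧
      (∀ i, ∀ θ ∈ A i, ∀ θ' ∈ A i, ∫⁻ x, ‖Y x θ - Y x θ'‖ₑ ^ 2 ∂ρ ≤ ENNReal.ofReal (ε ^ 2)) ∧
      ∑' i, (Q (A i)) ^ (1 / 2 : ℝ) ≤ ENNReal.ofReal (Real.exp (a * n)) ∧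
      Q (⋃ i, A i)ᶜ ≤ 2 * ENNReal.ofReal (Real.exp (-(c * n))) := by
  classical
  set ε₁ : ℝ := ε / 6 with hε₁
  have hε₁pos : 0 < ε₁ := by positivity
  set τ₀ : ℝ := ε₁ ^ 2 / 8 with hτ₀
  have hτ₀pos : 0 < τ₀ := by positivity
  -- the total mean square of the process
  set V : ℝ≥0∞ := ∫⁻ z, ‖Function.uncurry Y z‖ₑ ^ 2 ∂(ρ.prod Q) with hV
  have hVtop : V ≠ ⊤ := by
    have h1 := hY.eLpNorm_ne_top
    rw [eLpNorm_eq_lintegral_rpow_enorm_toReal (by simp) (by simp)] at h1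
    intro h2
    apply h1
    simp only [ENNReal.toReal_ofNat, ENNReal.rpow_ofNat]
    rw [← hV, h2]
    simp
  set τ : ℝ := 2 * (V.toReal + τ₀ / 4) with hτ
  have hτpos : 0 < τ := by positivity
  obtain ⟨ι₀, _, p₀, t₀, hp₀, happ₀⟩ := exists_sampling_approx ρ Q hYm hY
    (ε := ENNReal.ofReal (τ₀ / 4)) (by simp [hτ₀pos])
  set B : ℝ := τ / τ₀ * (cellConst + τ / ε₁ ^ 2) with hB
  have hBpos : 0 < B := by have := cellConst_pos; positivity
  -- with `K = c n`, the exponent `K B` of `exists_gaussian_covering` is `a n`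
  set c : ℝ := a / B with hc
  have hcpos : 0 < c := by positivity
  refine ⟨c, hcpos, ?_⟩
  have hlarge : ∀ᶠ n : ℕ in atTop, (Fintype.card ι₀ : ℝ) + 1 ≤ c * n :=
    (tendsto_natCast_atTop_atTop.const_mul_atTop hcpos).eventually_ge_atTop _
  filter_upwards [hlarge] with n hn
  set K : ℝ := c * n with hK
  have hKpos : 0 < K := by
    have : (0 : ℝ) ≤ Fintype.card ι₀ := Nat.cast_nonneg _
    linarith
  -- a second sampling, exponentially exact in `n`; its number of points does not enter the bounds
  obtain ⟨ι₁, _, p₁, t₁, hp₁, happ₁⟩ := exists_sampling_approx ρ Q hYm hY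
    (ε := ENNReal.ofReal (min (τ₀ / 4) (ε₁ ^ 2 * Real.exp (-K))))
    (by simp only [ne_eq, ENNReal.ofReal_eq_zero, not_le]; positivity)
  -- all step functions live on the common refinement of the two partitions
  set p : T → ι₀ × ι₁ := fun x => (p₀ x, p₁ x) with hpdef
  have hp : ∀ i, MeasurableSet (p ⁻¹' {i}) := measurableSet_preimage_pair hp₀ hp₁
  set W : ι₀ × ι₁ → ℝ := fun i => √(ρ.real (p ⁻¹' {i})) with hW
  set G : Θ → EuclideanSpace ℝ (ι₀ × ι₁) :=
    fun θ => WithLp.toLp 2 (fun i => W i * Y (t₁ i.2) θ) with hGdef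
  have hYt : ∀ t, Measurable (Y t) := fun t => hYm.comp measurable_prodMk_left
  have hGm : Measurable G := by
    refine (WithLp.measurable_toLp 2 _).comp (measurable_pi_lambda _ fun i => ?_)
    exact (hYt _).const_mul _
  have hGG : HasGaussianLaw G Q := hasGaussianLaw_toLp_of_isGaussianProcess hG (fun i => t₁ i.2) W
  have hG0 : ∫ θ, G θ ∂Q = 0 := by
    ext i
    have h1 := (EuclideanSpace.proj (𝕜 := ℝ) i).integral_comp_comm hGG.integrable
    have h2 : ∫ θ, EuclideanSpace.proj (𝕜 := ℝ) i (G θ) ∂Q = 0 := by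
      simp [hGdef, integral_const_mul, h0]
    exact h1.symm.trans h2
  set s₀ : T × Θ → ℝ := fun z => Y (t₀ (p₀ z.1)) z.2 with hs₀
  set s₁ : T × Θ → ℝ := fun z => Y (t₁ (p₁ z.1)) z.2 with hs₁
  have hs₀m : Measurable s₀ := measurable_partitionwise hp₀ (k := fun i => Y (t₀ i)) fun i => hYt _
  have hs₁m : Measurable s₁ := measurable_partitionwise hp₁ (k := fun i => Y (t₁ i)) fun i => hYt _
  have happ₀' : ∫⁻ z, ‖Function.uncurry Y z - s₀ z‖ₑ ^ 2 ∂(ρ.prod Q) ≤ ENNReal.ofReal (τ₀ / 4) := by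
    rw [lintegral_prod _ (by fun_prop)]
    exact happ₀
  have happ₁' : ∫⁻ z, ‖Function.uncurry Y z - s₁ z‖ₑ ^ 2 ∂(ρ.prod Q) ≤
      ENNReal.ofReal (min (τ₀ / 4) (ε₁ ^ 2 * Real.exp (-K))) := by
    rw [lintegral_prod _ (by fun_prop)]
    exact happ₁
  have happ₁'' : ∫⁻ z, ‖Function.uncurry Y z - s₁ z‖ₑ ^ 2 ∂(ρ.prod Q) ≤ ENNReal.ofReal (τ₀ / 4) :=
    happ₁'.trans (ENNReal.ofReal_le_ofReal (min_le_left _ _))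
  -- mean squares of vectors are integrals over the product space
  have hmean : ∀ (H : Θ → EuclideanSpace ℝ (ι₀ × ι₁)) (F : ι₀ × ι₁ → Θ → ℝ),
      (∀ i, Measurable (F i)) → (∀ θ, H θ = WithLp.toLp 2 (fun i => W i * F i θ)) → ∀ r : ℝ, 0 ≤ r →
      ∫⁻ z, ‖F (p z.1) z.2‖ₑ ^ 2 ∂(ρ.prod Q) ≤ ENNReal.ofReal r → ∫ θ, ‖H θ‖ ^ 2 ∂Q ≤ r := by
    intro H F hF hH r hr hle
    have hHm : Measurable H := by
      have : H = fun θ => WithLp.toLp 2 (fun i => W i * F i θ) := funext hH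
      rw [this]
      exact (WithLp.measurable_toLp 2 _).comp (measurable_pi_lambda _ fun i => (hF i).const_mul _)
    have hm : Measurable fun z : T × Θ => ‖F (p z.1) z.2‖ₑ ^ 2 :=
      ((measurable_partitionwise hp hF).enorm).pow_const 2
    rw [integral_eq_lintegral_of_nonneg_ae (Eventually.of_forall fun θ => by positivity)
      (by fun_prop)]
    refine ENNReal.toReal_le_of_le_ofReal hr ?_
    refine le_trans (le_of_eq ?_) hle
    rw [lintegral_prod_symm _ hm.aemeasurable]
    refine lintegral_congr fun θ => ?_
    rw [hH]
    exact ofReal_norm_sq_weighted ρ hp fun i => F i θ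
  let Λ : (ι₀ → ℝ) →ₗ[ℝ] EuclideanSpace ℝ (ι₀ × ι₁) :=
    { toFun := fun u => WithLp.toLp 2 (fun i => W i * u i.1)
      map_add' := fun u v => by ext i; simp [mul_add]
      map_smul' := fun r u => by ext i; simp; ring }
  -- the step functions of the first sampling, a space whose dimension is independent of `n`
  set F : Submodule ℝ (EuclideanSpace ℝ (ι₀ × ι₁)) := LinearMap.range Λ with hF
  have hFK : (Module.finrank ℝ F : ℝ) ≤ K := by
    have h1 : Module.finrank ℝ F ≤ Module.finrank ℝ (ι₀ → ℝ) := LinearMap.finrank_range_le Λ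
    rw [Module.finrank_fintype_fun_eq_card] at h1
    have h2 : (Module.finrank ℝ F : ℝ) ≤ Fintype.card ι₀ := by exact_mod_cast h1
    linarith
  have hτle : ∫ θ, ‖G θ‖ ^ 2 ∂Q ≤ τ := by
    refine hmean G (fun i => Y (t₁ i.2)) (fun i => hYt _) (fun θ => rfl) τ hτpos.le ?_
    calc ∫⁻ z, ‖s₁ z‖ₑ ^ 2 ∂(ρ.prod Q)
        = ∫⁻ z, ‖Function.uncurry Y z + (-(Function.uncurry Y z - s₁ z))‖ₑ ^ 2 ∂(ρ.prod Q) := by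
          simp
      _ ≤ 2 * (V + ∫⁻ z, ‖-(Function.uncurry Y z - s₁ z)‖ₑ ^ 2 ∂(ρ.prod Q)) :=
          lintegral_enorm_add_sq_le _ hYm
      _ ≤ 2 * (V + ENNReal.ofReal (τ₀ / 4)) := by
          simp only [enorm_neg]
          gcongr
      _ = ENNReal.ofReal τ := by
          rw [hτ, ENNReal.ofReal_mul (by norm_num),
            ENNReal.ofReal_add (by positivity) (by positivity), ENNReal.ofReal_toReal hVtop]
          simp
  have hτ₀le : ∫ θ, ‖G θ - F.starProjection (G θ)‖ ^ 2 ∂Q ≤ τ₀ := by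
    set H : Θ → EuclideanSpace ℝ (ι₀ × ι₁) := fun θ => G θ - Λ fun u => Y (t₀ u) θ with hH
    have h1 : ∫ θ, ‖H θ‖ ^ 2 ∂Q ≤ τ₀ := by
      refine hmean H (fun i θ => Y (t₁ i.2) θ - Y (t₀ i.1) θ) (fun i => (hYt _).sub (hYt _))
        (fun θ => ?_) τ₀ hτ₀pos.le ?_
      · ext i
        simp [hH, hGdef, Λ, mul_sub]
      · calc ∫⁻ z, ‖s₁ z - s₀ z‖ₑ ^ 2 ∂(ρ.prod Q)
            = ∫⁻ z, ‖(Function.uncurry Y z - s₀ z) + (-(Function.uncurry Y z - s₁ z))‖ₑ ^ 2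
                ∂(ρ.prod Q) := by
              refine lintegral_congr fun z => ?_
              congr 2
              ring
          _ ≤ 2 * (∫⁻ z, ‖Function.uncurry Y z - s₀ z‖ₑ ^ 2 ∂(ρ.prod Q) +
                ∫⁻ z, ‖-(Function.uncurry Y z - s₁ z)‖ₑ ^ 2 ∂(ρ.prod Q)) :=
              lintegral_enorm_add_sq_le _ (hYm.sub hs₀m)
          _ ≤ 2 * (ENNReal.ofReal (τ₀ / 4) + ENNReal.ofReal (τ₀ / 4)) := by
              simp only [enorm_neg]
              gcongr
          _ = ENNReal.ofReal τ₀ := by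
              rw [← ENNReal.ofReal_add (by positivity) (by positivity)]
              rw [show (2 : ℝ≥0∞) = ENNReal.ofReal 2 by simp, ← ENNReal.ofReal_mul (by norm_num)]
              congr 1; ring
    have hHm : MemLp H 2 Q := by
      refine MemLp.of_eval_piLp fun i => ?_
      have h2 : (fun θ => H θ i) = fun θ => W i * Y (t₁ i.2) θ - W i * Y (t₀ i.1) θ := by
        ext θ; simp [hH, hGdef, Λ]
      rw [h2]
      exact ((hG.hasGaussianLaw_eval _).memLp_two.const_mul _).sub
        ((hG.hasGaussianLaw_eval _).memLp_two.const_mul _)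
    refine le_trans (integral_mono_of_nonneg (Eventually.of_forall fun θ => by positivity)
      hHm.integrable_norm_pow' (Eventually.of_forall fun θ => ?_)) h1
    refine pow_le_pow_left₀ (norm_nonneg _) ?_ 2
    rw [Submodule.starProjection_minimal]
    exact ciInf_le ⟨0, by rintro _ ⟨x, rfl⟩; exact norm_nonneg _⟩
      (⟨Λ fun u => Y (t₀ u) θ, LinearMap.mem_range_self _ _⟩ : F)
  obtain ⟨S, A, hAm, hAd, hAs, hAc⟩ := exists_gaussian_covering hGm hGG hG0 F hτpos hτ₀pos hKpos hFK
    hτle hτ₀le hε₁pos (by rw [hτ₀]; linarith)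
  set R : Θ → ℝ≥0∞ := fun θ => ∫⁻ x, ‖Y x θ - Y (t₁ (p₁ x)) θ‖ₑ ^ 2 ∂ρ with hR
  have hRm : Measurable R := by
    have : Measurable fun z : T × Θ => ‖Function.uncurry Y z - s₁ z‖ₑ ^ 2 := by fun_prop
    exact this.lintegral_prod_left'
  have hRint : ∫⁻ θ, R θ ∂Q ≤ ENNReal.ofReal (ε₁ ^ 2 * Real.exp (-K)) := by
    rw [lintegral_prod_symm _ (by fun_prop)] at happ₁'
    exact happ₁'.trans (ENNReal.ofReal_le_ofReal (min_le_right _ _))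
  set D : Set Θ := {θ | R θ ≤ ENNReal.ofReal (ε₁ ^ 2)} with hD
  have hDm : MeasurableSet D := measurableSet_le hRm measurable_const
  have hDc : Q Dᶜ ≤ ENNReal.ofReal (Real.exp (-K)) := by
    have h1 := mul_meas_ge_le_lintegral (μ := Q) hRm (ENNReal.ofReal (ε₁ ^ 2))
    have h2 : Dᶜ ⊆ {θ | ENNReal.ofReal (ε₁ ^ 2) ≤ R θ} := fun θ hθ => by
      have h4 : ¬ R θ ≤ ENNReal.ofReal (ε₁ ^ 2) := hθ
      exact (not_le.1 h4).le
    have h3 : ENNReal.ofReal (ε₁ ^ 2) * Q Dᶜ ≤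
        ENNReal.ofReal (ε₁ ^ 2) * ENNReal.ofReal (Real.exp (-K)) := by
      rw [← ENNReal.ofReal_mul (by positivity)]
      exact (mul_le_mul_right (measure_mono h2) _).trans (h1.trans hRint)
    exact (ENNReal.mul_le_mul_iff_right (by simp [hε₁pos.ne']) (by simp)).1 h3
  refine ⟨S → ℤ, inferInstance, fun i => A i ∩ D, fun i => (hAm i).inter hDm, ?_, ?_, ?_⟩
  · intro i θ hθ θ' hθ'
    have h1 : ∫⁻ x, ‖Y (t₁ (p₁ x)) θ - Y (t₁ (p₁ x)) θ'‖ₑ ^ 2 ∂ρ ≤ ENNReal.ofReal (5 * ε₁ ^ 2) := by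
      have h2 := ofReal_norm_sq_weighted ρ hp fun i => Y (t₁ i.2) θ - Y (t₁ i.2) θ'
      refine (le_of_eq h2.symm).trans (ENNReal.ofReal_le_ofReal ?_)
      refine le_trans (le_of_eq ?_) (hAd i θ hθ.1 θ' hθ'.1)
      congr 2
      ext i
      simp [hGdef, mul_sub, hW]
    have hYx : ∀ θ, Measurable fun x => Y x θ := fun θ => hYm.comp measurable_prodMk_right
    have hsx : ∀ θ, Measurable fun x => Y (t₁ (p₁ x)) θ := fun θ =>
      hs₁m.comp measurable_prodMk_right
    calc ∫⁻ x, ‖Y x θ - Y x θ'‖ₑ ^ 2 ∂ρ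
        = ∫⁻ x, ‖(Y x θ - Y (t₁ (p₁ x)) θ) + ((Y (t₁ (p₁ x)) θ - Y (t₁ (p₁ x)) θ') +
            (-(Y x θ' - Y (t₁ (p₁ x)) θ')))‖ₑ ^ 2 ∂ρ := by
          refine lintegral_congr fun x => ?_
          congr 2
          ring
      _ ≤ 2 * (R θ + 2 * (ENNReal.ofReal (5 * ε₁ ^ 2) + R θ')) := by
          refine (lintegral_enorm_add_sq_le ρ ((hYx θ).sub (hsx θ))).trans ?_
          refine mul_le_mul_right (add_le_add le_rfl ?_) _
          refine (lintegral_enorm_add_sq_le ρ ((hsx θ).sub (hsx θ'))).trans ?_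
          simp only [enorm_neg]
          exact mul_le_mul_right (add_le_add h1 le_rfl) _
      _ ≤ 2 * (ENNReal.ofReal (ε₁ ^ 2) +
            2 * (ENNReal.ofReal (5 * ε₁ ^ 2) + ENNReal.ofReal (ε₁ ^ 2))) := by
          gcongr
          · exact hθ.2
          · exact hθ'.2
      _ ≤ ENNReal.ofReal (ε ^ 2) := by
          rw [show (2 : ℝ≥0∞) = ENNReal.ofReal 2 by simp,
            ← ENNReal.ofReal_add (by positivity) (by positivity),
            ← ENNReal.ofReal_mul (by norm_num),
            ← ENNReal.ofReal_add (by positivity) (by positivity),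
            ← ENNReal.ofReal_mul (by norm_num)]
          refine ENNReal.ofReal_le_ofReal ?_
          rw [hε₁]
          nlinarith [sq_nonneg ε]
  · calc ∑' i, (Q (A i ∩ D)) ^ (1 / 2 : ℝ) ≤ ∑' i, (Q (A i)) ^ (1 / 2 : ℝ) :=
          ENNReal.tsum_le_tsum fun i =>
            ENNReal.rpow_le_rpow (measure_mono Set.inter_subset_left) (by norm_num)
      _ ≤ _ := hAs
      _ = ENNReal.ofReal (Real.exp (a * n)) := by
          rw [← hB, hK, hc]
          congr 2
          field_simp
  · have h1 : (⋃ i, A i ∩ D)ᶜ ⊆ (⋃ i, A i)ᶜ ∪ Dᶜ := by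
      rw [← Set.iUnion_inter, Set.compl_inter]
    refine (measure_mono h1).trans ((measure_union_le _ _).trans ?_)
    rw [two_mul]
    exact add_le_add hAc hDc

end

/-! ### Integrated likelihoods of separated sets of parameters -/

section

variable {Ω 𝒵 Θ : Type*} [MeasurableSpace Ω] [MeasurableSpace 𝒵] [MeasurableSpace Θ]
  {P : Measure Ω} {μ : Measure 𝒵} {Q : Measure Θ} {W : ℕ → Ω → 𝒵}

/-- The expectation of a product over an independent sample with common law `μ`. -/
lemma lintegral_prod_sample (hW : ∀ i, Measurable (W i)) (hind : iIndepFun W P)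
    (hlaw : ∀ i, P.map (W i) = μ) {f : 𝒵 → ℝ≥0∞} (hf : Measurable f) (n : ℕ) :
    ∫⁻ ω, ∏ i : Fin n, f (W i ω) ∂P = (∫⁻ z, f z ∂μ) ^ n := by
  rw [lintegral_prod_eq_prod_lintegral_of_indepFun Finset.univ
    (fun (i : Fin n) ω => f (W i ω))
    ((hind.precomp Fin.val_injective).comp (fun _ => f) fun _ => hf) fun i => hf.comp (hW i)]
  have : ∀ i : Fin n, ∫⁻ ω, f (W i ω) ∂P = ∫⁻ z, f z ∂μ := fun i => by
    rw [← lintegral_map hf (hW i), hlaw]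
  simp [this]

/-- The likelihood of the first `n` observations, relative to the true law. -/
noncomputable def relLikelihood (r : Θ → 𝒵 → ℝ) (W : ℕ → Ω → 𝒵) (n : ℕ) (ω : Ω) (θ : Θ) : ℝ≥0∞ :=
  ∏ i : Fin n, ENNReal.ofReal (r θ (W i ω))

lemma measurable_relLikelihood {r : Θ → 𝒵 → ℝ} (hr : Measurable (Function.uncurry r))
    (hW : ∀ i, Measurable (W i)) (n : ℕ) :
    Measurable fun z : Ω × Θ => relLikelihood r W n z.1 z.2 := by
  unfold relLikelihood
  refine Finset.measurable_fun_prod _ fun i _ => ?_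
  exact (hr.comp (measurable_snd.prodMk ((hW i).comp measurable_fst))).ennreal_ofReal

/-- Cauchy-Schwarz with a product weight: the square root of the integrated likelihood of a set of
parameters that are separated from the truth is exponentially small in mean. -/
lemma lintegral_sqrt_setLIntegral_relLikelihood_le [SFinite P] [SFinite Q] [SFinite μ]
    {r : Θ → 𝒵 → ℝ}
    (hr : Measurable (Function.uncurry r))
    (hW : ∀ i, Measurable (W i)) (hind : iIndepFun W P) (hlaw : ∀ i, P.map (W i) = μ)
    {A : Set Θ} (hA : MeasurableSet A) {w : 𝒵 → ℝ≥0∞} (hw : Measurable w) (hw0 : ∀ z, w z ≠ 0)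
    (hwtop : ∀ z, w z ≠ ⊤) {β : ℝ≥0∞}
    (hβ : ∀ θ ∈ A, (∫⁻ z, w z ∂μ) * ∫⁻ z, (w z)⁻¹ * ENNReal.ofReal (r θ z) ∂μ ≤ β ^ 2) (n : ℕ) :
    ∫⁻ ω, (∫⁻ θ in A, relLikelihood r W n ω θ ∂Q) ^ (1 / 2 : ℝ) ∂P ≤
      (Q A) ^ (1 / 2 : ℝ) * β ^ n := by
  set V : Ω → ℝ≥0∞ := fun ω => ∏ i : Fin n, w (W i ω) with hV
  have hVm : Measurable V := Finset.measurable_fun_prod _ fun i _ => hw.comp (hW i)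
  have hV0 : ∀ ω, V ω ≠ 0 := fun ω => Finset.prod_ne_zero_iff.2 fun i _ => hw0 _
  have hVtop : ∀ ω, V ω ≠ ⊤ := fun ω => ENNReal.prod_ne_top fun i _ => hwtop _
  set I : Ω → ℝ≥0∞ := fun ω => ∫⁻ θ in A, relLikelihood r W n ω θ ∂Q with hI
  have hLm := measurable_relLikelihood hr hW n
  have hIm : Measurable I := hLm.lintegral_prod_right'
  have hsplit : ∀ ω, I ω ^ (1 / 2 : ℝ) = V ω ^ (1 / 2 : ℝ) * ((V ω)⁻¹ * I ω) ^ (1 / 2 : ℝ) := by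
    intro ω
    rw [← ENNReal.mul_rpow_of_nonneg _ _ (by norm_num), ← mul_assoc,
      ENNReal.mul_inv_cancel (hV0 ω) (hVtop ω), one_mul]
  have hCS := ENNReal.lintegral_mul_le_Lp_mul_Lq P (p := 2) (q := 2)
    (by constructor <;> norm_num)
    (f := fun ω => V ω ^ (1 / 2 : ℝ)) (g := fun ω => ((V ω)⁻¹ * I ω) ^ (1 / 2 : ℝ))
    (hVm.pow_const _).aemeasurable ((hVm.inv.mul hIm).pow_const _).aemeasurable
  have hhalf : ∀ x : ℝ≥0∞, (x ^ (1 / 2 : ℝ)) ^ (2 : ℝ) = x := fun x => by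
    rw [← ENNReal.rpow_mul]; norm_num
  simp only [Pi.mul_apply, hhalf] at hCS
  have h1 : ∫⁻ ω, V ω ∂P = (∫⁻ z, w z ∂μ) ^ n := lintegral_prod_sample hW hind hlaw hw n
  have h2 : ∫⁻ ω, (V ω)⁻¹ * I ω ∂P =
      ∫⁻ θ in A, (∫⁻ z, (w z)⁻¹ * ENNReal.ofReal (r θ z) ∂μ) ^ n ∂Q := by
    have h3 : ∀ ω, (V ω)⁻¹ * I ω = ∫⁻ θ in A, (V ω)⁻¹ * relLikelihood r W n ω θ ∂Q := by
      intro ω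
      rw [hI, lintegral_const_mul' _ _ (ENNReal.inv_ne_top.2 (hV0 ω))]
    simp_rw [h3]
    rw [lintegral_lintegral_swap ((hVm.comp measurable_fst).inv.mul hLm).aemeasurable]
    refine lintegral_congr fun θ => ?_
    have hrθ : Measurable (r θ) := hr.comp measurable_prodMk_left
    have hwr : Measurable fun z => (w z)⁻¹ * ENNReal.ofReal (r θ z) :=
      hw.inv.mul hrθ.ennreal_ofReal
    rw [← lintegral_prod_sample hW hind hlaw hwr n]
    refine lintegral_congr fun ω => ?_
    rw [hV, ENNReal.prod_inv_distrib, relLikelihood, ← Finset.prod_mul_distrib]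
    intro i _ j _ _
    exact Or.inl (hw0 _)
  calc ∫⁻ ω, I ω ^ (1 / 2 : ℝ) ∂P
      = ∫⁻ ω, V ω ^ (1 / 2 : ℝ) * ((V ω)⁻¹ * I ω) ^ (1 / 2 : ℝ) ∂P := lintegral_congr hsplit
    _ ≤ _ := hCS
    _ = ((∫⁻ z, w z ∂μ) ^ n *
          ∫⁻ θ in A, (∫⁻ z, (w z)⁻¹ * ENNReal.ofReal (r θ z) ∂μ) ^ n ∂Q) ^ (1 / 2 : ℝ) := by
        rw [h1, h2, ENNReal.mul_rpow_of_nonneg _ _ (by norm_num)]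
    _ ≤ (∫⁻ _ in A, (β ^ 2) ^ n ∂Q) ^ (1 / 2 : ℝ) := by
        refine ENNReal.rpow_le_rpow ?_ (by norm_num)
        rw [← lintegral_const_mul _ ?_]
        · refine setLIntegral_mono' hA fun θ hθ => ?_
          rw [← mul_pow]
          exact pow_le_pow_left' (hβ θ hθ) n
        · refine Measurable.pow_const ?_ n
          have : Measurable fun z : Θ × 𝒵 => (w z.2)⁻¹ * ENNReal.ofReal (r z.1 z.2) :=
            (hw.comp measurable_snd).inv.mul hr.ennreal_ofReal
          exact this.lintegral_prod_right'
    _ = _ := by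
        rw [setLIntegral_const, mul_comm, ENNReal.mul_rpow_of_nonneg _ _ (by norm_num)]
        congr 1
        rw [← pow_mul, mul_comm 2 n, pow_mul, ← ENNReal.rpow_natCast (β ^ n) 2,
          ← ENNReal.rpow_mul]
        norm_num

lemma exp_le_one_add_add_sq {x : ℝ} (hx : |x| ≤ 1) : Real.exp x ≤ 1 + x + x ^ 2 := by
  have := Real.abs_exp_sub_one_sub_id_le hx
  linarith [abs_le.1 this]

/-- A bounded test function `g` whose mean under the density `r` exceeds its mean under the truth
by `ε` gives the exponential weight `exp (ε g / 4)` that separates the two laws. -/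
lemma lintegral_exp_mul_lintegral_exp_neg_le [IsProbabilityMeasure μ] {g r : 𝒵 → ℝ}
    (hg : Measurable g) (hg1 : ∀ z, |g z| ≤ 1) (hr0 : ∀ z, 0 ≤ r z) (hri : Integrable r μ)
    (hr1 : ∫ z, r z ∂μ = 1) {ε : ℝ} (hε : 0 < ε) (hε1 : ε ≤ 1)
    (hgap : ∫ z, g z ∂μ + ε ≤ ∫ z, g z * r z ∂μ) :
    (∫⁻ z, ENNReal.ofReal (Real.exp (ε / 4 * g z)) ∂μ) *
      ∫⁻ z, (ENNReal.ofReal (Real.exp (ε / 4 * g z)))⁻¹ * ENNReal.ofReal (r z) ∂μ ≤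
      ENNReal.ofReal (Real.exp (-(ε ^ 2 / 16))) ^ 2 := by
  set s : ℝ := ε / 4 with hs
  have hs0 : 0 < s := by positivity
  have hgi : Integrable g μ := Integrable.of_bound hg.aestronglyMeasurable 1
    (Eventually.of_forall hg1)
  have hgri : Integrable (fun z => g z * r z) μ :=
    hri.bdd_mul hg.aestronglyMeasurable (Eventually.of_forall hg1)
  have hi₁ : Integrable (fun z => 1 + s * g z) μ := (integrable_const _).add (hgi.const_mul s)
  have hi₂ : Integrable (fun z => 1 + s * g z + s ^ 2) μ := hi₁.add (integrable_const _)
  have hi₃ : Integrable (fun z => r z - s * (g z * r z)) μ := hri.sub (hgri.const_mul s)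
  have hi₄ : Integrable (fun z => r z - s * (g z * r z) + s ^ 2 * r z) μ :=
    hi₃.add (hri.const_mul _)
  have hsg : ∀ z, |s * g z| ≤ s := fun z => by
    rw [abs_mul, abs_of_pos hs0]; nlinarith [hg1 z]
  have hsq : ∀ z, (s * g z) ^ 2 ≤ s ^ 2 := fun z => by
    rw [← sq_abs]; exact pow_le_pow_left₀ (abs_nonneg _) (hsg z) 2
  have h1 : ∫⁻ z, ENNReal.ofReal (Real.exp (s * g z)) ∂μ ≤
      ENNReal.ofReal (Real.exp (s * ∫ z, g z ∂μ + s ^ 2)) := by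
    calc ∫⁻ z, ENNReal.ofReal (Real.exp (s * g z)) ∂μ
        ≤ ∫⁻ z, ENNReal.ofReal (1 + s * g z + s ^ 2) ∂μ := by
          refine lintegral_mono fun z => ENNReal.ofReal_le_ofReal ?_
          linarith [exp_le_one_add_add_sq ((hsg z).trans (by linarith)), hsq z]
      _ = ENNReal.ofReal (∫ z, (1 + s * g z + s ^ 2) ∂μ) := by
          rw [ofReal_integral_eq_lintegral_ofReal hi₂]
          refine Eventually.of_forall fun z => ?_
          simp only [Pi.zero_apply]
          nlinarith [abs_le.1 (hsg z)]
      _ ≤ _ := by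
          refine ENNReal.ofReal_le_ofReal ?_
          rw [integral_add hi₁ (integrable_const _),
            integral_add (integrable_const _) (hgi.const_mul s), integral_const_mul]
          simp only [integral_const, probReal_univ, one_smul]
          linarith [Real.add_one_le_exp (s * ∫ z, g z ∂μ + s ^ 2)]
  have h2 : ∫⁻ z, (ENNReal.ofReal (Real.exp (s * g z)))⁻¹ * ENNReal.ofReal (r z) ∂μ ≤
      ENNReal.ofReal (Real.exp (-(s * ∫ z, g z * r z ∂μ) + s ^ 2)) := by
    calc ∫⁻ z, (ENNReal.ofReal (Real.exp (s * g z)))⁻¹ * ENNReal.ofReal (r z) ∂μ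
        ≤ ∫⁻ z, ENNReal.ofReal (r z - s * (g z * r z) + s ^ 2 * r z) ∂μ := by
          refine lintegral_mono fun z => ?_
          rw [← ENNReal.ofReal_inv_of_pos (Real.exp_pos _), ← Real.exp_neg,
            ← ENNReal.ofReal_mul (Real.exp_pos _).le]
          refine ENNReal.ofReal_le_ofReal ?_
          have h3 : |-(s * g z)| ≤ 1 := by rw [abs_neg]; exact (hsg z).trans (by linarith)
          have h4 := exp_le_one_add_add_sq h3
          have h5 : Real.exp (-(s * g z)) ≤ 1 - s * g z + s ^ 2 := by
            have := hsq z
            nlinarith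
          nlinarith [hr0 z]
      _ = ENNReal.ofReal (∫ z, (r z - s * (g z * r z) + s ^ 2 * r z) ∂μ) := by
          rw [ofReal_integral_eq_lintegral_ofReal hi₄]
          refine Eventually.of_forall fun z => ?_
          simp only [Pi.zero_apply]
          have h3 : s * g z ≤ 1 := by linarith [abs_le.1 (hsg z)]
          have h4 : 0 ≤ r z * (1 - s * g z + s ^ 2) := mul_nonneg (hr0 z) (by nlinarith)
          linarith
      _ ≤ _ := by
          refine ENNReal.ofReal_le_ofReal ?_
          rw [integral_add hi₃ (hri.const_mul _),
            integral_sub hri (hgri.const_mul s), integral_const_mul, integral_const_mul, hr1]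
          linarith [Real.add_one_le_exp (-(s * ∫ z, g z * r z ∂μ) + s ^ 2)]
  refine (mul_le_mul' h1 h2).trans ?_
  rw [← ENNReal.ofReal_mul (Real.exp_pos _).le, ← Real.exp_add,
    ← ENNReal.ofReal_pow (Real.exp_pos _).le, ← Real.exp_nat_mul]
  refine ENNReal.ofReal_le_ofReal (Real.exp_le_exp.2 ?_)
  have h3 : s * (∫ z, g z ∂μ + ε) ≤ s * ∫ z, g z * r z ∂μ := mul_le_mul_of_nonneg_left hgap hs0.le
  push_cast
  rw [hs] at h3 ⊢
  nlinarith

end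

/-! ### Posterior consistency -/

lemma sqrt_tsum_le_tsum_sqrt {ι : Type*} (x : ι → ℝ≥0∞) :
    (∑' i, x i) ^ (1 / 2 : ℝ) ≤ ∑' i, x i ^ (1 / 2 : ℝ) := by
  set S := ∑' i, x i ^ (1 / 2 : ℝ) with hS
  have h1 : ∑' i, x i ≤ S * S := by
    rw [hS, ← ENNReal.tsum_mul_right]
    refine ENNReal.tsum_le_tsum fun i => ?_
    calc x i = x i ^ (1 / 2 : ℝ) * x i ^ (1 / 2 : ℝ) := by
          rw [← ENNReal.rpow_add_of_nonneg _ _ (by norm_num) (by norm_num)]; norm_num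
      _ ≤ _ := mul_le_mul_right (ENNReal.le_tsum i) _
  refine (ENNReal.rpow_le_rpow h1 (by norm_num)).trans (le_of_eq ?_)
  rw [ENNReal.mul_rpow_of_nonneg _ _ (by norm_num),
    ← ENNReal.rpow_add_of_nonneg _ _ (by norm_num) (by norm_num)]
  norm_num

section

variable {Ω 𝒵 Θ : Type*} [MeasurableSpace Ω] [MeasurableSpace 𝒵] [MeasurableSpace Θ]
  {P : Measure Ω} {μ : Measure 𝒵} {Q : Measure Θ} {W : ℕ → Ω → 𝒵}

/-- Lower bound of the marginal likelihood. If the log-likelihood ratio exceeds `-a` on a prior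
neighbourhood `B` where `a` has a small mean `κ₀` under the truth, then the marginal likelihood is
at least `exp (-κ n) Q(B) / 2` up to probability `2 κ₀ / κ`. Markov's inequality suffices, as `κ₀`
may be chosen after `κ`. -/
lemma measure_lintegral_relLikelihood_lt_le [SFinite P] [IsProbabilityMeasure Q] [SFinite μ]
    {r : Θ → 𝒵 → ℝ} (hW : ∀ i, Measurable (W i)) (hlaw : ∀ i, P.map (W i) = μ)
    {B : Set Θ} (hB : MeasurableSet B) (hQB : Q B ≠ 0)
    {a : Θ → 𝒵 → ℝ≥0∞} (ham : Measurable (Function.uncurry a))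
    (har : ∀ θ ∈ B, ∀ z, a θ z ≠ ⊤ → Real.exp (-(a θ z).toReal) ≤ r θ z) {κ₀ κ : ℝ} (hκ : 0 < κ)
    (haκ : ∀ θ ∈ B, ∫⁻ z, a θ z ∂μ ≤ ENNReal.ofReal κ₀) {n : ℕ} (hn : 0 < n) :
    P {ω | ∫⁻ θ, relLikelihood r W n ω θ ∂Q < ENNReal.ofReal (Real.exp (-(κ * n))) * (Q B / 2)} ≤
      ENNReal.ofReal (2 * κ₀ / κ) := by
  set s : Ω → Θ → ℝ≥0∞ := fun ω θ => ∑ i : Fin n, a θ (W i ω) with hs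
  have hsm : Measurable fun z : Ω × Θ => s z.1 z.2 :=
    Finset.measurable_fun_sum _ fun i _ =>
      ham.comp (measurable_snd.prodMk ((hW i).comp measurable_fst))
  set N : Ω → ℝ≥0∞ := fun ω => ∫⁻ θ in B, s ω θ ∂Q with hN
  have hNm : Measurable N := hsm.lintegral_prod_right'
  have hκn : 0 < κ * n := by positivity
  have hQB' : Q B / 2 ≠ 0 := by simp [hQB]
  have hQBtop : Q B ≠ ⊤ := measure_ne_top _ _
  have hNint : ∫⁻ ω, N ω ∂P ≤ ENNReal.ofReal κ₀ * n * Q B := by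
    rw [hN, lintegral_lintegral_swap hsm.aemeasurable]
    calc ∫⁻ θ in B, ∫⁻ ω, s ω θ ∂P ∂Q ≤ ∫⁻ _ in B, ENNReal.ofReal κ₀ * n ∂Q := by
          refine setLIntegral_mono' hB fun θ hθ => ?_
          have haθ : Measurable (a θ) := ham.comp measurable_prodMk_left
          have hsum : ∫⁻ ω, s ω θ ∂P = ∑ i : Fin n, ∫⁻ ω, a θ (W i ω) ∂P :=
            lintegral_finsetSum _ fun i _ => haθ.comp (hW i)
          rw [hsum]
          have : ∀ i : Fin n, ∫⁻ ω, a θ (W i ω) ∂P = ∫⁻ z, a θ z ∂μ := fun i => by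
            rw [← lintegral_map haθ (hW i), hlaw]
          simp only [this, Finset.sum_const, Finset.card_univ, Fintype.card_fin, nsmul_eq_mul]
          rw [mul_comm]
          exact mul_le_mul_left (haκ θ hθ) _
      _ = ENNReal.ofReal κ₀ * n * Q B := setLIntegral_const _ _
  have hsub : {ω | ∫⁻ θ, relLikelihood r W n ω θ ∂Q <
      ENNReal.ofReal (Real.exp (-(κ * n))) * (Q B / 2)} ⊆
      {ω | ENNReal.ofReal (κ * n) * (Q B / 2) ≤ N ω} := by
    intro ω hω
    by_contra hcon
    have hcon' : N ω < ENNReal.ofReal (κ * n) * (Q B / 2) := not_le.1 hcon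
    have hsω : Measurable (s ω) := hsm.comp measurable_prodMk_left
    set D : Set Θ := {θ | ENNReal.ofReal (κ * n) < s ω θ} with hD
    have hDm : MeasurableSet D := measurableSet_lt measurable_const hsω
    have h1 : Q (B ∩ D) ≤ Q B / 2 := by
      have h2 := mul_meas_ge_le_lintegral (μ := Q.restrict B) hsω (ENNReal.ofReal (κ * n))
      have h3 : Q (B ∩ D) ≤ (Q.restrict B) {θ | ENNReal.ofReal (κ * n) ≤ s ω θ} := by
        rw [Set.inter_comm, ← Measure.restrict_apply hDm]
        refine measure_mono fun θ hθ => ?_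
        have hθ' : ENNReal.ofReal (κ * n) < s ω θ := hθ
        exact hθ'.le
      have h4 : ENNReal.ofReal (κ * n) * Q (B ∩ D) ≤ ENNReal.ofReal (κ * n) * (Q B / 2) :=
        (mul_le_mul_right h3 _).trans (h2.trans hcon'.le)
      exact (ENNReal.mul_le_mul_iff_right (by simpa using hκn) (by simp)).1 h4
    have h2 : Q B / 2 ≤ Q (B \ D) := by
      have h3 := measure_inter_add_sdiff (μ := Q) B hDm
      have h4 : Q B / 2 + Q B / 2 ≤ Q B / 2 + Q (B \ D) := by
        rw [ENNReal.add_halves]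
        exact (h3.symm.le).trans (add_le_add h1 le_rfl)
      exact (ENNReal.add_le_add_iff_left (ENNReal.div_ne_top hQBtop (by simp))).1 h4
    have h3 : ENNReal.ofReal (Real.exp (-(κ * n))) * (Q B / 2) ≤
        ∫⁻ θ, relLikelihood r W n ω θ ∂Q := by
      calc _ ≤ ENNReal.ofReal (Real.exp (-(κ * n))) * Q (B \ D) := by gcongr
        _ = ∫⁻ _ in B \ D, ENNReal.ofReal (Real.exp (-(κ * n))) ∂Q := (setLIntegral_const _ _).symm
        _ ≤ ∫⁻ θ in B \ D, relLikelihood r W n ω θ ∂Q := by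
            refine setLIntegral_mono' (hB.diff hDm) fun θ hθ => ?_
            have h5 : s ω θ ≤ ENNReal.ofReal (κ * n) := not_lt.1 hθ.2
            have h6 : s ω θ ≠ ⊤ := ne_top_of_le_ne_top ENNReal.ofReal_ne_top h5
            have h7 : ∀ i : Fin n, a θ (W i ω) ≠ ⊤ := fun i =>
              ENNReal.sum_ne_top.1 h6 i (Finset.mem_univ i)
            have h8 : ∑ i : Fin n, (a θ (W i ω)).toReal ≤ κ * n := by
              rw [← ENNReal.toReal_sum fun i _ => h7 i]
              exact ENNReal.toReal_le_of_le_ofReal hκn.le h5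
            calc ENNReal.ofReal (Real.exp (-(κ * n)))
                ≤ ENNReal.ofReal (Real.exp (∑ i : Fin n, -(a θ (W i ω)).toReal)) := by
                  refine ENNReal.ofReal_le_ofReal (Real.exp_le_exp.2 ?_)
                  rw [Finset.sum_neg_distrib]
                  linarith
              _ = ∏ i : Fin n, ENNReal.ofReal (Real.exp (-(a θ (W i ω)).toReal)) := by
                  rw [Real.exp_sum, ENNReal.ofReal_prod_of_nonneg fun _ _ => (Real.exp_pos _).le]
              _ ≤ relLikelihood r W n ω θ :=
                  Finset.prod_le_prod' fun i _ =>
                    ENNReal.ofReal_le_ofReal (har θ hθ.1 _ (h7 i))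
        _ ≤ _ := setLIntegral_le_lintegral _ _
    exact absurd hω (not_lt.2 h3)
  refine (measure_mono hsub).trans ?_
  have h1 :=
    (mul_meas_ge_le_lintegral (μ := P) hNm (ENNReal.ofReal (κ * n) * (Q B / 2))).trans hNint
  have h2 : ENNReal.ofReal κ₀ * n * Q B =
      (ENNReal.ofReal (κ * n) * (Q B / 2)) * ENNReal.ofReal (2 * κ₀ / κ) := by
    have h3 : Q B = 2 * (Q B / 2) := (ENNReal.mul_div_cancel (by simp) (by simp)).symm
    have h4 : ENNReal.ofReal (κ * n) * ENNReal.ofReal (2 * κ₀ / κ) =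
        2 * (ENNReal.ofReal κ₀ * n) := by
      rw [← ENNReal.ofReal_mul hκn.le]
      have : κ * n * (2 * κ₀ / κ) = 2 * (n * κ₀) := by field_simp
      rw [this, ENNReal.ofReal_mul (by norm_num), ENNReal.ofReal_mul (by positivity)]
      simp [mul_comm]
    calc ENNReal.ofReal κ₀ * n * Q B = ENNReal.ofReal κ₀ * n * (2 * (Q B / 2)) := by rw [← h3]
      _ = (2 * (ENNReal.ofReal κ₀ * n)) * (Q B / 2) := by ring
      _ = _ := by rw [← h4]; ring
  rw [h2] at h1
  refine (ENNReal.mul_le_mul_iff_right ?_ ?_).1 h1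
  · exact mul_ne_zero (by simpa using hκn) hQB'
  · exact ENNReal.mul_ne_top (by simp) (ENNReal.div_ne_top hQBtop (by simp))

/-- Posterior consistency. The posterior mass of a set `U` of parameters tends to zero in
probability if the truth is in the support of the prior in the sense of
`measure_lintegral_relLikelihood_lt_le`, and if `U` is covered, up to exponentially small prior
mass, by cells that are separated from the truth by bounded tests and for which the square roots of
the prior masses do not sum up too fast. -/
theorem tendsto_measure_posterior_mass [IsProbabilityMeasure P] [IsProbabilityMeasure Q]
    [IsProbabilityMeasure μ]
    {r : Θ → 𝒵 → ℝ} (hr : Measurable (Function.uncurry r)) (hr0 : ∀ θ z, 0 ≤ r θ z)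
    (hri : ∀ θ, Integrable (r θ) μ) (hr1 : ∀ θ, ∫ z, r θ z ∂μ = 1)
    (hW : ∀ i, Measurable (W i)) (hind : iIndepFun W P) (hlaw : ∀ i, P.map (W i) = μ)
    {a : Θ → 𝒵 → ℝ≥0∞} (ham : Measurable (Function.uncurry a))
    (har : ∀ θ z, a θ z ≠ ⊤ → Real.exp (-(a θ z).toReal) ≤ r θ z)
    (hsupp : ∀ κ₀ : ℝ, 0 < κ₀ → Q {θ | ∫⁻ z, a θ z ∂μ ≤ ENNReal.ofReal κ₀} ≠ 0)
    {U : Set Θ} (hU : MeasurableSet U) {ε c : ℝ} (hε : 0 < ε) (hε1 : ε ≤ 1) (hc : 0 < c)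
    (hcover : ∀ᶠ n : ℕ in atTop, ∃ (κ : Type) (_ : Countable κ) (A : κ → Set Θ),
      (∀ i, MeasurableSet (A i)) ∧
      (∀ i, ∃ g : 𝒵 → ℝ, Measurable g ∧ (∀ z, |g z| ≤ 1) ∧
        ∀ θ ∈ A i ∩ U, ∫ z, g z ∂μ + ε ≤ ∫ z, g z * r θ z ∂μ) ∧
      ∑' i, (Q (A i)) ^ (1 / 2 : ℝ) ≤ ENNReal.ofReal (Real.exp (ε ^ 2 / 32 * n)) ∧
      Q (⋃ i, A i)ᶜ ≤ 2 * ENNReal.ofReal (Real.exp (-(c * n))))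
    {η : ℝ} (hη : 0 < η) :
    Tendsto (fun n : ℕ => P {ω | ENNReal.ofReal η * ∫⁻ θ, relLikelihood r W n ω θ ∂Q ≤
      ∫⁻ θ in U, relLikelihood r W n ω θ ∂Q}) atTop (𝓝 0) := by
  set b : ℝ := min (ε ^ 2 / 32) (c / 2) with hb
  have hbpos : 0 < b := by positivity
  -- upper bound of the numerator
  have hupper : ∀ᶠ n : ℕ in atTop,
      ∫⁻ ω, (∫⁻ θ in U, relLikelihood r W n ω θ ∂Q) ^ (1 / 2 : ℝ) ∂P ≤
        ENNReal.ofReal (3 * Real.exp (-(b * n))) := by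
    filter_upwards [hcover] with n hn
    obtain ⟨ι, _, A, hAm, hAg, hAs, hAc⟩ := hn
    have hLm := measurable_relLikelihood hr hW n
    have hIm : ∀ S : Set Θ, Measurable fun ω => ∫⁻ θ in S, relLikelihood r W n ω θ ∂Q :=
      fun S => hLm.lintegral_prod_right'
    set C : Set Θ := (⋃ i, A i)ᶜ with hC
    have hCm : MeasurableSet C := (MeasurableSet.iUnion hAm).compl
    have hsplit : ∀ ω, (∫⁻ θ in U, relLikelihood r W n ω θ ∂Q) ^ (1 / 2 : ℝ) ≤
        (∑' i, (∫⁻ θ in A i ∩ U, relLikelihood r W n ω θ ∂Q) ^ (1 / 2 : ℝ)) +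
          (∫⁻ θ in C, relLikelihood r W n ω θ ∂Q) ^ (1 / 2 : ℝ) := by
      intro ω
      have h1 : U ⊆ (⋃ i, A i ∩ U) ∪ C := by
        intro θ hθ
        by_cases h : θ ∈ ⋃ i, A i
        · left
          rw [← Set.iUnion_inter]
          exact ⟨h, hθ⟩
        · exact Or.inr h
      have h2 : ∫⁻ θ in U, relLikelihood r W n ω θ ∂Q ≤
          (∑' i, ∫⁻ θ in A i ∩ U, relLikelihood r W n ω θ ∂Q) +
            ∫⁻ θ in C, relLikelihood r W n ω θ ∂Q :=
        (lintegral_mono_set h1).trans ((lintegral_union_le _ _ _).trans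
          (add_le_add (lintegral_iUnion_le _ _) le_rfl))
      refine (ENNReal.rpow_le_rpow h2 (by norm_num)).trans ?_
      refine (ENNReal.rpow_add_le_add_rpow _ _ (by norm_num) (by norm_num)).trans ?_
      refine add_le_add ?_ le_rfl
      exact sqrt_tsum_le_tsum_sqrt _
    set β : ℝ≥0∞ := ENNReal.ofReal (Real.exp (-(ε ^ 2 / 16))) with hβ
    have hAi : ∀ i, ∫⁻ ω, (∫⁻ θ in A i ∩ U, relLikelihood r W n ω θ ∂Q) ^ (1 / 2 : ℝ) ∂P ≤
        (Q (A i)) ^ (1 / 2 : ℝ) * β ^ n := by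
      intro i
      obtain ⟨g, hgm, hg1, hgA⟩ := hAg i
      refine (lintegral_sqrt_setLIntegral_relLikelihood_le hr hW hind hlaw ((hAm i).inter hU)
        (w := fun z => ENNReal.ofReal (Real.exp (ε / 4 * g z))) (by fun_prop)
        (fun z => by simp [Real.exp_pos]) (fun z => by simp) (β := β)
        (fun θ hθ => lintegral_exp_mul_lintegral_exp_neg_le hgm hg1 (hr0 θ) (hri θ) (hr1 θ) hε hε1
          (hgA θ hθ)) n).trans ?_
      gcongr
      exact Set.inter_subset_left
    have hCi : ∫⁻ ω, (∫⁻ θ in C, relLikelihood r W n ω θ ∂Q) ^ (1 / 2 : ℝ) ∂P ≤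
        (Q C) ^ (1 / 2 : ℝ) := by
      refine (lintegral_sqrt_setLIntegral_relLikelihood_le hr hW hind hlaw hCm
        (w := fun _ => 1) measurable_const (by simp) (by simp) (β := 1)
        (fun θ _ => ?_) n).trans (by simp)
      have := ofReal_integral_eq_lintegral_ofReal (hri θ) (Eventually.of_forall (hr0 θ))
      rw [hr1] at this
      simp [← this]
    calc ∫⁻ ω, (∫⁻ θ in U, relLikelihood r W n ω θ ∂Q) ^ (1 / 2 : ℝ) ∂P
        ≤ ∫⁻ ω, ((∑' i, (∫⁻ θ in A i ∩ U, relLikelihood r W n ω θ ∂Q) ^ (1 / 2 : ℝ)) +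
          (∫⁻ θ in C, relLikelihood r W n ω θ ∂Q) ^ (1 / 2 : ℝ)) ∂P := lintegral_mono hsplit
      _ = ∑' i, ∫⁻ ω, (∫⁻ θ in A i ∩ U, relLikelihood r W n ω θ ∂Q) ^ (1 / 2 : ℝ) ∂P +
          ∫⁻ ω, (∫⁻ θ in C, relLikelihood r W n ω θ ∂Q) ^ (1 / 2 : ℝ) ∂P := by
          rw [lintegral_add_right _ ((hIm C).pow_const _),
            lintegral_tsum fun i => ((hIm _).pow_const _).aemeasurable]
      _ ≤ ∑' i, (Q (A i)) ^ (1 / 2 : ℝ) * β ^ n + (Q C) ^ (1 / 2 : ℝ) :=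
          add_le_add (ENNReal.tsum_le_tsum hAi) hCi
      _ ≤ ENNReal.ofReal (Real.exp (ε ^ 2 / 32 * n)) * β ^ n +
          (2 * ENNReal.ofReal (Real.exp (-(c * n)))) ^ (1 / 2 : ℝ) := by
          rw [ENNReal.tsum_mul_right]
          gcongr
      _ ≤ ENNReal.ofReal (Real.exp (-(b * n))) + ENNReal.ofReal (2 * Real.exp (-(b * n))) := by
          refine add_le_add ?_ ?_
          · rw [hβ, ← ENNReal.ofReal_pow (Real.exp_pos _).le, ← Real.exp_nat_mul,
              ← ENNReal.ofReal_mul (Real.exp_pos _).le, ← Real.exp_add]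
            refine ENNReal.ofReal_le_ofReal (Real.exp_le_exp.2 ?_)
            have : b * n ≤ ε ^ 2 / 32 * n :=
              mul_le_mul_of_nonneg_right (min_le_left _ _) (Nat.cast_nonneg n)
            linarith
          · rw [show (2 : ℝ≥0∞) = ENNReal.ofReal 2 by simp, ← ENNReal.ofReal_mul (by norm_num),
              ENNReal.ofReal_rpow_of_nonneg (by positivity) (by norm_num), ← Real.sqrt_eq_rpow]
            refine ENNReal.ofReal_le_ofReal (Real.sqrt_le_iff.2 ⟨by positivity, ?_⟩)
            rw [mul_pow, ← Real.exp_nat_mul]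
            have : b * n ≤ c / 2 * n :=
              mul_le_mul_of_nonneg_right (min_le_right _ _) (Nat.cast_nonneg n)
            have h2 : Real.exp (-(c * n)) ≤ Real.exp (((2 : ℕ) : ℝ) * -(b * n)) := by
              apply Real.exp_le_exp.2
              push_cast
              linarith
            have := Real.exp_pos (-(c * n))
            linarith
      _ = ENNReal.ofReal (3 * Real.exp (-(b * n))) := by
          rw [← ENNReal.ofReal_add (by positivity) (by positivity)]
          congr 1; ring
  rw [ENNReal.tendsto_nhds_zero]
  intro γ hγ
  -- the prior neighbourhood is chosen after the tolerance `γ`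
  obtain ⟨γ', hγ'0, hγ'⟩ : ∃ γ' : ℝ, 0 < γ' ∧ ENNReal.ofReal γ' + ENNReal.ofReal γ' ≤ γ := by
    by_cases htop : γ = ⊤
    · exact ⟨1, one_pos, by simp [htop]⟩
    · have h1 := ENNReal.toReal_pos hγ.ne' htop
      refine ⟨γ.toReal / 2, by positivity, ?_⟩
      rw [← ENNReal.ofReal_add (by positivity) (by positivity), add_halves,
        ENNReal.ofReal_toReal htop]
  set κ₀ : ℝ := γ' * b / 2 with hκ₀
  have hκ₀pos : 0 < κ₀ := by positivity
  set B : Set Θ := {θ | ∫⁻ z, a θ z ∂μ ≤ ENNReal.ofReal κ₀} with hB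
  have hBm : MeasurableSet B := measurableSet_le ham.lintegral_prod_right' measurable_const
  have hQB : Q B ≠ 0 := hsupp κ₀ hκ₀pos
  have hq : 0 < (Q B).toReal := ENNReal.toReal_pos hQB (measure_ne_top _ _)
  set q : ℝ := (Q B).toReal with hqdef
  have hQBq : Q B / 2 = ENNReal.ofReal (q / 2) := by
    rw [ENNReal.ofReal_div_of_pos (by norm_num), hqdef, ENNReal.ofReal_toReal (measure_ne_top _ _)]
    simp
  have hlim : ∀ᶠ n : ℕ in atTop,
      3 * Real.exp (-(b * n)) ≤ γ' * √(η * (Real.exp (-(b * n)) * (q / 2))) := by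
    have h1 : ∀ n : ℕ, γ' * √(η * (Real.exp (-(b * n)) * (q / 2))) =
        Real.exp (-(b * n)) * (Real.exp (b / 2 * n) * (γ' * √(η * (q / 2)))) := by
      intro n
      have h2 : η * (Real.exp (-(b * n)) * (q / 2)) =
          (Real.exp (-(b / 2 * n))) ^ 2 * (η * (q / 2)) := by
        rw [← Real.exp_nat_mul]
        have : ((2 : ℕ) : ℝ) * -(b / 2 * n) = -(b * n) := by push_cast; ring
        rw [this]; ring
      rw [h2, Real.sqrt_mul (by positivity), Real.sqrt_sq (Real.exp_pos _).le]
      have h3 : Real.exp (-(b / 2 * n)) = Real.exp (-(b * n)) * Real.exp (b / 2 * n) := by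
        rw [← Real.exp_add]; congr 1; ring
      rw [h3]; ring
    have h2 : Tendsto (fun n : ℕ => Real.exp (b / 2 * n) * (γ' * √(η * (q / 2)))) atTop atTop := by
      refine Tendsto.atTop_mul_const (by positivity) ?_
      exact Real.tendsto_exp_atTop.comp
        (tendsto_natCast_atTop_atTop.const_mul_atTop (by positivity))
    filter_upwards [h2.eventually_ge_atTop 3] with n hn
    rw [h1, mul_comm]
    exact mul_le_mul_of_nonneg_left hn (Real.exp_pos _).le
  filter_upwards [hupper, hlim, eventually_gt_atTop 0] with n hn1 hn2 hn3
  have hlow := measure_lintegral_relLikelihood_lt_le hW hlaw hBm hQB ham (fun θ _ => har θ)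
    (κ := b) (κ₀ := κ₀) hbpos (fun θ hθ => hθ) hn3
  have hκeq : 2 * κ₀ / b = γ' := by
    rw [hκ₀]
    have : b ≠ 0 := hbpos.ne'
    field_simp
  rw [hκeq] at hlow
  set d : ℝ := η * (Real.exp (-(b * n)) * (q / 2)) with hd
  have hdpos : 0 < d := by positivity
  have hsub : {ω | ENNReal.ofReal η * ∫⁻ θ, relLikelihood r W n ω θ ∂Q ≤
      ∫⁻ θ in U, relLikelihood r W n ω θ ∂Q} ⊆
      {ω | ∫⁻ θ, relLikelihood r W n ω θ ∂Q < ENNReal.ofReal (Real.exp (-(b * n))) * (Q B / 2)} ∪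
      {ω | ENNReal.ofReal (√d) ≤ (∫⁻ θ in U, relLikelihood r W n ω θ ∂Q) ^ (1 / 2 : ℝ)} := by
    intro ω hω
    by_cases h : ∫⁻ θ, relLikelihood r W n ω θ ∂Q <
      ENNReal.ofReal (Real.exp (-(b * n))) * (Q B / 2)
    · exact Or.inl h
    · refine Or.inr ?_
      have h1 : ENNReal.ofReal d ≤ ∫⁻ θ in U, relLikelihood r W n ω θ ∂Q := by
        refine le_trans ?_ hω
        rw [hd, ENNReal.ofReal_mul hη.le, ENNReal.ofReal_mul (Real.exp_pos _).le, ← hQBq]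
        exact mul_le_mul_right (not_lt.1 h) _
      have h2 := ENNReal.rpow_le_rpow (z := 1 / 2) h1 (by norm_num)
      rwa [ENNReal.ofReal_rpow_of_nonneg hdpos.le (by norm_num), ← Real.sqrt_eq_rpow] at h2
  refine (measure_mono hsub).trans ((measure_union_le _ _).trans (le_trans ?_ hγ'))
  refine add_le_add hlow ?_
  have hIm : Measurable fun ω => (∫⁻ θ in U, relLikelihood r W n ω θ ∂Q) ^ (1 / 2 : ℝ) :=
    ((measurable_relLikelihood hr hW n).lintegral_prod_right').pow_const _
  have h1 := (mul_meas_ge_le_lintegral (μ := P) hIm (ENNReal.ofReal (√d))).trans hn1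
  have h2 : ENNReal.ofReal (3 * Real.exp (-(b * n))) ≤ ENNReal.ofReal (√d) * ENNReal.ofReal γ' := by
    rw [← ENNReal.ofReal_mul (by positivity), mul_comm (√d)]
    exact ENNReal.ofReal_le_ofReal hn2
  exact (ENNReal.mul_le_mul_iff_right (by simp [hdpos]) (by simp)).1 (h1.trans h2)

end

/-! ### The logistic synthesis model -/

section

variable {𝒳 : Type*} [MeasurableSpace 𝒳] {J : ℕ}

lemma synthesis_true (d : Fin (J + 1) → ℝ) (f : Fin J → ℝ) :
    synthesis d f true = Real.exp (linearPredictor d f) / (1 + Real.exp (linearPredictor d f)) := by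
  simp [synthesis]

lemma synthesis_false (d : Fin (J + 1) → ℝ) (f : Fin J → ℝ) :
    synthesis d f false = 1 / (1 + Real.exp (linearPredictor d f)) := by
  simp [synthesis]

lemma synthesis_pos (d : Fin (J + 1) → ℝ) (f : Fin J → ℝ) (z : Bool) : 0 < synthesis d f z := by
  unfold synthesis; positivity

lemma synthesis_add (d : Fin (J + 1) → ℝ) (f : Fin J → ℝ) :
    synthesis d f true + synthesis d f false = 1 := by
  rw [synthesis_true, synthesis_false]
  have := Real.exp_pos (linearPredictor d f)
  field_simp
  ring

lemma synthesis_le_one (d : Fin (J + 1) → ℝ) (f : Fin J → ℝ) (z : Bool) : synthesis d f z ≤ 1 := by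
  have h1 := synthesis_add d f
  have h2 := synthesis_pos d f true
  have h3 := synthesis_pos d f false
  cases z <;> linarith

/-- The logarithm of the logistic link is 1-Lipschitz in the linear predictor. -/
lemma exp_neg_mul_synthesis_le (d d' : Fin (J + 1) → ℝ) (f : Fin J → ℝ) (z : Bool) :
    Real.exp (-|linearPredictor d f - linearPredictor d' f|) * synthesis d f z ≤
      synthesis d' f z := by
  set u := linearPredictor d f with hu
  set v := linearPredictor d' f with hv
  have hE : Real.exp (-|u - v|) ≤ 1 := Real.exp_le_one_iff.2 (by simp)
  have huv : Real.exp (-|u - v|) * Real.exp u ≤ Real.exp v := by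
    rw [← Real.exp_add]
    exact Real.exp_le_exp.2 (by linarith [le_abs_self (u - v)])
  have hvu : Real.exp (-|u - v|) * Real.exp v ≤ Real.exp u := by
    rw [← Real.exp_add]
    exact Real.exp_le_exp.2 (by linarith [neg_abs_le (u - v)])
  have h0 := Real.exp_pos (-|u - v|)
  have h1 := Real.exp_pos u
  have h2 := Real.exp_pos v
  cases z
  · rw [synthesis_false, synthesis_false, ← hu, ← hv, mul_one_div,
      div_le_div_iff₀ (by positivity) (by positivity)]
    linarith
  · rw [synthesis_true, synthesis_true, ← hu, ← hv, mul_div_assoc',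
      div_le_div_iff₀ (by positivity) (by positivity)]
    have : Real.exp (-|u - v|) * Real.exp u * Real.exp v ≤ 1 * Real.exp u * Real.exp v := by
      gcongr
    nlinarith

lemma abs_synthesis_sub_le (d d' : Fin (J + 1) → ℝ) (f : Fin J → ℝ) (z : Bool) :
    |synthesis d f z - synthesis d' f z| ≤ |linearPredictor d f - linearPredictor d' f| := by
  have key : ∀ d d' : Fin (J + 1) → ℝ, synthesis d f z - synthesis d' f z ≤
      |linearPredictor d f - linearPredictor d' f| := by
    intro d d'
    have h1 := exp_neg_mul_synthesis_le d d' f z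
    have h2 := synthesis_le_one d f z
    have h3 := synthesis_pos d f z
    have h4 := Real.add_one_le_exp (-|linearPredictor d f - linearPredictor d' f|)
    have h5 := abs_nonneg (linearPredictor d f - linearPredictor d' f)
    nlinarith
  rw [abs_le]
  have := key d' d
  rw [abs_sub_comm] at this
  exact ⟨by linarith, key d d'⟩

lemma continuous_linearPredictor :
    Continuous fun p : (Fin (J + 1) → ℝ) × (Fin J → ℝ) => linearPredictor p.1 p.2 := by
  unfold linearPredictor
  fun_prop

lemma continuous_synthesis (z : Bool) :
    Continuous fun p : (Fin (J + 1) → ℝ) × (Fin J → ℝ) => synthesis p.1 p.2 z := by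
  have := continuous_linearPredictor (J := J)
  unfold synthesis
  refine Continuous.div (by fun_prop) (by fun_prop) fun p => ?_
  positivity

/-- The joint law of independent candidate estimates as a kernel. -/
noncomputable def estimateKernel (h : Fin J → Kernel 𝒳 ℝ) [∀ j, IsMarkovKernel (h j)] :
    Kernel 𝒳 (Fin J → ℝ) where
  toFun x := Measure.pi fun j => h j x
  measurable' := by
    refine Measurable.measure_of_isPiSystem_of_isProbabilityMeasure
      (S := Set.pi Set.univ '' Set.pi Set.univ fun _ : Fin J => {s : Set ℝ | MeasurableSet s})
      generateFrom_pi.symm isPiSystem_pi ?_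
    rintro _ ⟨s, hs, rfl⟩
    simp only [Measure.pi_pi]
    exact Finset.measurable_fun_prod _ fun j _ => (h j).measurable_coe (hs j (Set.mem_univ j))

instance (h : Fin J → Kernel 𝒳 ℝ) [∀ j, IsMarkovKernel (h j)] :
    IsMarkovKernel (estimateKernel h) :=
  ⟨fun x => by change IsProbabilityMeasure (Measure.pi fun j => h j x); infer_instance⟩

/-- The mean absolute size of the regressor that goes with weight `j`: one for the intercept, and
the first absolute moment of the estimate distribution for a candidate model. -/
noncomputable def regressorSize (h : Fin J → Kernel 𝒳 ℝ) (j : Fin (J + 1)) (x : 𝒳) : ℝ≥0∞ :=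
  Fin.cases 1 (fun j => ∫⁻ f, ‖f‖ₑ ∂(h j x)) j

lemma measurable_regressorSize (h : Fin J → Kernel 𝒳 ℝ) (j : Fin (J + 1)) :
    Measurable (regressorSize h j) := by
  refine Fin.cases ?_ (fun j => ?_) j
  · exact measurable_const
  · exact Measurable.lintegral_kernel (κ := h j) (by fun_prop)

variable (h : Fin J → Kernel 𝒳 ℝ) [∀ j, IsMarkovKernel (h j)]

lemma integrable_synthesis (d : Fin (J + 1) → ℝ) (x : 𝒳) (z : Bool) :
    Integrable (fun f => synthesis d f z) (Measure.pi fun j => h j x) := by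
  refine Integrable.of_bound (C := 1) ?_ (Eventually.of_forall fun f => ?_)
  · exact ((continuous_synthesis z).comp
      (by fun_prop : Continuous fun f => (d, f))).aestronglyMeasurable
  · rw [Real.norm_eq_abs, abs_of_pos (synthesis_pos d f z)]
    exact synthesis_le_one d f z

lemma unitProb_pos (d : Fin (J + 1) → ℝ) (x : 𝒳) (z : Bool) : 0 < unitProb h d x z := by
  refine (integral_pos_iff_support_of_nonneg (fun f => (synthesis_pos d f z).le)
    (integrable_synthesis h d x z)).2 ?_
  have : Function.support (fun f : Fin J → ℝ => synthesis d f z) = Set.univ :=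
    Set.eq_univ_of_forall fun f => (synthesis_pos d f z).ne'
  rw [this, measure_univ]
  exact one_pos

lemma unitProb_add (d : Fin (J + 1) → ℝ) (x : 𝒳) :
    unitProb h d x true + unitProb h d x false = 1 := by
  unfold unitProb
  rw [← integral_add (integrable_synthesis h d x true) (integrable_synthesis h d x false)]
  simp [synthesis_add]

lemma unitProb_le_one (d : Fin (J + 1) → ℝ) (x : 𝒳) (z : Bool) : unitProb h d x z ≤ 1 := by
  have h1 := unitProb_add h d x
  have h2 := unitProb_pos h d x true
  have h3 := unitProb_pos h d x false
  cases z <;> linarith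

lemma measurable_unitProb (z : Bool) :
    Measurable fun p : (Fin (J + 1) → ℝ) × 𝒳 => unitProb h p.1 p.2 z := by
  have h1 : StronglyMeasurable
      (Function.uncurry fun (p : (Fin (J + 1) → ℝ) × 𝒳) (f : Fin J → ℝ) => synthesis p.1 f z) := by
    have : Measurable fun q : ((Fin (J + 1) → ℝ) × 𝒳) × (Fin J → ℝ) => synthesis q.1.1 q.2 z :=
      (continuous_synthesis z).measurable.comp
        ((measurable_fst.comp measurable_fst).prodMk measurable_snd)
    exact this.stronglyMeasurable
  exact (h1.integral_kernel_prod_right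
    (κ := (estimateKernel h).comap Prod.snd measurable_snd)).measurable

/-- The mean distance of two linear predictors. -/
lemma lintegral_enorm_linearPredictor_sub_le (d d' : Fin (J + 1) → ℝ) (x : 𝒳) :
    ∫⁻ f, ‖linearPredictor d f - linearPredictor d' f‖ₑ ∂(Measure.pi fun j => h j x) ≤
      ∑ j, ‖d j - d' j‖ₑ * regressorSize h j x := by
  calc ∫⁻ f, ‖linearPredictor d f - linearPredictor d' f‖ₑ ∂(Measure.pi fun j => h j x)
      ≤ ∫⁻ f, (‖d 0 - d' 0‖ₑ + ∑ j : Fin J, ‖d j.succ - d' j.succ‖ₑ * ‖f j‖ₑ)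
          ∂(Measure.pi fun j => h j x) := by
        refine lintegral_mono fun f => ?_
        have h1 : linearPredictor d f - linearPredictor d' f =
            (d 0 - d' 0) + ∑ j : Fin J, (d j.succ - d' j.succ) * f j := by
          unfold linearPredictor
          simp only [sub_mul, Finset.sum_sub_distrib]
          ring
        rw [h1]
        refine (enorm_add_le _ _).trans (add_le_add le_rfl ?_)
        refine (enorm_sum_le _ _).trans (le_of_eq ?_)
        exact Finset.sum_congr rfl fun j _ => enorm_mul _ _
    _ = ‖d 0 - d' 0‖ₑ + ∑ j : Fin J, ‖d j.succ - d' j.succ‖ₑ * ∫⁻ f, ‖f‖ₑ ∂(h j x) := by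
        rw [lintegral_add_left measurable_const, lintegral_finsetSum _ fun j _ => by fun_prop]
        simp only [lintegral_const, measure_univ, mul_one]
        congr 1
        refine Finset.sum_congr rfl fun j _ => ?_
        rw [lintegral_const_mul _ (by fun_prop)]
        congr 1
        exact (measurePreserving_eval (fun j => h j x) j).lintegral_comp (f := fun y : ℝ => ‖y‖ₑ)
          (by fun_prop)
    _ = ∑ j, ‖d j - d' j‖ₑ * regressorSize h j x := by
        rw [Fin.sum_univ_succ]
        simp [regressorSize]

lemma enorm_unitProb_sub_le (d d' : Fin (J + 1) → ℝ) (x : 𝒳) (z : Bool) :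
    ‖unitProb h d x z - unitProb h d' x z‖ₑ ≤ ∑ j, ‖d j - d' j‖ₑ * regressorSize h j x := by
  refine le_trans ?_ (lintegral_enorm_linearPredictor_sub_le h d d' x)
  unfold unitProb
  rw [← integral_sub (integrable_synthesis h d x z) (integrable_synthesis h d' x z)]
  refine (enorm_integral_le_lintegral_enorm _).trans (lintegral_mono fun f => ?_)
  rw [Real.enorm_eq_ofReal_abs, Real.enorm_eq_ofReal_abs]
  exact ENNReal.ofReal_le_ofReal (abs_synthesis_sub_le d d' f z)

/-- An upper bound for the log-likelihood ratio of one unit: the distance of the linear predictors,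
averaged over the conditional law of the estimates given the observed treatment. -/
noncomputable def logRatioBound (d d' : Fin (J + 1) → ℝ) (x : 𝒳) (z : Bool) : ℝ≥0∞ :=
  (∫⁻ f, ENNReal.ofReal (synthesis d f z) * ‖linearPredictor d f - linearPredictor d' f‖ₑ
    ∂(Measure.pi fun j => h j x)) / ENNReal.ofReal (unitProb h d x z)

lemma measurable_logRatioBound (z : Bool) :
    Measurable fun p : ((Fin (J + 1) → ℝ) × (Fin (J + 1) → ℝ)) × 𝒳 =>
      logRatioBound h p.1.1 p.1.2 p.2 z := by
  unfold logRatioBound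
  refine Measurable.div ?_ ?_
  · have h1 : Measurable (Function.uncurry
        fun (p : ((Fin (J + 1) → ℝ) × (Fin (J + 1) → ℝ)) × 𝒳) (f : Fin J → ℝ) =>
          ENNReal.ofReal (synthesis p.1.1 f z) *
            ‖linearPredictor p.1.1 f - linearPredictor p.1.2 f‖ₑ) := by
      have hs := (continuous_synthesis (J := J) z).measurable
      have hl := (continuous_linearPredictor (J := J)).measurable
      have e1 : Measurable
          fun q : (((Fin (J + 1) → ℝ) × (Fin (J + 1) → ℝ)) × 𝒳) × (Fin J → ℝ) => (q.1.1.1, q.2) :=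
        by fun_prop
      have e2 : Measurable
          fun q : (((Fin (J + 1) → ℝ) × (Fin (J + 1) → ℝ)) × 𝒳) × (Fin J → ℝ) => (q.1.1.2, q.2) :=
        by fun_prop
      exact (hs.comp e1).ennreal_ofReal.mul ((hl.comp e1).sub (hl.comp e2)).enorm
    exact h1.lintegral_kernel_prod_right (κ := (estimateKernel h).comap Prod.snd measurable_snd)
  · have e : Measurable fun p : ((Fin (J + 1) → ℝ) × (Fin (J + 1) → ℝ)) × 𝒳 => (p.1.1, p.2) := by
      fun_prop
    exact ((measurable_unitProb h z).comp e).ennreal_ofReal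

/-- The bound on the log-likelihood ratio follows from Jensen's inequality for the exponential,
applied to the conditional law of the estimates given the treatment; the tangent line at the mean
is used directly. -/
lemma exp_neg_logRatioBound_mul_le (d d' : Fin (J + 1) → ℝ) (x : 𝒳) (z : Bool)
    (hfin : logRatioBound h d d' x z ≠ ⊤) :
    Real.exp (-(logRatioBound h d d' x z).toReal) * unitProb h d x z ≤ unitProb h d' x z := by
  set π := Measure.pi fun j => h j x with hπ
  set Δ : (Fin J → ℝ) → ℝ := fun f => |linearPredictor d f - linearPredictor d' f| with hΔ
  have hq := unitProb_pos h d x z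
  set a : ℝ := (logRatioBound h d d' x z).toReal with ha
  have hΔm : Measurable Δ := by
    have hl := (continuous_linearPredictor (J := J)).measurable
    exact ((hl.comp (measurable_const.prodMk measurable_id)).sub
      (hl.comp (measurable_const.prodMk measurable_id))).abs
  have hsm : Measurable fun f : Fin J → ℝ => synthesis d f z :=
    (continuous_synthesis z).measurable.comp (measurable_const.prodMk measurable_id)
  have hnum : ∫⁻ f, ENNReal.ofReal (synthesis d f z) *
      ‖linearPredictor d f - linearPredictor d' f‖ₑ ∂π =
        ∫⁻ f, ENNReal.ofReal (synthesis d f z * Δ f) ∂π := by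
    refine lintegral_congr fun f => ?_
    rw [ENNReal.ofReal_mul (synthesis_pos d f z).le, Real.enorm_eq_ofReal_abs]
  have hnumfin : ∫⁻ f, ENNReal.ofReal (synthesis d f z * Δ f) ∂π ≠ ⊤ := by
    intro htop
    apply hfin
    unfold logRatioBound
    rw [hnum, htop]
    exact ENNReal.top_div_of_ne_top (by simp)
  have hnn : ∀ f, 0 ≤ synthesis d f z * Δ f := fun f =>
    mul_nonneg (synthesis_pos d f z).le (abs_nonneg _)
  have hint : Integrable (fun f => synthesis d f z * Δ f) π := by
    refine ⟨(hsm.mul hΔm).aestronglyMeasurable, ?_⟩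
    rw [hasFiniteIntegral_iff_ofReal (Eventually.of_forall hnn)]
    exact lt_top_iff_ne_top.2 hnumfin
  have haeq : ∫ f, synthesis d f z * Δ f ∂π = a * unitProb h d x z := by
    rw [integral_eq_lintegral_of_nonneg_ae (Eventually.of_forall hnn)
      (hsm.mul hΔm).aestronglyMeasurable, ha]
    unfold logRatioBound
    rw [hnum, ENNReal.toReal_div, ENNReal.toReal_ofReal hq.le]
    field_simp
  have hsint := integrable_synthesis h d x z
  -- the tangent line of `exp` at `-a`
  have hlow : ∀ f, Real.exp (-a) * ((1 + a) * synthesis d f z - synthesis d f z * Δ f) ≤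
      synthesis d' f z := by
    intro f
    refine le_trans ?_ (exp_neg_mul_synthesis_le d d' f z)
    have h1 : Real.exp (-Δ f) = Real.exp (-a) * Real.exp (a - Δ f) := by
      rw [← Real.exp_add]; congr 1; ring
    have h2 := Real.add_one_le_exp (a - Δ f)
    have h3 := synthesis_pos d f z
    change _ ≤ Real.exp (-Δ f) * _
    rw [h1, mul_assoc]
    refine mul_le_mul_of_nonneg_left ?_ (Real.exp_pos _).le
    nlinarith
  calc Real.exp (-a) * unitProb h d x z
      = ∫ f, Real.exp (-a) * ((1 + a) * synthesis d f z - synthesis d f z * Δ f) ∂π := by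
        rw [integral_const_mul, integral_sub (hsint.const_mul _) hint, integral_const_mul, haeq]
        change _ = Real.exp (-a) * ((1 + a) * unitProb h d x z - a * unitProb h d x z)
        ring
    _ ≤ unitProb h d' x z :=
        integral_mono (((hsint.const_mul _).sub hint).const_mul _)
          (integrable_synthesis h d' x z) hlow

/-- The mean of the bound on the log-likelihood ratio under the treatment law. -/
lemma sum_unitProb_mul_logRatioBound_le (d d' : Fin (J + 1) → ℝ) (x : 𝒳) :
    ∑ z : Bool, ENNReal.ofReal (unitProb h d x z) * logRatioBound h d d' x z ≤
      ∑ j, ‖d j - d' j‖ₑ * regressorSize h j x := by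
  refine le_trans (le_of_eq ?_) (lintegral_enorm_linearPredictor_sub_le h d d' x)
  have h1 : ∀ z, ENNReal.ofReal (unitProb h d x z) * logRatioBound h d d' x z =
      ∫⁻ f, ENNReal.ofReal (synthesis d f z) * ‖linearPredictor d f - linearPredictor d' f‖ₑ
        ∂(Measure.pi fun j => h j x) := fun z => by
    unfold logRatioBound
    exact ENNReal.mul_div_cancel (by simpa using unitProb_pos h d x z) (by simp)
  simp only [h1, Fintype.sum_bool]
  have hsm : Measurable fun f : Fin J → ℝ => ENNReal.ofReal (synthesis d f true) *
      ‖linearPredictor d f - linearPredictor d' f‖ₑ := by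
    have hl := (continuous_linearPredictor (J := J)).measurable
    exact ((continuous_synthesis true).measurable.comp
      (measurable_const.prodMk measurable_id)).ennreal_ofReal.mul
      ((hl.comp (measurable_const.prodMk measurable_id)).sub
        (hl.comp (measurable_const.prodMk measurable_id))).enorm
  rw [← lintegral_add_left hsm]
  refine lintegral_congr fun f => ?_
  rw [← add_mul, ← ENNReal.ofReal_add (synthesis_pos d f _).le (synthesis_pos d f _).le,
    synthesis_add]
  simp

end

/-! ### The Gaussian process prior of the weight functions -/

section

variable {𝒳 Θ : Type*} [MeasurableSpace Θ] {Q : Measure Θ}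

/-- Independent Gaussian processes form one Gaussian process on the disjoint union of their index
sets. -/
lemma isGaussianProcess_of_iIndepFun {ι : Type*} [Fintype ι] {δ : ι → 𝒳 → Θ → ℝ}
    (hG : ∀ j, IsGaussianProcess (δ j) Q) (hind : iIndepFun (fun j θ x => δ j x θ) Q) :
    IsGaussianProcess (fun t : ι × 𝒳 => δ t.1 t.2) Q where
  hasGaussianLaw I := by
    classical
    set I' : Finset 𝒳 := I.image Prod.snd with hI'
    have h1 : HasGaussianLaw (fun θ j => I'.restrict (fun x => δ j x θ)) Q := by
      refine iIndepFun.hasGaussianLaw (X := fun j θ => I'.restrict (fun x => δ j x θ))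
        (fun j => (hG j).hasGaussianLaw I') ?_
      exact hind.comp (fun _ u => I'.restrict u) fun _ => by fun_prop
    let L : (ι → I' → ℝ) →L[ℝ] (I → ℝ) := ContinuousLinearMap.pi fun t =>
      (ContinuousLinearMap.proj (R := ℝ) (⟨t.1.2, Finset.mem_image_of_mem _ t.2⟩ : I')).comp
        (ContinuousLinearMap.proj (R := ℝ) (φ := fun _ : ι => I' → ℝ) t.1.1)
    exact h1.map_fun L

lemma isGaussianProcess_sub_const {Y : 𝒳 → Θ → ℝ} (hG : IsGaussianProcess Y Q) (m : 𝒳 → ℝ) :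
    IsGaussianProcess (fun t θ => Y t θ - m t) Q where
  hasGaussianLaw I := by
    have h1 := hG.hasGaussianLaw I
    have := h1.isGaussian_map
    refine ⟨?_⟩
    have h2 : Q.map (fun θ => I.restrict (fun t => Y t θ - m t)) =
        (Q.map (fun θ => I.restrict (fun t => Y t θ))).map
          (fun v => v + I.restrict (fun t => -m t)) := by
      rw [AEMeasurable.map_map_of_aemeasurable (by fun_prop) h1.aemeasurable]
      rfl
    rw [h2]
    infer_instance

end

section

variable {𝒳 Θ : Type*} [MeasurableSpace 𝒳] [MeasurableSpace Θ] {J : ℕ}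

lemma lintegral_count_prod {ι : Type*} [Fintype ι] [MeasurableSpace ι] [MeasurableSingletonClass ι]
    (ν : Measure 𝒳) [SFinite ν] {F : ι × 𝒳 → ℝ≥0∞} (hF : Measurable F) :
    ∫⁻ t, F t ∂((Measure.count : Measure ι).prod ν) = ∑ j, ∫⁻ x, F (j, x) ∂ν := by
  rw [lintegral_prod _ hF.aemeasurable, lintegral_count, tsum_fintype]

/-- Prior cells of small mean distance of the weight functions, on a set where the variances of the
weights are bounded. -/
lemma exists_prior_covering {ν : Measure 𝒳} [IsProbabilityMeasure ν] {Q : Measure Θ}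
    [IsProbabilityMeasure Q] {δ : Fin (J + 1) → 𝒳 → Θ → ℝ} {m : Fin (J + 1) → 𝒳 → ℝ}
    {C : Fin (J + 1) → 𝒳 → 𝒳 → ℝ} (hprior : IsGPPrior ν Q δ m C) {E : Set 𝒳}
    (hE : MeasurableSet E) {N : ℝ} (hN : ∀ x ∈ E, ∀ j, C j x x ≤ N) {ε a : ℝ} (hε : 0 < ε)
    (ha : 0 < a) :
    ∃ c : ℝ, 0 < c ∧ ∀ᶠ n : ℕ in atTop, ∃ (κ : Type) (_ : Countable κ) (A : κ → Set Θ),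
      (∀ i, MeasurableSet (A i)) ∧
      (∀ i, ∀ θ ∈ A i, ∀ θ' ∈ A i,
        ∑ j, ∫⁻ x in E, ‖δ j x θ - δ j x θ'‖ₑ ∂ν ≤ ENNReal.ofReal ε) ∧
      ∑' i, (Q (A i)) ^ (1 / 2 : ℝ) ≤ ENNReal.ofReal (Real.exp (a * n)) ∧
      Q (⋃ i, A i)ᶜ ≤ 2 * ENNReal.ofReal (Real.exp (-(c * n))) := by
  have : Nonempty 𝒳 := nonempty_of_isProbabilityMeasure ν
  set ρ : Measure (Fin (J + 1) × 𝒳) := (Measure.count : Measure (Fin (J + 1))).prod (ν.restrict E)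
    with hρ
  have hρ1 : ρ Set.univ ≤ ENNReal.ofReal (J + 1) := by
    rw [hρ, ← Set.univ_prod_univ, Measure.prod_prod, Measure.restrict_apply_univ]
    calc Measure.count (Set.univ : Set (Fin (J + 1))) * ν E
        ≤ Measure.count (Set.univ : Set (Fin (J + 1))) * 1 := by
          gcongr; exact prob_le_one
      _ = ENNReal.ofReal (J + 1) := by
          rw [Measure.count_univ]
          rw [ENNReal.ofReal_add (by positivity) (by norm_num)]
          simp
  set Y : Fin (J + 1) × 𝒳 → Θ → ℝ := fun t θ => δ t.1 t.2 θ - m t.1 t.2 with hY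
  have hδt : ∀ j x, Measurable (δ j x) := fun j x =>
    (hprior.measurable j).comp measurable_prodMk_left
  have hδL : ∀ j x, MemLp (δ j x) 2 Q := fun j x =>
    ((hprior.gaussian j).hasGaussianLaw_eval x).memLp_two
  have hδm : Measurable fun z : (Fin (J + 1) × 𝒳) × Θ => δ z.1.1 z.1.2 z.2 := by
    have : Measurable fun z : Fin (J + 1) × (𝒳 × Θ) => δ z.1 z.2.1 z.2.2 :=
      measurable_from_prod_countable_right hprior.measurable
    exact this.comp ((measurable_fst.comp measurable_fst).prodMk
      ((measurable_snd.comp measurable_fst).prodMk measurable_snd))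
  have hmm : Measurable fun t : Fin (J + 1) × 𝒳 => m t.1 t.2 := by
    have h1 : StronglyMeasurable fun t : Fin (J + 1) × 𝒳 => ∫ θ, δ t.1 t.2 θ ∂Q :=
      hδm.stronglyMeasurable.integral_prod_right'
    have h2 : (fun t : Fin (J + 1) × 𝒳 => ∫ θ, δ t.1 t.2 θ ∂Q) = fun t => m t.1 t.2 := by
      ext t; exact hprior.mean _ _
    rw [← h2]
    exact h1.measurable
  have hYm : Measurable (Function.uncurry Y) := hδm.sub (hmm.comp measurable_fst)
  have hG : IsGaussianProcess Y Q :=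
    isGaussianProcess_sub_const (isGaussianProcess_of_iIndepFun hprior.gaussian hprior.indep)
      fun t => m t.1 t.2
  have h0 : ∀ t, ∫ θ, Y t θ ∂Q = 0 := fun t => by
    rw [hY, integral_sub ((hδL _ _).integrable (by norm_num)) (integrable_const _), hprior.mean]
    simp
  have hvar : ∀ t, ∫⁻ θ, ‖Y t θ‖ₑ ^ 2 ∂Q = ENNReal.ofReal (C t.1 t.2 t.2) := by
    intro t
    rw [← hprior.cov, covariance_self (hδt _ _).aemeasurable, ofReal_variance (hδL _ _), evariance,
      hprior.mean]
  have hL2 : MemLp (Function.uncurry Y) 2 (ρ.prod Q) := by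
    refine ⟨hYm.aestronglyMeasurable, ?_⟩
    rw [eLpNorm_lt_top_iff_lintegral_rpow_enorm_lt_top (by simp) (by simp)]
    simp only [ENNReal.toReal_ofNat, ENNReal.rpow_ofNat]
    have hm2 : Measurable fun z => ‖Function.uncurry Y z‖ₑ ^ 2 := hYm.enorm.pow_const 2
    rw [lintegral_prod _ hm2.aemeasurable, hρ, lintegral_count_prod _ hm2.lintegral_prod_right']
    refine ENNReal.sum_lt_top.2 fun j _ => ?_
    calc ∫⁻ x in E, ∫⁻ θ, ‖Y (j, x) θ‖ₑ ^ 2 ∂Q ∂ν ≤ ∫⁻ x in E, ENNReal.ofReal N ∂ν := by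
          refine setLIntegral_mono' hE fun x hx => ?_
          rw [hvar]
          exact ENNReal.ofReal_le_ofReal (hN x hx j)
      _ < ⊤ := by
          rw [setLIntegral_const]
          exact ENNReal.mul_lt_top (by simp) (measure_lt_top _ _)
  set ε' : ℝ := ε / √(J + 1) with hε'
  have hε'pos : 0 < ε' := by positivity
  obtain ⟨c, hc, hcov⟩ := exists_gaussianProcess_covering ρ hYm hL2 hG h0 hε'pos ha
  refine ⟨c, hc, hcov.mono fun n hn => ?_⟩
  obtain ⟨κ, hκ, A, hAm, hAd, hAs, hAc⟩ := hn
  refine ⟨κ, hκ, A, hAm, fun i θ hθ θ' hθ' => ?_, hAs, hAc⟩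
  have hYd : Measurable fun t => ‖Y t θ - Y t θ'‖ₑ :=
    ((hYm.comp measurable_prodMk_right).sub (hYm.comp measurable_prodMk_right)).enorm
  have h1 : ∑ j, ∫⁻ x in E, ‖δ j x θ - δ j x θ'‖ₑ ∂ν = ∫⁻ t, ‖Y t θ - Y t θ'‖ₑ ∂ρ := by
    rw [hρ, lintegral_count_prod _ hYd]
    simp [hY]
  rw [h1]
  have hCS := ENNReal.lintegral_mul_le_Lp_mul_Lq ρ (p := 2) (q := 2) (by constructor <;> norm_num)
    (f := fun t => ‖Y t θ - Y t θ'‖ₑ) (g := fun _ => 1) hYd.aemeasurable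
    measurable_const.aemeasurable
  simp only [Pi.mul_apply, mul_one, lintegral_const, ENNReal.rpow_ofNat, one_pow,
    one_mul] at hCS
  refine hCS.trans ?_
  calc (∫⁻ t, ‖Y t θ - Y t θ'‖ₑ ^ 2 ∂ρ) ^ (1 / 2 : ℝ) * ρ Set.univ ^ (1 / 2 : ℝ)
      ≤ ENNReal.ofReal (ε' ^ 2) ^ (1 / 2 : ℝ) * ENNReal.ofReal (J + 1) ^ (1 / 2 : ℝ) := by
        gcongr
        exact hAd i θ hθ θ' hθ'
    _ = ENNReal.ofReal ε := by
        rw [ENNReal.ofReal_rpow_of_nonneg (by positivity) (by norm_num),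
          ENNReal.ofReal_rpow_of_nonneg (by positivity) (by norm_num), ← Real.sqrt_eq_rpow,
          ← Real.sqrt_eq_rpow, Real.sqrt_sq hε'pos.le, ← ENNReal.ofReal_mul hε'pos.le]
        congr 1
        rw [hε']
        have : √((J : ℝ) + 1) ≠ 0 := by positivity
        field_simp

/-- Outside of a set of covariates of small probability, the prior variances of the weights and the
first moments of the estimates are bounded. -/
lemma exists_truncation {ν : Measure 𝒳} [IsProbabilityMeasure ν] {Q : Measure Θ}
    [IsProbabilityMeasure Q] {δ : Fin (J + 1) → 𝒳 → Θ → ℝ} {m : Fin (J + 1) → 𝒳 → ℝ}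
    {C : Fin (J + 1) → 𝒳 → 𝒳 → ℝ} (hprior : IsGPPrior ν Q δ m C) (h : Fin J → Kernel 𝒳 ℝ)
    (hfin : ∀ j, ∀ᵐ x ∂ν, regressorSize h j x ≠ ⊤) {γ : ℝ≥0∞} (hγ : 0 < γ) :
    ∃ (E : Set 𝒳) (N : ℝ), MeasurableSet E ∧ 0 < N ∧ (∀ x ∈ E, ∀ j, C j x x ≤ N) ∧
      (∀ x ∈ E, ∀ j, regressorSize h j x ≤ ENNReal.ofReal N) ∧ ν Eᶜ ≤ γ := by
  have hCm : ∀ j, Measurable fun x => C j x x := by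
    intro j
    have hmm : Measurable (m j) := by
      have h1 : StronglyMeasurable fun x => ∫ θ, δ j x θ ∂Q :=
        (hprior.measurable j).stronglyMeasurable.integral_prod_right
      have h2 : (fun x => ∫ θ, δ j x θ ∂Q) = m j := funext (hprior.mean j)
      rw [← h2]
      exact h1.measurable
    have h1 : Measurable (Function.uncurry fun x θ => (δ j x θ - m j x) * (δ j x θ - m j x)) := by
      have h3 := (hprior.measurable j).sub (hmm.comp measurable_fst)
      exact h3.mul h3
    have h2 : (fun x => C j x x) = fun x => ∫ θ, (δ j x θ - m j x) * (δ j x θ - m j x) ∂Q := by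
      ext x
      rw [← hprior.cov, covariance, hprior.mean]
    rw [h2]
    exact h1.stronglyMeasurable.integral_prod_right.measurable
  set F : 𝒳 → ℝ≥0∞ := fun x => ∑ j, (ENNReal.ofReal (C j x x) + regressorSize h j x) with hF
  have hFm : Measurable F := Finset.measurable_fun_sum _ fun j _ =>
    (hCm j).ennreal_ofReal.add (measurable_regressorSize h j)
  have hFfin : ∀ᵐ x ∂ν, F x ≠ ⊤ := by
    filter_upwards [ae_all_iff.2 hfin] with x hx
    exact ENNReal.sum_ne_top.2 fun j _ => ENNReal.add_ne_top.2 ⟨by simp, hx j⟩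
  have hlim : Tendsto (fun n : ℕ => ν {x | (n : ℝ≥0∞) < F x}) atTop
      (𝓝 (ν (⋂ n : ℕ, {x | (n : ℝ≥0∞) < F x}))) := by
    refine tendsto_measure_iInter_atTop
      (fun n => (measurableSet_lt measurable_const hFm).nullMeasurableSet)
      (fun n k hnk x hx => ?_) ⟨0, measure_ne_top _ _⟩
    have hx' : (k : ℝ≥0∞) < F x := hx
    exact lt_of_le_of_lt (by exact_mod_cast hnk : (n : ℝ≥0∞) ≤ k) hx'
  have hzero : ν (⋂ n : ℕ, {x | (n : ℝ≥0∞) < F x}) = 0 := by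
    refine measure_mono_null (fun x hx => ?_) (ae_iff.1 hFfin)
    simp only [Set.mem_iInter] at hx
    intro hcon
    obtain ⟨n, hn⟩ := ENNReal.exists_nat_gt hcon
    exact absurd hn (not_lt.2 (le_of_lt (hx n)))
  rw [hzero] at hlim
  obtain ⟨n, hn, hn0⟩ :=
    ((ENNReal.tendsto_nhds_zero.1 hlim γ hγ).and (eventually_gt_atTop 0)).exists
  have hle : ∀ x, F x ≤ n → ∀ j,
      ENNReal.ofReal (C j x x) + regressorSize h j x ≤ ENNReal.ofReal n := by
    intro x hx j
    rw [ENNReal.ofReal_natCast]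
    exact (Finset.single_le_sum (f := fun j => ENNReal.ofReal (C j x x) + regressorSize h j x)
      (fun _ _ => zero_le) (Finset.mem_univ j)).trans hx
  refine ⟨{x | F x ≤ n}, n, measurableSet_le hFm measurable_const, by exact_mod_cast hn0,
    fun x hx j => ?_, fun x hx j => le_add_self.trans (hle x hx j), ?_⟩
  · exact (ENNReal.ofReal_le_ofReal_iff (Nat.cast_nonneg n)).1 (le_self_add.trans (hle x hx j))
  · refine le_trans (measure_mono fun x hx => ?_) hn
    have hx' : ¬ F x ≤ n := hx
    exact not_le.1 hx'

end

/-! ### The propensity estimate as a posterior mean -/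

section

variable {𝒳 Θ : Type*} [MeasurableSpace 𝒳] [MeasurableSpace Θ] {J : ℕ}

lemma measurable_unitProb_process (h : Fin J → Kernel 𝒳 ℝ) [∀ j, IsMarkovKernel (h j)]
    {δ : Fin (J + 1) → 𝒳 → Θ → ℝ} (hδ : ∀ j, Measurable (Function.uncurry (δ j))) :
    Measurable fun p : Θ × (𝒳 × Bool) => unitProb h (fun j => δ j p.2.1 p.1) p.2.1 p.2.2 := by
  have h1 : Measurable fun p : (Θ × 𝒳) × Bool =>
      unitProb h (fun j => δ j p.1.2 p.1.1) p.1.2 p.2 := by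
    refine measurable_from_prod_countable_left fun z => ?_
    refine (measurable_unitProb h z).comp
      ((measurable_pi_lambda _ fun j => ?_).prodMk measurable_snd)
    exact (hδ j).comp measurable_swap
  exact h1.comp ((measurable_fst.prodMk (measurable_fst.comp measurable_snd)).prodMk
    (measurable_snd.comp measurable_snd))

lemma measurable_unitProb_comp (h : Fin J → Kernel 𝒳 ℝ) [∀ j, IsMarkovKernel (h j)]
    {d : Fin (J + 1) → 𝒳 → ℝ} (hd : ∀ j, Measurable (d j)) (z : Bool) :
    Measurable fun x => unitProb h (fun j => d j x) x z :=
  (measurable_unitProb h z).comp ((measurable_pi_lambda _ hd).prodMk measurable_id)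

lemma likelihood_pos (h : Fin J → Kernel 𝒳 ℝ) [∀ j, IsMarkovKernel (h j)]
    (δ : Fin (J + 1) → 𝒳 → ℝ) {n : ℕ} (xs : Fin n → 𝒳) (zs : Fin n → Bool) :
    0 < likelihood h δ xs zs :=
  Finset.prod_pos fun _ _ => unitProb_pos h _ _ _

lemma likelihood_le_one (h : Fin J → Kernel 𝒳 ℝ) [∀ j, IsMarkovKernel (h j)]
    (δ : Fin (J + 1) → 𝒳 → ℝ) {n : ℕ} (xs : Fin n → 𝒳) (zs : Fin n → Bool) :
    likelihood h δ xs zs ≤ 1 :=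
  Finset.prod_le_one (fun _ _ => (unitProb_pos h _ _ _).le) fun _ _ => unitProb_le_one h _ _ _

lemma measurable_likelihood_process (h : Fin J → Kernel 𝒳 ℝ) [∀ j, IsMarkovKernel (h j)]
    {δ : Fin (J + 1) → 𝒳 → Θ → ℝ} (hδ : ∀ j, Measurable (Function.uncurry (δ j))) (n : ℕ) :
    Measurable fun p : ((Fin n → 𝒳) × (Fin n → Bool)) × Θ =>
      likelihood h (fun j y => δ j y p.2) p.1.1 p.1.2 := by
  refine Finset.measurable_fun_prod _ fun i _ => ?_
  have e : Measurable fun p : ((Fin n → 𝒳) × (Fin n → Bool)) × Θ =>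
      ((p.2, (p.1.1 i, p.1.2 i)) : Θ × (𝒳 × Bool)) := by fun_prop
  exact (measurable_unitProb_process h hδ).comp e

lemma measurable_likelihood (h : Fin J → Kernel 𝒳 ℝ) [∀ j, IsMarkovKernel (h j)]
    {δ : Fin (J + 1) → 𝒳 → Θ → ℝ} (hδ : ∀ j, Measurable (Function.uncurry (δ j))) {n : ℕ}
    (xs : Fin n → 𝒳) (zs : Fin n → Bool) :
    Measurable fun θ => likelihood h (fun j y => δ j y θ) xs zs := by
  have e : Measurable fun θ : Θ => (((xs, zs), θ) : ((Fin n → 𝒳) × (Fin n → Bool)) × Θ) := by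
    fun_prop
  exact (measurable_likelihood_process h hδ n).comp e

lemma integrable_likelihood_mul (h : Fin J → Kernel 𝒳 ℝ) [∀ j, IsMarkovKernel (h j)] (Q : Measure Θ)
    [IsProbabilityMeasure Q] {δ : Fin (J + 1) → 𝒳 → Θ → ℝ}
    (hδ : ∀ j, Measurable (Function.uncurry (δ j))) {n : ℕ} (xs : Fin n → 𝒳) (zs : Fin n → Bool)
    {u : Θ → ℝ} (hu : Measurable u) (hu1 : ∀ θ, |u θ| ≤ 1) :
    Integrable (fun θ => likelihood h (fun j y => δ j y θ) xs zs * u θ) Q := by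
  refine Integrable.of_bound (C := 1)
    ((measurable_likelihood h hδ xs zs).mul hu).aestronglyMeasurable
    (Eventually.of_forall fun θ => ?_)
  rw [Real.norm_eq_abs, abs_mul, abs_of_pos (likelihood_pos h _ xs zs)]
  exact mul_le_one₀ (likelihood_le_one h _ xs zs) (abs_nonneg _) (hu1 θ)

/-- The propensity estimate as a posterior mean: the two predictive weights add up to the marginal
likelihood of the data. -/
lemma propensityEstimate_eq (h : Fin J → Kernel 𝒳 ℝ) [∀ j, IsMarkovKernel (h j)] (Q : Measure Θ)
    [IsProbabilityMeasure Q] {δ : Fin (J + 1) → 𝒳 → Θ → ℝ}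
    (hδ : ∀ j, Measurable (Function.uncurry (δ j))) {n : ℕ} (xs : Fin n → 𝒳) (zs : Fin n → Bool)
    (x : 𝒳) :
    propensityEstimate h Q δ xs zs x =
      (∫ θ, likelihood h (fun j y => δ j y θ) xs zs * unitProb h (fun j => δ j x θ) x true ∂Q) /
        ∫ θ, likelihood h (fun j y => δ j y θ) xs zs ∂Q := by
  have h1 : ∀ z : Bool, marginal h Q δ (Fin.snoc (α := fun _ => 𝒳) xs x)
      (Fin.snoc (α := fun _ => Bool) zs z) =
      ∫ θ, likelihood h (fun j y => δ j y θ) xs zs * unitProb h (fun j => δ j x θ) x z ∂Q := by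
    intro z
    refine integral_congr_ae (Eventually.of_forall fun θ => ?_)
    simp only [likelihood, Fin.prod_univ_castSucc, Fin.snoc_castSucc, Fin.snoc_last]
  have hi : ∀ z : Bool, Integrable (fun θ => likelihood h (fun j y => δ j y θ) xs zs *
      unitProb h (fun j => δ j x θ) x z) Q := by
    intro z
    have e : Measurable fun θ : Θ => ((θ, (x, z)) : Θ × (𝒳 × Bool)) := by fun_prop
    refine integrable_likelihood_mul h Q hδ xs zs ((measurable_unitProb_process h hδ).comp e)
      fun θ => ?_
    rw [abs_of_pos (unitProb_pos h _ _ _)]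
    exact unitProb_le_one h _ _ _
  simp only [propensityEstimate, predictive, Fintype.sum_bool, h1, Bool.toNat_true,
    Bool.toNat_false, Nat.cast_one, Nat.cast_zero, one_mul, zero_mul, add_zero]
  rw [← integral_add (hi true) (hi false)]
  simp only [← mul_add, unitProb_add, mul_one]

lemma measurable_propensityEstimate (h : Fin J → Kernel 𝒳 ℝ) [∀ j, IsMarkovKernel (h j)]
    (Q : Measure Θ) [IsProbabilityMeasure Q] {δ : Fin (J + 1) → 𝒳 → Θ → ℝ}
    (hδ : ∀ j, Measurable (Function.uncurry (δ j))) (n : ℕ) :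
    Measurable fun p : ((Fin n → 𝒳) × (Fin n → Bool)) × 𝒳 =>
      propensityEstimate h Q δ p.1.1 p.1.2 p.2 := by
  simp only [propensityEstimate_eq h Q hδ]
  have hL := measurable_likelihood_process h hδ n
  refine Measurable.div ?_ ?_
  · have h1 : Measurable (Function.uncurry fun (p : ((Fin n → 𝒳) × (Fin n → Bool)) × 𝒳) (θ : Θ) =>
        likelihood h (fun j y => δ j y θ) p.1.1 p.1.2 *
          unitProb h (fun j => δ j p.2 θ) p.2 true) := by
      have e1 : Measurable fun w : (((Fin n → 𝒳) × (Fin n → Bool)) × 𝒳) × Θ =>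
          ((w.1.1, w.2) : ((Fin n → 𝒳) × (Fin n → Bool)) × Θ) := by fun_prop
      have e2 : Measurable fun w : (((Fin n → 𝒳) × (Fin n → Bool)) × 𝒳) × Θ =>
          ((w.2, (w.1.2, true)) : Θ × (𝒳 × Bool)) := by fun_prop
      exact (hL.comp e1).mul ((measurable_unitProb_process h hδ).comp e2)
    exact h1.stronglyMeasurable.integral_prod_right.measurable
  · have h1 : StronglyMeasurable (Function.uncurry
        fun (p : (Fin n → 𝒳) × (Fin n → Bool)) (θ : Θ) =>
          likelihood h (fun j y => δ j y θ) p.1 p.2) := hL.stronglyMeasurable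
    exact h1.integral_prod_right.measurable.comp measurable_fst

/-- The ratio of the probabilities of one observation `(x, z)` under the weight functions
`x ↦ δ j x θ` and under `δs`. -/
noncomputable def likelihoodRatio (h : Fin J → Kernel 𝒳 ℝ) (δ : Fin (J + 1) → 𝒳 → Θ → ℝ)
    (δs : Fin (J + 1) → 𝒳 → ℝ) (θ : Θ) (w : 𝒳 × Bool) : ℝ :=
  unitProb h (fun j => δ j w.1 θ) w.1 w.2 / unitProb h (fun j => δs j w.1) w.1 w.2

/-- A weighted mean differs from a number by at most the weighted mean of the differences. -/
lemma enorm_weightedMean_sub_mul_le {Q : Measure Θ} {L u : Θ → ℝ} (hL0 : ∀ θ, 0 ≤ L θ)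
    (hL : Integrable L Q) (hLu : Integrable (fun θ => L θ * u θ) Q) (hpos : 0 < ∫ θ, L θ ∂Q)
    (s : ℝ) :
    ‖(∫ θ, L θ * u θ ∂Q) / (∫ θ, L θ ∂Q) - s‖ₑ * ∫⁻ θ, ENNReal.ofReal (L θ) ∂Q ≤
      ∫⁻ θ, ENNReal.ofReal (L θ) * ‖u θ - s‖ₑ ∂Q := by
  rw [← ofReal_integral_eq_lintegral_ofReal hL (Eventually.of_forall hL0),
    Real.enorm_eq_ofReal_abs, ← ENNReal.ofReal_mul (abs_nonneg _)]
  have h1 : |(∫ θ, L θ * u θ ∂Q) / (∫ θ, L θ ∂Q) - s| * ∫ θ, L θ ∂Q =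
      |∫ θ, L θ * (u θ - s) ∂Q| := by
    have h2 : ∫ θ, L θ * (u θ - s) ∂Q =
        ((∫ θ, L θ * u θ ∂Q) / (∫ θ, L θ ∂Q) - s) * ∫ θ, L θ ∂Q := by
      simp_rw [mul_sub]
      rw [integral_sub hLu (hL.mul_const s), integral_mul_const]
      field_simp
    rw [h2, abs_mul, abs_of_pos hpos]
  rw [h1, ← Real.enorm_eq_ofReal_abs]
  refine (enorm_integral_le_lintegral_enorm _).trans (le_of_eq (lintegral_congr fun θ => ?_))
  rw [enorm_mul, Real.enorm_eq_ofReal_abs (L θ), abs_of_nonneg (hL0 θ)]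

/-- The mean error of the propensity estimate on `E`, times the marginal likelihood, is at most the
integral of the likelihood against the mean error of the single parameters. -/
lemma setLIntegral_error_mul_le {Ω : Type*} (h : Fin J → Kernel 𝒳 ℝ)
    [∀ j, IsMarkovKernel (h j)] (ν : Measure 𝒳) [IsProbabilityMeasure ν] (Q : Measure Θ)
    [IsProbabilityMeasure Q] {δ : Fin (J + 1) → 𝒳 → Θ → ℝ}
    (hδ : ∀ j, Measurable (Function.uncurry (δ j))) {δs : Fin (J + 1) → 𝒳 → ℝ}
    (hδs : ∀ j, Measurable (δs j)) (X : ℕ → Ω → 𝒳) (Z : ℕ → Ω → Bool) (E : Set 𝒳) (n : ℕ) (ω : Ω)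
    {R : Θ → ℝ≥0∞}
    (hR : ∀ θ, R θ = relLikelihood (likelihoodRatio h δ δs) (fun i ω => (X i ω, Z i ω)) n ω θ) :
    (∫⁻ x in E, ‖propensityEstimate h Q δ (fun i : Fin n => X i ω) (fun i : Fin n => Z i ω) x -
        unitProb h (fun j => δs j x) x true‖ₑ ∂ν) * ∫⁻ θ, R θ ∂Q ≤
      ∫⁻ θ, R θ * ∫⁻ x in E, ‖unitProb h (fun j => δ j x θ) x true -
        unitProb h (fun j => δs j x) x true‖ₑ ∂ν ∂Q ∧
    ∫⁻ θ, R θ ∂Q ≠ 0 ∧ ∫⁻ θ, R θ ∂Q ≠ ⊤ := by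
  set xs : Fin n → 𝒳 := fun i => X i ω
  set zs : Fin n → Bool := fun i => Z i ω
  set k : ℝ := likelihood h δs xs zs with hk
  have hkpos : 0 < k := likelihood_pos h δs xs zs
  set L : Θ → ℝ := fun θ => likelihood h (fun j y => δ j y θ) xs zs / k with hL
  have hLpos : ∀ θ, 0 < L θ := fun θ => div_pos (likelihood_pos h _ xs zs) hkpos
  have hRL : ∀ θ, R θ = ENNReal.ofReal (L θ) := by
    intro θ
    rw [hR]
    simp only [relLikelihood, likelihoodRatio, hL, hk, likelihood]
    rw [← Finset.prod_div_distrib, ENNReal.ofReal_prod_of_nonneg]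
    intro i _
    exact (div_pos (unitProb_pos h _ _ _) (unitProb_pos h _ _ _)).le
  have hq := measurable_unitProb_process h hδ
  have hqx : ∀ x, Measurable fun θ => unitProb h (fun j => δ j x θ) x true := fun x => by
    have e : Measurable fun θ : Θ => ((θ, (x, true)) : Θ × (𝒳 × Bool)) := by fun_prop
    exact hq.comp e
  have hLu : ∀ {u : Θ → ℝ}, Measurable u → (∀ θ, |u θ| ≤ 1) →
      Integrable (fun θ => L θ * u θ) Q := by
    intro u hu hu1
    have := (integrable_likelihood_mul h Q hδ xs zs hu hu1).div_const k
    refine this.congr (Eventually.of_forall fun θ => ?_)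
    simp only [hL]
    ring
  have hLi : Integrable L Q := by
    have := hLu (u := fun _ => 1) measurable_const (by simp)
    simpa using this
  have hLint : 0 < ∫ θ, L θ ∂Q := by
    refine (integral_pos_iff_support_of_nonneg (fun θ => (hLpos θ).le) hLi).2 ?_
    have : Function.support L = Set.univ := Set.eq_univ_of_forall fun θ => (hLpos θ).ne'
    rw [this, measure_univ]
    exact one_pos
  have hRint : ∫⁻ θ, R θ ∂Q = ENNReal.ofReal (∫ θ, L θ ∂Q) := by
    rw [ofReal_integral_eq_lintegral_ofReal hLi (Eventually.of_forall fun θ => (hLpos θ).le)]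
    exact lintegral_congr hRL
  refine ⟨?_, by rw [hRint]; simpa using hLint, by rw [hRint]; simp⟩
  have hest : ∀ x, propensityEstimate h Q δ xs zs x =
      (∫ θ, L θ * unitProb h (fun j => δ j x θ) x true ∂Q) / ∫ θ, L θ ∂Q := by
    intro x
    rw [propensityEstimate_eq h Q hδ]
    simp only [hL, div_mul_eq_mul_div, integral_div]
    rw [div_div_div_cancel_right₀ hkpos.ne']
  have hD : ∫⁻ θ, R θ ∂Q = ∫⁻ θ, ENNReal.ofReal (L θ) ∂Q := lintegral_congr hRL
  have hLm : Measurable L := (measurable_likelihood h hδ xs zs).div_const k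
  have hsm : Measurable fun x => unitProb h (fun j => δs j x) x true :=
    measurable_unitProb_comp h hδs true
  have hqm : Measurable fun p : 𝒳 × Θ => ‖unitProb h (fun j => δ j p.1 p.2) p.1 true -
      unitProb h (fun j => δs j p.1) p.1 true‖ₑ := by
    have e : Measurable fun p : 𝒳 × Θ => ((p.2, (p.1, true)) : Θ × (𝒳 × Bool)) := by fun_prop
    exact ((hq.comp e).sub (hsm.comp measurable_fst)).enorm
  rw [← lintegral_mul_const' _ _ (by rw [hRint]; simp)]
  calc ∫⁻ x in E, ‖propensityEstimate h Q δ xs zs x - unitProb h (fun j => δs j x) x true‖ₑ *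
        (∫⁻ θ, R θ ∂Q) ∂ν
      ≤ ∫⁻ x in E, ∫⁻ θ, ENNReal.ofReal (L θ) * ‖unitProb h (fun j => δ j x θ) x true -
          unitProb h (fun j => δs j x) x true‖ₑ ∂Q ∂ν := by
        refine lintegral_mono fun x => ?_
        rw [hest, hD]
        refine enorm_weightedMean_sub_mul_le (fun θ => (hLpos θ).le) hLi
          (hLu (hqx x) fun θ => ?_) hLint _
        rw [abs_of_pos (unitProb_pos h _ _ _)]
        exact unitProb_le_one h _ _ _
    _ = ∫⁻ θ, ∫⁻ x in E, ENNReal.ofReal (L θ) * ‖unitProb h (fun j => δ j x θ) x true -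
          unitProb h (fun j => δs j x) x true‖ₑ ∂ν ∂Q :=
        lintegral_lintegral_swap
          ((hLm.ennreal_ofReal.comp measurable_snd).mul hqm).aemeasurable
    _ = _ := by
        refine lintegral_congr fun θ => ?_
        rw [lintegral_const_mul' _ _ (by simp), hRL]

/-- Integration against the law of one observation. -/
lemma lintegral_truth {ν : Measure 𝒳} [SFinite ν] {pstar : Kernel 𝒳 Bool} [IsMarkovKernel pstar]
    {p : 𝒳 → Bool → ℝ} (hp : ∀ᵐ x ∂ν, ∀ z : Bool, (pstar x).real {z} = p x z)
    {F : 𝒳 × Bool → ℝ≥0∞} (hF : Measurable F) :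
    ∫⁻ w, F w ∂(ν ⊗ₘ pstar) = ∫⁻ x, ∑ z : Bool, ENNReal.ofReal (p x z) * F (x, z) ∂ν := by
  rw [Measure.lintegral_compProd hF]
  refine lintegral_congr_ae ?_
  filter_upwards [hp] with x hx
  rw [lintegral_fintype]
  refine Finset.sum_congr rfl fun z _ => ?_
  rw [← hx z, ofReal_measureReal, mul_comm]

end

/-! ### Likelihood ratios, prior support and tests in the synthesis model -/

section

variable {𝒳 Θ : Type*} [MeasurableSpace 𝒳] [MeasurableSpace Θ] {J : ℕ}
  {h : Fin J → Kernel 𝒳 ℝ} [∀ j, IsMarkovKernel (h j)] {δ : Fin (J + 1) → 𝒳 → Θ → ℝ}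
  {δs : Fin (J + 1) → 𝒳 → ℝ}

lemma likelihoodRatio_pos {Θ : Type*} {δ : Fin (J + 1) → 𝒳 → Θ → ℝ} (θ : Θ) (w : 𝒳 × Bool) :
    0 < likelihoodRatio h δ δs θ w :=
  div_pos (unitProb_pos h _ _ _) (unitProb_pos h _ _ _)

lemma measurable_likelihoodRatio (hδ : ∀ j, Measurable (Function.uncurry (δ j)))
    (hδs : ∀ j, Measurable (δs j)) :
    Measurable (Function.uncurry (likelihoodRatio h δ δs)) := by
  have h1 : Measurable fun p : Unit × (𝒳 × Bool) =>
      unitProb h (fun j => δs j p.2.1) p.2.1 p.2.2 :=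
    measurable_unitProb_process h (δ := fun j x _ => δs j x)
      fun j => (hδs j).comp measurable_fst
  have e : Measurable fun p : Θ × (𝒳 × Bool) => (((), p.2) : Unit × (𝒳 × Bool)) := by fun_prop
  exact (measurable_unitProb_process h hδ).div (h1.comp e)

lemma measurable_process_apply (hδ : ∀ j, Measurable (Function.uncurry (δ j))) (θ : Θ)
    (j : Fin (J + 1)) : Measurable fun x => δ j x θ := by
  have e : Measurable fun x : 𝒳 => ((x, θ) : 𝒳 × Θ) := by fun_prop
  exact (hδ j).comp e

lemma integral_truth {ν : Measure 𝒳} [SFinite ν] {pstar : Kernel 𝒳 Bool} [IsMarkovKernel pstar]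
    {p : 𝒳 → Bool → ℝ} (hp : ∀ᵐ x ∂ν, ∀ z : Bool, (pstar x).real {z} = p x z)
    {F : 𝒳 × Bool → ℝ} (hF : Integrable F (ν ⊗ₘ pstar)) :
    ∫ w, F w ∂(ν ⊗ₘ pstar) = ∫ x, ∑ z : Bool, p x z * F (x, z) ∂ν := by
  rw [Measure.integral_compProd hF]
  refine integral_congr_ae ?_
  filter_upwards [hp] with x hx
  rw [integral_fintype .of_finite]
  refine Finset.sum_congr rfl fun z _ => ?_
  rw [hx z, smul_eq_mul]

variable {ν : Measure 𝒳} [IsProbabilityMeasure ν] {pstar : Kernel 𝒳 Bool} [IsMarkovKernel pstar]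

lemma lintegral_likelihoodRatio (hδ : ∀ j, Measurable (Function.uncurry (δ j)))
    (hδs : ∀ j, Measurable (δs j))
    (hmodel : ∀ᵐ x ∂ν, ∀ z : Bool, (pstar x).real {z} = unitProb h (fun j => δs j x) x z) (θ : Θ) :
    ∫⁻ w, ENNReal.ofReal (likelihoodRatio h δ δs θ w) ∂(ν ⊗ₘ pstar) = 1 := by
  have hm : Measurable (likelihoodRatio h δ δs θ) :=
    (measurable_likelihoodRatio hδ hδs).comp measurable_prodMk_left
  rw [lintegral_truth (p := fun x z => unitProb h (fun j => δs j x) x z) hmodel hm.ennreal_ofReal]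
  have h1 : ∀ x, ∑ z : Bool, ENNReal.ofReal (unitProb h (fun j => δs j x) x z) *
      ENNReal.ofReal (likelihoodRatio h δ δs θ (x, z)) = 1 := by
    intro x
    have h2 : ∀ z, ENNReal.ofReal (unitProb h (fun j => δs j x) x z) *
        ENNReal.ofReal (likelihoodRatio h δ δs θ (x, z)) =
        ENNReal.ofReal (unitProb h (fun j => δ j x θ) x z) := fun z => by
      rw [← ENNReal.ofReal_mul (unitProb_pos h _ _ _).le, likelihoodRatio,
        mul_div_cancel₀ _ (unitProb_pos h _ _ _).ne']
    simp only [h2, Fintype.sum_bool]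
    rw [← ENNReal.ofReal_add (unitProb_pos h _ _ _).le (unitProb_pos h _ _ _).le, unitProb_add,
      ENNReal.ofReal_one]
  simp only [h1, lintegral_const, measure_univ, mul_one]

lemma integrable_likelihoodRatio (hδ : ∀ j, Measurable (Function.uncurry (δ j)))
    (hδs : ∀ j, Measurable (δs j))
    (hmodel : ∀ᵐ x ∂ν, ∀ z : Bool, (pstar x).real {z} = unitProb h (fun j => δs j x) x z) (θ : Θ) :
    Integrable (likelihoodRatio h δ δs θ) (ν ⊗ₘ pstar) := by
  have hm : Measurable (likelihoodRatio h δ δs θ) :=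
    (measurable_likelihoodRatio hδ hδs).comp measurable_prodMk_left
  refine ⟨hm.aestronglyMeasurable, ?_⟩
  rw [hasFiniteIntegral_iff_ofReal (Eventually.of_forall fun w => (likelihoodRatio_pos θ w).le),
    lintegral_likelihoodRatio hδ hδs hmodel]
  exact ENNReal.one_lt_top

lemma integral_likelihoodRatio (hδ : ∀ j, Measurable (Function.uncurry (δ j)))
    (hδs : ∀ j, Measurable (δs j))
    (hmodel : ∀ᵐ x ∂ν, ∀ z : Bool, (pstar x).real {z} = unitProb h (fun j => δs j x) x z) (θ : Θ) :
    ∫ w, likelihoodRatio h δ δs θ w ∂(ν ⊗ₘ pstar) = 1 := by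
  rw [integral_eq_lintegral_of_nonneg_ae
    (Eventually.of_forall fun w => (likelihoodRatio_pos θ w).le)
    (integrable_likelihoodRatio hδ hδs hmodel θ).aestronglyMeasurable,
    lintegral_likelihoodRatio hδ hδs hmodel, ENNReal.toReal_one]

/-- The upper bound of the log-likelihood ratio of the observation `w`, for the parameter `θ`. -/
noncomputable def processLogRatioBound (h : Fin J → Kernel 𝒳 ℝ) (δ : Fin (J + 1) → 𝒳 → Θ → ℝ)
    (δs : Fin (J + 1) → 𝒳 → ℝ) (θ : Θ) (w : 𝒳 × Bool) : ℝ≥0∞ :=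
  logRatioBound h (fun j => δs j w.1) (fun j => δ j w.1 θ) w.1 w.2

lemma measurable_processLogRatioBound (hδ : ∀ j, Measurable (Function.uncurry (δ j)))
    (hδs : ∀ j, Measurable (δs j)) :
    Measurable (Function.uncurry (processLogRatioBound h δ δs)) := by
  have h1 : Measurable fun p : (Θ × 𝒳) × Bool =>
      logRatioBound h (fun j => δs j p.1.2) (fun j => δ j p.1.2 p.1.1) p.1.2 p.2 := by
    refine measurable_from_prod_countable_left fun z => ?_
    refine (measurable_logRatioBound h z).comp (((measurable_pi_lambda _ fun j => ?_).prodMk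
      (measurable_pi_lambda _ fun j => ?_)).prodMk measurable_snd)
    · exact (hδs j).comp measurable_snd
    · exact (hδ j).comp measurable_swap
  have e : Measurable fun p : Θ × (𝒳 × Bool) => (((p.1, p.2.1), p.2.2) : (Θ × 𝒳) × Bool) := by
    fun_prop
  exact h1.comp e

lemma exp_neg_processLogRatioBound_le {Θ : Type*} {δ : Fin (J + 1) → 𝒳 → Θ → ℝ} (θ : Θ)
    (w : 𝒳 × Bool)
    (hw : processLogRatioBound h δ δs θ w ≠ ⊤) :
    Real.exp (-(processLogRatioBound h δ δs θ w).toReal) ≤ likelihoodRatio h δ δs θ w := by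
  rw [likelihoodRatio, le_div_iff₀ (unitProb_pos h _ _ _)]
  exact exp_neg_logRatioBound_mul_le h _ _ _ _ hw

/-- The Cauchy-Schwarz inequality. -/
lemma lintegral_enorm_mul_le {ν : Measure 𝒳} {f : 𝒳 → ℝ} {g : 𝒳 → ℝ≥0∞} (hf : AEMeasurable f ν)
    (hg : AEMeasurable g ν) :
    ∫⁻ x, ‖f x‖ₑ * g x ∂ν ≤ eLpNorm f 2 ν * (∫⁻ x, g x ^ 2 ∂ν) ^ (1 / 2 : ℝ) := by
  have hCS := ENNReal.lintegral_mul_le_Lp_mul_Lq ν (p := 2) (q := 2) (f := fun x => ‖f x‖ₑ) (g := g)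
    (by constructor <;> norm_num) hf.enorm hg
  simp only [Pi.mul_apply, ENNReal.rpow_ofNat] at hCS
  refine hCS.trans (le_of_eq ?_)
  rw [eLpNorm_eq_lintegral_rpow_enorm_toReal (by simp) (by simp)]
  simp only [ENNReal.toReal_ofNat, ENNReal.rpow_ofNat]

/-- The mean log-likelihood ratio is controlled by the distances of the weight functions in
`L²(ν)`. -/
lemma lintegral_processLogRatioBound_le (hδ : ∀ j, Measurable (Function.uncurry (δ j)))
    (hδs : ∀ j, Measurable (δs j))
    (hmodel : ∀ᵐ x ∂ν, ∀ z : Bool, (pstar x).real {z} = unitProb h (fun j => δs j x) x z) (θ : Θ) :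
    ∫⁻ w, processLogRatioBound h δ δs θ w ∂(ν ⊗ₘ pstar) ≤
      ∑ j, eLpNorm (fun x => δ j x θ - δs j x) 2 ν *
        (∫⁻ x, regressorSize h j x ^ 2 ∂ν) ^ (1 / 2 : ℝ) := by
  have haθ : Measurable (processLogRatioBound h δ δs θ) :=
    (measurable_processLogRatioBound hδ hδs).comp measurable_prodMk_left
  have hdm : ∀ j, Measurable fun x => δs j x - δ j x θ := fun j =>
    (hδs j).sub (measurable_process_apply hδ θ j)
  rw [lintegral_truth (p := fun x z => unitProb h (fun j => δs j x) x z) hmodel haθ]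
  calc ∫⁻ x, ∑ z : Bool, ENNReal.ofReal (unitProb h (fun j => δs j x) x z) *
          processLogRatioBound h δ δs θ (x, z) ∂ν
      ≤ ∫⁻ x, ∑ j, ‖δs j x - δ j x θ‖ₑ * regressorSize h j x ∂ν :=
        lintegral_mono fun x => sum_unitProb_mul_logRatioBound_le h (fun j => δs j x)
          (fun j => δ j x θ) x
    _ = ∑ j, ∫⁻ x, ‖δs j x - δ j x θ‖ₑ * regressorSize h j x ∂ν :=
        lintegral_finsetSum _ fun j _ => (hdm j).enorm.mul (measurable_regressorSize h j)
    _ ≤ _ := by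
        refine Finset.sum_le_sum fun j _ => ?_
        have h1 := lintegral_enorm_mul_le (ν := ν) (f := fun x => δs j x - δ j x θ)
          (g := regressorSize h j) (hdm j).aemeasurable
          (measurable_regressorSize h j).aemeasurable
        have h2 : eLpNorm (fun x => δs j x - δ j x θ) 2 ν =
            eLpNorm (fun x => δ j x θ - δs j x) 2 ν := 
          eLpNorm_sub_comm (δs j) (fun x => δ j x θ) 2 ν
        rwa [h2] at h1

/-- The Kullback-Leibler support condition: every bound of the mean log-likelihood ratio holds with
positive prior probability. -/
lemma measure_processLogRatioBound_ne_zero {Q : Measure Θ}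
    (hδ : ∀ j, Measurable (Function.uncurry (δ j)))
    (hδs : ∀ j, Measurable (δs j))
    (hmodel : ∀ᵐ x ∂ν, ∀ z : Bool, (pstar x).real {z} = unitProb h (fun j => δs j x) x z)
    (hmass : ∀ ε : ℝ≥0∞, 0 < ε → 0 < Q {θ | ∀ j, eLpNorm (fun x => δ j x θ - δs j x) 2 ν < ε})
    (hreg : ∀ j, ∫⁻ x, regressorSize h j x ^ 2 ∂ν ≠ ⊤) {κ₀ : ℝ} (hκ₀ : 0 < κ₀) :
    Q {θ | ∫⁻ w, processLogRatioBound h δ δs θ w ∂(ν ⊗ₘ pstar) ≤ ENNReal.ofReal κ₀} ≠ 0 := by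
  obtain ⟨K, hK⟩ : ∃ K : ℝ≥0∞,
    K = ∑ j, (∫⁻ x, regressorSize h j x ^ 2 ∂ν) ^ (1 / 2 : ℝ) := ⟨_, rfl⟩
  have hK0 : K ≠ ⊤ := by
    rw [hK]
    exact ENNReal.sum_ne_top.2 fun j _ => ENNReal.rpow_ne_top_of_nonneg (by norm_num) (hreg j)
  have hKtop : K + 1 ≠ ⊤ := ENNReal.add_ne_top.2 ⟨hK0, ENNReal.one_ne_top⟩
  obtain ⟨ε, hε⟩ : ∃ ε : ℝ≥0∞, ε = ENNReal.ofReal κ₀ / (K + 1) := ⟨_, rfl⟩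
  have hεpos : 0 < ε := by
    rw [hε]
    exact ENNReal.div_pos (by simpa using hκ₀) hKtop
  have hεK : ε * (K + 1) = ENNReal.ofReal κ₀ := by
    rw [hε]
    exact ENNReal.div_mul_cancel (by simp) hKtop
  refine ((hmass ε hεpos).trans_le (measure_mono fun θ hθ => ?_)).ne'
  have hθ' : ∀ j, eLpNorm (fun x => δ j x θ - δs j x) 2 ν < ε := hθ
  change ∫⁻ w, processLogRatioBound h δ δs θ w ∂(ν ⊗ₘ pstar) ≤ ENNReal.ofReal κ₀
  refine (lintegral_processLogRatioBound_le hδ hδs hmodel θ).trans ?_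
  calc ∑ j, eLpNorm (fun x => δ j x θ - δs j x) 2 ν *
        (∫⁻ x, regressorSize h j x ^ 2 ∂ν) ^ (1 / 2 : ℝ)
      ≤ ∑ j, ε * (∫⁻ x, regressorSize h j x ^ 2 ∂ν) ^ (1 / 2 : ℝ) :=
        Finset.sum_le_sum fun j _ => mul_le_mul_left (hθ' j).le _
    _ = ε * K := by rw [hK, Finset.mul_sum]
    _ ≤ ε * (K + 1) := mul_le_mul_right le_self_add _
    _ = ENNReal.ofReal κ₀ := hεK

/-- If the parameters `θ`, `θ₀` are close on `E`, and `θ₀` is at mean distance at least `ε` from the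
truth on `E`, then the sign of the deviation of `θ₀` from the truth separates `θ` from the truth. -/
lemma sign_test_gap (hδ : ∀ j, Measurable (Function.uncurry (δ j)))
    (hδs : ∀ j, Measurable (δs j))
    (hmodel : ∀ᵐ x ∂ν, ∀ z : Bool, (pstar x).real {z} = unitProb h (fun j => δs j x) x z)
    {E : Set 𝒳} (hE : MeasurableSet E) {θ₀ θ : Θ} {ε : ℝ} (hε : 0 < ε)
    (hfar : ENNReal.ofReal ε ≤ ∫⁻ x in E, ‖unitProb h (fun j => δ j x θ₀) x true -
      unitProb h (fun j => δs j x) x true‖ₑ ∂ν)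
    (hclose : ∫⁻ x in E, ‖unitProb h (fun j => δ j x θ) x true -
      unitProb h (fun j => δ j x θ₀) x true‖ₑ ∂ν ≤ ENNReal.ofReal (ε / 2))
    {s : 𝒳 → ℝ} (hs : s = fun x => if unitProb h (fun j => δs j x) x true ≤
      unitProb h (fun j => δ j x θ₀) x true then 1 else -1)
    {g : 𝒳 × Bool → ℝ} (hg : g = fun w => if w.2 then E.indicator s w.1 else 0)
    (hgm : Measurable g) (hg1 : ∀ w, |g w| ≤ 1) :
    ∫ w, g w ∂(ν ⊗ₘ pstar) + ε / 2 ≤ ∫ w, g w * likelihoodRatio h δ δs θ w ∂(ν ⊗ₘ pstar) := by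
  set q : 𝒳 → ℝ := fun x => unitProb h (fun j => δ j x θ) x true with hq
  set q₀ : 𝒳 → ℝ := fun x => unitProb h (fun j => δ j x θ₀) x true with hq₀
  set qs : 𝒳 → ℝ := fun x => unitProb h (fun j => δs j x) x true with hqs
  have hqm : Measurable q := measurable_unitProb_comp h (measurable_process_apply hδ θ) true
  have hq₀m : Measurable q₀ := measurable_unitProb_comp h (measurable_process_apply hδ θ₀) true
  have hqsm : Measurable qs := measurable_unitProb_comp h hδs true
  have hint : ∀ {f₁ f₂ : 𝒳 → ℝ}, Measurable f₁ → Measurable f₂ → (∀ x, 0 ≤ f₁ x ∧ f₁ x ≤ 1) →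
      (∀ x, 0 ≤ f₂ x ∧ f₂ x ≤ 1) → Integrable (fun x => f₁ x - f₂ x) (ν.restrict E) := by
    intro f₁ f₂ h₁ h₂ b₁ b₂
    refine Integrable.of_bound (C := 1) (h₁.sub h₂).aestronglyMeasurable
      (Eventually.of_forall fun x => ?_)
    rw [Real.norm_eq_abs, abs_le]
    constructor <;> linarith [(b₁ x).1, (b₁ x).2, (b₂ x).1, (b₂ x).2]
  have hqb : ∀ x, 0 ≤ q x ∧ q x ≤ 1 := fun x => ⟨(unitProb_pos h _ _ _).le, unitProb_le_one h _ _ _⟩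
  have hq₀b : ∀ x, 0 ≤ q₀ x ∧ q₀ x ≤ 1 :=
    fun x => ⟨(unitProb_pos h _ _ _).le, unitProb_le_one h _ _ _⟩
  have hqsb : ∀ x, 0 ≤ qs x ∧ qs x ≤ 1 :=
    fun x => ⟨(unitProb_pos h _ _ _).le, unitProb_le_one h _ _ _⟩
  have i0 := hint hq₀m hqsm hq₀b hqsb
  have i1 := hint hqm hq₀m hqb hq₀b
  have hfar' : ε ≤ ∫ x in E, |q₀ x - qs x| ∂ν := by
    have h1 := ofReal_integral_norm_eq_lintegral_enorm i0
    simp only [Real.norm_eq_abs] at h1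
    have h2 : ENNReal.ofReal ε ≤ ENNReal.ofReal (∫ x in E, |q₀ x - qs x| ∂ν) := by
      rw [h1]; exact hfar
    exact (ENNReal.ofReal_le_ofReal_iff (integral_nonneg fun x => abs_nonneg _)).1 h2
  have hclose' : ∫ x in E, |q x - q₀ x| ∂ν ≤ ε / 2 := by
    have h1 := ofReal_integral_norm_eq_lintegral_enorm i1
    simp only [Real.norm_eq_abs] at h1
    have h2 : ENNReal.ofReal (∫ x in E, |q x - q₀ x| ∂ν) ≤ ENNReal.ofReal (ε / 2) := by
      rw [h1]; exact hclose
    exact (ENNReal.ofReal_le_ofReal_iff (by positivity)).1 h2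
  have hgi : Integrable g (ν ⊗ₘ pstar) := Integrable.of_bound (C := 1) hgm.aestronglyMeasurable
    (Eventually.of_forall hg1)
  have hgr : Integrable (fun w => g w * likelihoodRatio h δ δs θ w) (ν ⊗ₘ pstar) :=
    (integrable_likelihoodRatio hδ hδs hmodel θ).bdd_mul hgm.aestronglyMeasurable
      (Eventually.of_forall hg1)
  have hgd : Integrable (fun w => g w * likelihoodRatio h δ δs θ w - g w) (ν ⊗ₘ pstar) :=
    hgr.sub hgi
  have hkey : ∫ w, (g w * likelihoodRatio h δ δs θ w - g w) ∂(ν ⊗ₘ pstar) =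
      ∫ x in E, s x * (q x - qs x) ∂ν := by
    rw [integral_truth (p := fun x z => unitProb h (fun j => δs j x) x z) hmodel hgd,
      ← integral_indicator hE]
    refine integral_congr_ae (Eventually.of_forall fun x => ?_)
    have hp : 0 < qs x := unitProb_pos h _ _ _
    have hr : likelihoodRatio h δ δs θ (x, true) = q x / qs x := rfl
    simp only [Fintype.sum_bool, hg, if_true, Bool.false_eq_true, if_false, zero_mul, sub_self,
      mul_zero, add_zero, hr]
    change qs x * (E.indicator s x * (q x / qs x) - E.indicator s x) = _
    by_cases hx : x ∈ E
    · simp only [Set.indicator_of_mem hx]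
      field_simp
    · simp [Set.indicator_of_notMem hx]
  have hss : ∀ x, |q₀ x - qs x| - |q x - q₀ x| ≤ s x * (q x - qs x) := by
    intro x
    rw [hs]
    change _ ≤ (if qs x ≤ q₀ x then (1 : ℝ) else -1) * _
    split_ifs with hc
    · rw [abs_of_nonneg (by linarith)]
      linarith [neg_abs_le (q x - q₀ x)]
    · rw [abs_of_neg (by linarith)]
      linarith [le_abs_self (q x - q₀ x)]
  have hsm : Measurable s := by
    rw [hs]
    exact Measurable.ite (measurableSet_le hqsm hq₀m) measurable_const measurable_const
  have hsi : Integrable (fun x => s x * (q x - qs x)) (ν.restrict E) := by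
    refine (hint hqm hqsm hqb hqsb).bdd_mul (c := 1) hsm.aestronglyMeasurable
      (Eventually.of_forall fun x => ?_)
    rw [hs]
    dsimp only
    split_ifs <;> simp
  have hfin : ∫ x in E, (|q₀ x - qs x| - |q x - q₀ x|) ∂ν ≤ ∫ x in E, s x * (q x - qs x) ∂ν :=
    integral_mono (i0.abs.sub i1.abs) hsi hss
  rw [integral_sub i0.abs i1.abs] at hfin
  rw [integral_sub hgr hgi] at hkey
  linarith

/-- Every cell of parameters that are close to each other on `E` has one test that separates all its
members at mean distance at least `ε` from the truth. -/
lemma exists_cell_test (hδ : ∀ j, Measurable (Function.uncurry (δ j)))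
    (hδs : ∀ j, Measurable (δs j))
    (hmodel : ∀ᵐ x ∂ν, ∀ z : Bool, (pstar x).real {z} = unitProb h (fun j => δs j x) x z)
    {E : Set 𝒳} (hE : MeasurableSet E) {N : ℝ} (hN : 0 < N)
    (hRN : ∀ x ∈ E, ∀ j, regressorSize h j x ≤ ENNReal.ofReal N) {ε : ℝ} (hε : 0 < ε) {A : Set Θ}
    (hA : ∀ θ ∈ A, ∀ θ' ∈ A,
      ∑ j, ∫⁻ x in E, ‖δ j x θ - δ j x θ'‖ₑ ∂ν ≤ ENNReal.ofReal (ε / 2 / N)) :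
    ∃ g : 𝒳 × Bool → ℝ, Measurable g ∧ (∀ w, |g w| ≤ 1) ∧
      ∀ θ ∈ A ∩ {θ | ENNReal.ofReal ε ≤ ∫⁻ x in E, ‖unitProb h (fun j => δ j x θ) x true -
        unitProb h (fun j => δs j x) x true‖ₑ ∂ν},
        ∫ w, g w ∂(ν ⊗ₘ pstar) + ε / 2 ≤
          ∫ w, g w * likelihoodRatio h δ δs θ w ∂(ν ⊗ₘ pstar) := by
  by_cases hne : (A ∩ {θ | ENNReal.ofReal ε ≤ ∫⁻ x in E, ‖unitProb h (fun j => δ j x θ) x true -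
        unitProb h (fun j => δs j x) x true‖ₑ ∂ν}).Nonempty
  swap
  · exact ⟨fun _ => 0, measurable_const, by simp, fun θ hθ => absurd ⟨θ, hθ⟩ hne⟩
  obtain ⟨θ₀, hθ₀A, hθ₀U⟩ := hne
  set s : 𝒳 → ℝ := fun x => if unitProb h (fun j => δs j x) x true ≤
      unitProb h (fun j => δ j x θ₀) x true then 1 else -1 with hs
  have hsm : Measurable s := Measurable.ite
    (measurableSet_le (measurable_unitProb_comp h hδs true)
      (measurable_unitProb_comp h (measurable_process_apply hδ θ₀) true))
    measurable_const measurable_const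
  have hgm : Measurable fun w : 𝒳 × Bool => if w.2 then E.indicator s w.1 else 0 :=
    Measurable.ite (measurable_snd (measurableSet_singleton true))
      ((hsm.indicator hE).comp measurable_fst) measurable_const
  have hg1 : ∀ w : 𝒳 × Bool, |if w.2 then E.indicator s w.1 else 0| ≤ 1 := by
    intro w
    split_ifs
    · by_cases hx : w.1 ∈ E
      · rw [Set.indicator_of_mem hx, hs]
        dsimp only
        split_ifs <;> simp
      · simp [Set.indicator_of_notMem hx]
    · simp
  refine ⟨_, hgm, hg1, fun θ hθ => ?_⟩
  refine sign_test_gap hδ hδs hmodel hE hε hθ₀U ?_ hs rfl hgm hg1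
  have hdm : ∀ j, Measurable fun x => ‖δ j x θ - δ j x θ₀‖ₑ := fun j =>
    ((measurable_process_apply hδ θ j).sub (measurable_process_apply hδ θ₀ j)).enorm
  calc ∫⁻ x in E, ‖unitProb h (fun j => δ j x θ) x true -
        unitProb h (fun j => δ j x θ₀) x true‖ₑ ∂ν
      ≤ ∫⁻ x in E, ∑ j, ‖δ j x θ - δ j x θ₀‖ₑ * ENNReal.ofReal N ∂ν := by
        refine setLIntegral_mono' hE fun x hx => (enorm_unitProb_sub_le h _ _ _ _).trans ?_
        exact Finset.sum_le_sum fun j _ => mul_le_mul_right (hRN x hx j) _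
    _ = (∑ j, ∫⁻ x in E, ‖δ j x θ - δ j x θ₀‖ₑ ∂ν) * ENNReal.ofReal N := by
        rw [lintegral_finsetSum _ fun j _ => (hdm j).mul_const _, Finset.sum_mul]
        exact Finset.sum_congr rfl fun j _ => lintegral_mul_const _ (hdm j)
    _ ≤ ENNReal.ofReal (ε / 2 / N) * ENNReal.ofReal N := mul_le_mul_left (hA θ hθ.1 θ₀ hθ₀A) _
    _ = ENNReal.ofReal (ε / 2) := by
        rw [← ENNReal.ofReal_mul (by positivity), div_mul_cancel₀ _ hN.ne']

end

/-! ### Consistency of the propensity estimate -/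

section

variable {𝒳 Ω Θ : Type*} [MeasurableSpace 𝒳] [MeasurableSpace Ω] [MeasurableSpace Θ] {J : ℕ}
  {h : Fin J → Kernel 𝒳 ℝ} [∀ j, IsMarkovKernel (h j)] {δ : Fin (J + 1) → 𝒳 → Θ → ℝ}
  {δs : Fin (J + 1) → 𝒳 → ℝ} {ν : Measure 𝒳} [IsProbabilityMeasure ν]

lemma measurable_setLIntegral_unitProb_sub (hδ : ∀ j, Measurable (Function.uncurry (δ j)))
    (hδs : ∀ j, Measurable (δs j)) (E : Set 𝒳) :
    Measurable fun θ => ∫⁻ x in E, ‖unitProb h (fun j => δ j x θ) x true -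
      unitProb h (fun j => δs j x) x true‖ₑ ∂ν := by
  have e : Measurable fun p : Θ × 𝒳 => ((p.1, (p.2, true)) : Θ × (𝒳 × Bool)) := by fun_prop
  have h1 : Measurable fun p : Θ × 𝒳 => ‖unitProb h (fun j => δ j p.2 p.1) p.2 true -
      unitProb h (fun j => δs j p.2) p.2 true‖ₑ :=
    (((measurable_unitProb_process h hδ).comp e).sub
      ((measurable_unitProb_comp h hδs true).comp measurable_snd)).enorm
  exact h1.lintegral_prod_right'

lemma setLIntegral_unitProb_sub_le_one {Θ : Type*} {δ : Fin (J + 1) → 𝒳 → Θ → ℝ} (θ : Θ)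
    (E : Set 𝒳) :
    ∫⁻ x in E, ‖unitProb h (fun j => δ j x θ) x true -
      unitProb h (fun j => δs j x) x true‖ₑ ∂ν ≤ 1 := by
  calc ∫⁻ x in E, ‖unitProb h (fun j => δ j x θ) x true -
        unitProb h (fun j => δs j x) x true‖ₑ ∂ν ≤ ∫⁻ _ in E, 1 ∂ν := by
        refine lintegral_mono fun x => ?_
        rw [Real.enorm_eq_ofReal_abs]
        refine ENNReal.ofReal_le_one.2 (abs_le.2 ⟨?_, ?_⟩)
        · linarith [unitProb_pos h (fun j => δ j x θ) x true,
            unitProb_le_one h (fun j => δs j x) x true]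
        · linarith [unitProb_pos h (fun j => δs j x) x true,
            unitProb_le_one h (fun j => δ j x θ) x true]
    _ ≤ 1 := by
        rw [setLIntegral_const, one_mul]
        exact prob_le_one

/-- A mean of a function `d ≤ 1` is small if `d` is small outside a set of small mass. -/
lemma lintegral_mul_le_of_setLIntegral_le {Q : Measure Θ} {R d : Θ → ℝ≥0∞} (hR : Measurable R)
    (hd : ∀ θ, d θ ≤ 1) {U : Set Θ} (hU : MeasurableSet U) {b : ℝ≥0∞}
    (hdU : ∀ θ ∉ U, d θ ≤ b) (hRU : ∫⁻ θ in U, R θ ∂Q ≤ b * ∫⁻ θ, R θ ∂Q) :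
    ∫⁻ θ, R θ * d θ ∂Q ≤ (b + b) * ∫⁻ θ, R θ ∂Q := by
  calc ∫⁻ θ, R θ * d θ ∂Q
      = ∫⁻ θ in U, R θ * d θ ∂Q + ∫⁻ θ in Uᶜ, R θ * d θ ∂Q := (lintegral_add_compl _ hU).symm
    _ ≤ ∫⁻ θ in U, R θ ∂Q + ∫⁻ θ in Uᶜ, R θ * b ∂Q :=
        add_le_add (lintegral_mono fun θ => mul_le_of_le_one_right' (hd θ))
          (setLIntegral_mono' hU.compl fun θ hθ => mul_le_mul_right (hdU θ hθ) _)
    _ ≤ b * ∫⁻ θ, R θ ∂Q + b * ∫⁻ θ, R θ ∂Q := by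
        refine add_le_add hRU ?_
        rw [lintegral_mul_const _ hR, mul_comm]
        exact mul_le_mul_right (setLIntegral_le_lintegral _ _) _
    _ = (b + b) * ∫⁻ θ, R θ ∂Q := (add_mul _ _ _).symm

/-- The mean error over `E` of the estimated propensity tends to zero in probability. -/
theorem tendsto_measure_setLIntegral_error {Q : Measure Θ} [IsProbabilityMeasure Q]
    {m : Fin (J + 1) → 𝒳 → ℝ} {C : Fin (J + 1) → 𝒳 → 𝒳 → ℝ}
    (hprior : IsGPPrior ν Q δ m C) {pstar : Kernel 𝒳 Bool} [IsMarkovKernel pstar]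
    (hδs : ∀ j, Measurable (δs j))
    (hmodel : ∀ᵐ x ∂ν, ∀ z : Bool, (pstar x).real {z} = unitProb h (fun j => δs j x) x z)
    (hmass : ∀ ε : ℝ≥0∞, 0 < ε → 0 < Q {θ | ∀ j, eLpNorm (fun x => δ j x θ - δs j x) 2 ν < ε})
    (hreg : ∀ j, ∫⁻ x, regressorSize h j x ^ 2 ∂ν ≠ ⊤)
    {P : Measure Ω} [IsProbabilityMeasure P] {X : ℕ → Ω → 𝒳} {Z : ℕ → Ω → Bool}
    (hX : ∀ i, Measurable (X i)) (hZ : ∀ i, Measurable (Z i))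
    (hindep : iIndepFun (fun i ω => (X i ω, Z i ω)) P)
    (hlaw : ∀ i, P.map (fun ω => (X i ω, Z i ω)) = ν ⊗ₘ pstar)
    {E : Set 𝒳} (hE : MeasurableSet E) {N : ℝ} (hN : 0 < N) (hCN : ∀ x ∈ E, ∀ j, C j x x ≤ N)
    (hRN : ∀ x ∈ E, ∀ j, regressorSize h j x ≤ ENNReal.ofReal N) {η : ℝ} (hη : 0 < η) :
    Tendsto (fun n : ℕ => P {ω | ENNReal.ofReal η < ∫⁻ x in E,
      ‖propensityEstimate h Q δ (fun i : Fin n => X i ω) (fun i : Fin n => Z i ω) x -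
        unitProb h (fun j => δs j x) x true‖ₑ ∂ν}) atTop (𝓝 0) := by
  have hδ := hprior.measurable
  have hW : ∀ i, Measurable fun ω => (X i ω, Z i ω) := fun i => (hX i).prodMk (hZ i)
  have hrm := measurable_likelihoodRatio (h := h) hδ hδs
  obtain ⟨ε, hε⟩ : ∃ ε : ℝ, ε = min (η / 2) 1 := ⟨_, rfl⟩
  have hεpos : 0 < ε := by rw [hε]; positivity
  have hε1 : ε ≤ 1 := by rw [hε]; exact min_le_right _ _
  have hεη : ε ≤ η / 2 := by rw [hε]; exact min_le_left _ _
  have hUm : MeasurableSet {θ | ENNReal.ofReal ε ≤ ∫⁻ x in E,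
      ‖unitProb h (fun j => δ j x θ) x true - unitProb h (fun j => δs j x) x true‖ₑ ∂ν} :=
    measurableSet_le measurable_const (measurable_setLIntegral_unitProb_sub hδ hδs E)
  obtain ⟨c, hc, hcov⟩ := exists_prior_covering hprior hE hCN (ε := ε / 2 / N)
    (a := (ε / 2) ^ 2 / 32) (by positivity) (by positivity)
  have hcover : ∀ᶠ n : ℕ in atTop, ∃ (κ : Type) (_ : Countable κ) (A : κ → Set Θ),
      (∀ i, MeasurableSet (A i)) ∧
      (∀ i, ∃ g : 𝒳 × Bool → ℝ, Measurable g ∧ (∀ z, |g z| ≤ 1) ∧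
        ∀ θ ∈ A i ∩ {θ | ENNReal.ofReal ε ≤ ∫⁻ x in E,
          ‖unitProb h (fun j => δ j x θ) x true - unitProb h (fun j => δs j x) x true‖ₑ ∂ν},
          ∫ z, g z ∂(ν ⊗ₘ pstar) + ε / 2 ≤
            ∫ z, g z * likelihoodRatio h δ δs θ z ∂(ν ⊗ₘ pstar)) ∧
      ∑' i, (Q (A i)) ^ (1 / 2 : ℝ) ≤ ENNReal.ofReal (Real.exp ((ε / 2) ^ 2 / 32 * n)) ∧
      Q (⋃ i, A i)ᶜ ≤ 2 * ENNReal.ofReal (Real.exp (-(c * n))) := by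
    filter_upwards [hcov] with n hn
    obtain ⟨κ, hκ, A, hAm, hAd, hAs, hAc⟩ := hn
    exact ⟨κ, hκ, A, hAm,
      fun i => exists_cell_test hδ hδs hmodel hE hN hRN hεpos (hAd i), hAs, hAc⟩
  have hpost := tendsto_measure_posterior_mass (P := P) (Q := Q) (μ := ν ⊗ₘ pstar) (c := c)
    (W := fun i ω => (X i ω, Z i ω)) (η := η / 2) (r := likelihoodRatio h δ δs)
    (a := processLogRatioBound h δ δs) hrm (fun θ w => (likelihoodRatio_pos θ w).le)
    (integrable_likelihoodRatio hδ hδs hmodel) (integral_likelihoodRatio hδ hδs hmodel) hW hindep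
    hlaw (measurable_processLogRatioBound hδ hδs) exp_neg_processLogRatioBound_le
    (fun κ₀ => measure_processLogRatioBound_ne_zero hδ hδs hmodel hmass hreg) hUm
    (half_pos hεpos) (by linarith) hc hcover (half_pos hη)
  refine tendsto_of_tendsto_of_tendsto_of_le_of_le tendsto_const_nhds hpost (fun _ => zero_le)
    fun n => measure_mono fun ω hω => ?_
  by_contra hcon
  rw [Set.mem_ofPred_eq, not_le] at hcon
  have hcon' := hcon.le
  obtain ⟨R, hR⟩ : ∃ R : Θ → ℝ≥0∞, ∀ θ, R θ =
      relLikelihood (likelihoodRatio h δ δs) (fun i ω => (X i ω, Z i ω)) n ω θ :=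
    ⟨_, fun _ => rfl⟩
  have hRm : Measurable R := by
    have e : Measurable fun θ : Θ => ((ω, θ) : Ω × Θ) := by fun_prop
    have h1 := (measurable_relLikelihood hrm hW n).comp e
    rwa [show R = _ from funext hR]
  obtain ⟨h1, hD0, hDtop⟩ := setLIntegral_error_mul_le h ν Q hδ hδs X Z E n ω hR
  simp only [← hR] at hcon'
  have h2 := lintegral_mul_le_of_setLIntegral_le (Q := Q) hRm
    (fun θ => setLIntegral_unitProb_sub_le_one (h := h) (δ := δ) (δs := δs) (ν := ν) θ E) hUm
    (fun θ hθ => (le_of_lt (not_le.1 hθ)).trans (ENNReal.ofReal_le_ofReal hεη)) hcon'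
  rw [← ENNReal.ofReal_add (by positivity) (by positivity), add_halves] at h2
  have h3 := (ENNReal.mul_le_mul_iff_left hD0 hDtop).1 (h1.trans h2)
  exact absurd hω (not_lt.2 h3)

/-- The conditional mean sizes of the estimates are square integrable if the estimates are. -/
lemma lintegral_regressorSize_sq_ne_top (hh : ∀ j, MemLp (fun p : 𝒳 × ℝ => p.2) 2 (ν ⊗ₘ h j))
    (j : Fin (J + 1)) : ∫⁻ x, regressorSize h j x ^ 2 ∂ν ≠ ⊤ := by
  refine Fin.cases ?_ (fun j => ?_) j
  · simp [regressorSize]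
  · have h1 : ∀ x, regressorSize h j.succ x ^ 2 ≤ ∫⁻ f, ‖f‖ₑ ^ 2 ∂(h j x) := by
      intro x
      have h2 := lintegral_enorm_mul_le (ν := h j x) (f := fun f => f) (g := fun _ => 1)
        aemeasurable_id aemeasurable_const
      simp only [mul_one, one_pow, lintegral_const, measure_univ, ENNReal.one_rpow] at h2
      rw [eLpNorm_eq_lintegral_rpow_enorm_toReal (by simp) (by simp)] at h2
      simp only [ENNReal.toReal_ofNat, ENNReal.rpow_ofNat] at h2
      refine (pow_le_pow_left₀ zero_le h2 2).trans (le_of_eq ?_)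
      rw [← ENNReal.rpow_ofNat, ← ENNReal.rpow_mul]
      norm_num
    refine ne_top_of_le_ne_top ?_ (lintegral_mono h1)
    rw [← Measure.lintegral_compProd (f := fun p : 𝒳 × ℝ => ‖p.2‖ₑ ^ 2) (by fun_prop)]
    have h3 := (eLpNorm_lt_top_iff_lintegral_rpow_enorm_lt_top (by simp) (by simp)).1 (hh j).2
    simp only [ENNReal.toReal_ofNat, ENNReal.rpow_ofNat] at h3
    exact h3.ne

/-- Markov's inequality on a set `E` of covariates, for an error whose mean over `E` is small with
high probability. -/
lemma lintegral_measure_ge_le {P : Measure Ω} [IsProbabilityMeasure P] {e : Ω × 𝒳 → ℝ≥0∞}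
    (he : Measurable e) {E : Set 𝒳} (hE : MeasurableSet E) {ε : ℝ≥0∞} (hε : ε ≠ 0) (hεtop : ε ≠ ⊤)
    {τ : ℝ≥0∞} (hνE : ν Eᶜ ≤ τ) (hP : P {ω | τ * ε < ∫⁻ x in E, e (ω, x) ∂ν} ≤ τ) :
    ∫⁻ ω, ν (Prod.mk ω ⁻¹' {w | ε ≤ e w}) ∂P ≤ 3 * τ := by
  have hBm : MeasurableSet {ω | τ * ε < ∫⁻ x in E, e (ω, x) ∂ν} :=
    measurableSet_lt measurable_const he.lintegral_prod_right'
  have hω : ∀ ω, ν (Prod.mk ω ⁻¹' {w | ε ≤ e w}) ≤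
      τ + τ + {ω | τ * ε < ∫⁻ x in E, e (ω, x) ∂ν}.indicator 1 ω := by
    intro ω
    by_cases hωB : ω ∈ {ω | τ * ε < ∫⁻ x in E, e (ω, x) ∂ν}
    · rw [Set.indicator_of_mem hωB]
      exact prob_le_one.trans le_add_self
    rw [Set.indicator_of_notMem hωB, add_zero]
    rw [Set.mem_ofPred_eq, not_lt] at hωB
    have hEm : ν.restrict E {x | ε ≤ e (ω, x)} ≤ τ := by
      refine (meas_ge_le_lintegral_div (he.comp measurable_prodMk_left).aemeasurable hε hεtop).trans
        ?_
      exact ENNReal.div_le_of_le_mul hωB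
    calc ν (Prod.mk ω ⁻¹' {w | ε ≤ e w})
        ≤ ν ({x | ε ≤ e (ω, x)} ∩ E) + ν Eᶜ := by
          refine (measure_mono fun x hx => ?_).trans (measure_union_le _ _)
          by_cases hxE : x ∈ E
          · exact Or.inl ⟨hx, hxE⟩
          · exact Or.inr hxE
      _ ≤ τ + τ := by
          refine add_le_add ?_ hνE
          rwa [Measure.restrict_apply' hE] at hEm
  calc ∫⁻ ω, ν (Prod.mk ω ⁻¹' {w | ε ≤ e w}) ∂P
      ≤ ∫⁻ ω, (τ + τ + {ω | τ * ε < ∫⁻ x in E, e (ω, x) ∂ν}.indicator 1 ω) ∂P := lintegral_mono hω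
    _ = τ + τ + P {ω | τ * ε < ∫⁻ x in E, e (ω, x) ∂ν} := by
        rw [lintegral_add_left measurable_const, lintegral_indicator_one hBm, lintegral_const,
          measure_univ, mul_one]
    _ ≤ τ + τ + τ := by gcongr
    _ = 3 * τ := by ring

/-- Consistency for weight functions `δs` that are measurable. -/
theorem tendstoInMeasure_propensityEstimate {Q : Measure Θ} [IsProbabilityMeasure Q]
    {m : Fin (J + 1) → 𝒳 → ℝ} {C : Fin (J + 1) → 𝒳 → 𝒳 → ℝ}
    (hh : ∀ j, MemLp (fun p : 𝒳 × ℝ => p.2) 2 (ν ⊗ₘ h j))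
    (hprior : IsGPPrior ν Q δ m C) {pstar : Kernel 𝒳 Bool} [IsMarkovKernel pstar]
    (hδs : ∀ j, Measurable (δs j))
    (hmodel : ∀ᵐ x ∂ν, ∀ z : Bool, (pstar x).real {z} = unitProb h (fun j => δs j x) x z)
    (hmass : ∀ ε : ℝ≥0∞, 0 < ε → 0 < Q {θ | ∀ j, eLpNorm (fun x => δ j x θ - δs j x) 2 ν < ε})
    {P : Measure Ω} [IsProbabilityMeasure P] {X : ℕ → Ω → 𝒳} {Z : ℕ → Ω → Bool}
    (hX : ∀ i, Measurable (X i)) (hZ : ∀ i, Measurable (Z i))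
    (hindep : iIndepFun (fun i ω => (X i ω, Z i ω)) P)
    (hlaw : ∀ i, P.map (fun ω => (X i ω, Z i ω)) = ν ⊗ₘ pstar) :
    TendstoInMeasure (P.prod ν)
      (fun (n : ℕ) (w : Ω × 𝒳) =>
        propensityEstimate h Q δ (fun i : Fin n => X i w.1) (fun i : Fin n => Z i w.1) w.2)
      atTop (fun w => unitProb h (fun j => δs j w.2) w.2 true) := by
  have hreg := lintegral_regressorSize_sq_ne_top hh
  have hfin : ∀ j, ∀ᵐ x ∂ν, regressorSize h j x ≠ ⊤ := by
    intro j
    filter_upwards [ae_lt_top ((measurable_regressorSize h j).pow_const 2) (hreg j)] with x hx htop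
    rw [htop] at hx
    simp at hx
  have hδ := hprior.measurable
  have hsm := measurable_unitProb_comp h hδs true
  have hem : ∀ n : ℕ, Measurable fun w : Ω × 𝒳 =>
      ‖propensityEstimate h Q δ (fun i : Fin n => X i w.1) (fun i : Fin n => Z i w.1) w.2 -
        unitProb h (fun j => δs j w.2) w.2 true‖ₑ := by
    intro n
    have e : Measurable fun w : Ω × 𝒳 =>
        ((((fun i : Fin n => X i w.1), (fun i : Fin n => Z i w.1)), w.2) :
          ((Fin n → 𝒳) × (Fin n → Bool)) × 𝒳) := by fun_prop
    exact (((measurable_propensityEstimate h Q hδ n).comp e).sub (hsm.comp measurable_snd)).enorm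
  refine tendstoInMeasure_of_ne_top fun ε hε hεtop => ?_
  simp only [edist_eq_enorm_sub]
  refine ENNReal.tendsto_nhds_zero.2 fun γ hγ => ?_
  -- the budget `γ` is split between the covariates outside `E`, Markov's inequality on `E`, and the
  -- samples with a large mean error
  obtain ⟨τ, hτ, hτγ⟩ : ∃ τ : ℝ, 0 < τ ∧ 3 * ENNReal.ofReal τ ≤ γ := by
    obtain ⟨t, ht0, ht⟩ := ENNReal.lt_iff_exists_nnreal_btwn.1
      (ENNReal.div_pos hγ.ne' (by norm_num : (3 : ℝ≥0∞) ≠ ⊤))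
    refine ⟨t, by exact_mod_cast ht0, ?_⟩
    rw [ENNReal.ofReal_coe_nnreal, mul_comm]
    exact (ENNReal.le_div_iff_mul_le (by simp) (by simp)).1 ht.le
  have hε0 : 0 < ε.toReal := ENNReal.toReal_pos hε.ne' hεtop
  obtain ⟨E, N, hE, hN, hCN, hRN, hνE⟩ := exists_truncation hprior h hfin
    (γ := ENNReal.ofReal τ) (by simpa using hτ)
  have hlim := tendsto_measure_setLIntegral_error hprior hδs hmodel hmass hreg hX hZ hindep hlaw hE
    hN hCN hRN (mul_pos hτ hε0)
  filter_upwards [ENNReal.tendsto_nhds_zero.1 hlim (ENNReal.ofReal τ) (by simpa using hτ)] with n hn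
  refine le_trans ?_ hτγ
  obtain ⟨e, he⟩ : ∃ e : Ω × 𝒳 → ℝ≥0∞, e = fun w =>
      ‖propensityEstimate h Q δ (fun i : Fin n => X i w.1) (fun i : Fin n => Z i w.1) w.2 -
        unitProb h (fun j => δs j w.2) w.2 true‖ₑ := ⟨_, rfl⟩
  have hem' : Measurable e := by rw [he]; exact hem n
  have hn' : P {ω | ENNReal.ofReal τ * ε < ∫⁻ x in E, e (ω, x) ∂ν} ≤ ENNReal.ofReal τ := by
    rw [ENNReal.ofReal_mul hτ.le, ENNReal.ofReal_toReal hεtop] at hn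
    rw [he]; exact hn
  change (P.prod ν) {w | ε ≤ ‖propensityEstimate h Q δ (fun i : Fin n => X i w.1)
    (fun i : Fin n => Z i w.1) w.2 - unitProb h (fun j => δs j w.2) w.2 true‖ₑ} ≤ _
  have hset : {w : Ω × 𝒳 | ε ≤ ‖propensityEstimate h Q δ (fun i : Fin n => X i w.1)
    (fun i : Fin n => Z i w.1) w.2 - unitProb h (fun j => δs j w.2) w.2 true‖ₑ} =
      {w | ε ≤ e w} := by rw [he]
  rw [hset, Measure.prod_apply (measurableSet_le measurable_const hem')]
  exact lintegral_measure_ge_le hem' hE hε.ne' hεtop hνE hn'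

end

end BRS

theorem theorem1 {q J : ℕ} {Ω Θ : Type*} [MeasurableSpace Ω] [MeasurableSpace Θ]
    -- the law of the covariates
    (ν : Measure (EuclideanSpace ℝ (Fin q))) [IsProbabilityMeasure ν]
    -- the estimate distributions of the candidate models
    (h : Fin J → Kernel (EuclideanSpace ℝ (Fin q)) ℝ) [∀ j, IsMarkovKernel (h j)]
    (hh : ∀ j, MemLp (fun p : EuclideanSpace ℝ (Fin q) × ℝ => p.2) 2 (ν ⊗ₘ h j))
    -- the Gaussian process prior of the weight functions
    (Q : Measure Θ) [IsProbabilityMeasure Q]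
    (δ : Fin (J + 1) → EuclideanSpace ℝ (Fin q) → Θ → ℝ)
    (m : Fin (J + 1) → EuclideanSpace ℝ (Fin q) → ℝ)
    (C : Fin (J + 1) → EuclideanSpace ℝ (Fin q) → EuclideanSpace ℝ (Fin q) → ℝ)
    (hprior : BRS.IsGPPrior ν Q δ m C)
    -- the true treatment law lies inside the synthesis model, with weight functions around which
    -- the prior puts positive mass
    (pstar : Kernel (EuclideanSpace ℝ (Fin q)) Bool) [IsMarkovKernel pstar]
    (δstar : Fin (J + 1) → EuclideanSpace ℝ (Fin q) → ℝ)
    (hδstar : ∀ j, MemLp (δstar j) 2 ν)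
    (hmodel : ∀ᵐ x ∂ν, ∀ z : Bool,
      (pstar x).real {z} = BRS.unitProb h (fun j => δstar j x) x z)
    (hmass : ∀ ε : ℝ≥0∞, 0 < ε →
      0 < Q {θ | ∀ j, eLpNorm (fun x => δ j x θ - δstar j x) 2 ν < ε})
    -- the data: independent copies of (X, Z)
    (P : Measure Ω) [IsProbabilityMeasure P]
    (X : ℕ → Ω → EuclideanSpace ℝ (Fin q)) (Z : ℕ → Ω → Bool)
    (hX : ∀ i, Measurable (X i)) (hZ : ∀ i, Measurable (Z i))
    (hindep : iIndepFun (fun i ω => (X i ω, Z i ω)) P)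
    (hlaw : ∀ i, P.map (fun ω => (X i ω, Z i ω)) = ν ⊗ₘ pstar) :
    TendstoInMeasure (P.prod ν)
      (fun (n : ℕ) (w : Ω × EuclideanSpace ℝ (Fin q)) =>
        BRS.propensityEstimate h Q δ (fun i : Fin n => X i w.1) (fun i : Fin n => Z i w.1) w.2)
      atTop
      (fun w => (pstar w.2).real {true}) := by
  -- the true weight functions have measurable versions, which change neither the model nor the
  -- distances in `L²(ν)`
  have hae : ∀ j, δstar j =ᵐ[ν] (hδstar j).aestronglyMeasurable.mk (δstar j) := fun j =>
    (hδstar j).aestronglyMeasurable.ae_eq_mk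
  have hunit : ∀ᵐ x ∂ν, ∀ z, BRS.unitProb h (fun j => δstar j x) x z =
      BRS.unitProb h (fun j => (hδstar j).aestronglyMeasurable.mk (δstar j) x) x z := by
    filter_upwards [ae_all_iff.2 hae] with x hx z
    simp only [hx]
  have hmodel' : ∀ᵐ x ∂ν, ∀ z : Bool, (pstar x).real {z} =
      BRS.unitProb h (fun j => (hδstar j).aestronglyMeasurable.mk (δstar j) x) x z := by
    filter_upwards [hmodel, hunit] with x h1 h2 z
    rw [h1, h2]
  have hmass' : ∀ ε : ℝ≥0∞, 0 < ε → 0 < Q {θ | ∀ j, eLpNorm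
      (fun x => δ j x θ - (hδstar j).aestronglyMeasurable.mk (δstar j) x) 2 ν < ε} := by
    intro ε hε
    have h1 : ∀ θ j, eLpNorm
        (fun x => δ j x θ - (hδstar j).aestronglyMeasurable.mk (δstar j) x) 2 ν =
        eLpNorm (fun x => δ j x θ - δstar j x) 2 ν := by
      intro θ j
      refine eLpNorm_congr_ae ?_
      filter_upwards [hae j] with x hx
      rw [hx]
    simp only [h1]
    exact hmass ε hε
  refine (BRS.tendstoInMeasure_propensityEstimate hh hprior
    (fun j => (hδstar j).aestronglyMeasurable.stronglyMeasurable_mk.measurable) hmodel' hmass' hX hZ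
    hindep hlaw).congr_right ?_
  filter_upwards [Measure.quasiMeasurePreserving_snd.ae hmodel'] with w hw
  exact (hw true).symm
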